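/- Fix $q\in(0,1)$. For integers $L\ge 2$, $H\ge 0$, let $\mu$ be the product probability measure on $\{0,1\}^{\{1,\dots,L\}\times\{1,\dots,H\}}$ given by $$\mu(\alpha)=\prod_{i=1}^L\prod_{h=1}^H\frac{q^{2h\alpha_{(i,h)}}}{1+q^{2h}},$$ and write $\alpha=(\eta_1,\dots,\eta_L)$ with $\eta_i=\pi_i\alpha\in\{0,1\}^H$ the restriction of $\alpha$ to the $i$-th stick $\{i\}\times\{1,\dots,H\}$. Let $n(\eta)=\sum_h\eta(h)$ be the number of particles in a stick. For $0\le N\le LH$ let $\nu=\mu\big(\,\cdot\mid\sum_{i=1}^L n(\eta_i)=N\big)$, let $\nu_0=\nu\circ\pi_1^{-1}$ be its marginal on one stick, and let $\langle\varphi,\psi\rangle=\nu_0(\varphi\psi)$ be the scalar product of the real Hilbert space $\mathbb H=L^2(\{0,1\}^H,\nu_0)$. Let $K:\mathbb H\to\mathbb H$ be the self-adjoint stochastic operator $K\varphi=\nu(\varphi\circ\pi_2\mid\mathcal F_1)$, where $\mathcal F_1$ is the $\sigma$-algebra generated by $\eta_1$; equivalently, $\langle\varphi,K\psi\rangle=\nu\big((\varphi\circ\pi_1)(\psi\circ\pi_2)\big)$.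 Put $\rho=N/L$ and $\bar n=n-\rho$. **Theorem.** For every $q\in(0,1)$ there exist constants $\delta>0$, $k<\infty$ and $L_0<\infty$, independent of $N$ and $H$, such that for all $L\ge L_0$ with $L\ge 2$, all $H$ and all $0\le N\le LH$: 1. $\big|\langle\varphi,K\varphi\rangle\big|\le k\,L^{-1-\delta}\,\langle\varphi,\varphi\rangle$ for all $\varphi\in\mathbb H$ with $\nu_0(\varphi)=0$ and $\langle\varphi,\bar n\rangle=0$; 2. every $\lambda$ in the spectrum of $K$ satisfies $\lambda=1$, or $\lambda=-\frac1{L-1}$, or $|\lambda|\le k\,L^{-1-\delta}$. -/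

import Mathlib

open MeasureTheory ProbabilityTheory

noncomputable section

namespace StickModel

/-- Configurations `η ∈ {0,1}^H` of a single stick. The index `h : Fin H` is the site at height
`h + 1`; `true` means that the site is occupied. -/
abbrev Stick (H : ℕ) : Type := Fin H → Bool

/-- Configurations `α = (η_1, …, η_L) ∈ {0,1}^Λ` on the rectangle made of `L` sticks of
height `H`. -/
abbrev Config (L H : ℕ) : Type := Fin L → Stick H

/-- The number `n(η)` of particles in a stick. -/
def stickCount {H : ℕ} (η : Stick H) : ℕ := ∑ h, (η h).toNat

/-- The total number of particles of a configuration. -/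
def totalCount {L H : ℕ} (α : Config L H) : ℕ := ∑ i, stickCount (α i)

/-- The weight `∏_i ∏_h q^{2hα_{(i,h)}} / (1 + q^{2h})`, with heights `h = 1, …, H`. -/
def weight (q : ℝ) {L H : ℕ} (α : Config L H) : ℝ :=
  ∏ i : Fin L, ∏ h : Fin H,
    q ^ (2 * ((h : ℕ) + 1) * (α i h).toNat) / (1 + q ^ (2 * ((h : ℕ) + 1)))

/-- The product probability measure `μ` on configurations. -/
def grandCanonical (q : ℝ) (L H : ℕ) : Measure (Config L H) :=
  ∑ α : Config L H, ENNReal.ofReal (weight q α) • Measure.dirac α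

/-- The canonical measure `ν = μ(· | ∑_i n_i = N)`. -/
def canonical (q : ℝ) (L H N : ℕ) : Measure (Config L H) :=
  (grandCanonical q L H)[|{α | totalCount α = N}]

/-- The marginal `ν₀ = ν ∘ π₁⁻¹` of `ν` on the first stick. -/
def stickMarginal (q : ℝ) (L H N : ℕ) [NeZero L] : Measure (Stick H) :=
  (canonical q L H N).map fun α => α 0

/-- The space `L²(ν₀)` of single-stick functions. -/
abbrev StickL2 (q : ℝ) (L H N : ℕ) [NeZero L] : Type := Lp ℝ 2 (stickMarginal q L H N)

instance (q : ℝ) (L H : ℕ) : IsFiniteMeasure (grandCanonical q L H) := by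
  refine ⟨?_⟩
  simp [grandCanonical, Measure.finsetSum_apply, ENNReal.sum_lt_top]

instance (q : ℝ) (L H N : ℕ) : IsFiniteMeasure (canonical q L H N) := by
  unfold canonical; infer_instance

instance (q : ℝ) (L H N : ℕ) [NeZero L] : IsFiniteMeasure (stickMarginal q L H N) := by
  unfold stickMarginal; infer_instance

theorem grandCanonical_map_perm (q : ℝ) (L H : ℕ) (σ : Equiv.Perm (Fin L)) :
    (grandCanonical q L H).map (fun α => α ∘ σ) = grandCanonical q L H := by
  have hm : Measurable (fun α : Config L H => α ∘ σ) := measurable_of_finite _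
  unfold grandCanonical
  rw [← Measure.mapₗ_apply_of_measurable hm, map_sum]
  simp only [Measure.mapₗ_apply_of_measurable hm, Measure.map_smul, Measure.map_dirac' hm]
  refine Fintype.sum_equiv (σ.arrowCongr (Equiv.refl (Stick H))).symm _ _ fun α => ?_
  have h1 : (σ.arrowCongr (Equiv.refl (Stick H))).symm α = α ∘ σ := by
    ext i; simp [Equiv.arrowCongr]
  have h2 : weight q (α ∘ σ) = weight q α := by
    unfold weight
    exact Fintype.prod_equiv σ _ _ fun i => rfl
  rw [h1, h2]

theorem canonical_map_perm (q : ℝ) (L H N : ℕ) (σ : Equiv.Perm (Fin L)) :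
    (canonical q L H N).map (fun α => α ∘ σ) = canonical q L H N := by
  have hm : Measurable (fun α : Config L H => α ∘ σ) := measurable_of_finite _
  have hpre : (fun α : Config L H => α ∘ σ) ⁻¹' {α | totalCount α = N}
      = {α | totalCount α = N} := by
    ext α
    have : totalCount (α ∘ σ) = totalCount α := by
      unfold totalCount
      exact Fintype.sum_equiv σ _ _ fun i => rfl
    simp [this]
  have hs : MeasurableSet {α : Config L H | totalCount α = N} := MeasurableSet.of_discrete
  unfold canonical ProbabilityTheory.cond
  rw [Measure.map_smul]
  congr 1
  conv_rhs => rw [← grandCanonical_map_perm q L H σ, Measure.restrict_map hm hs, hpre]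

/-- Every stick has the same marginal under `ν`. -/
theorem measurePreserving_proj (q : ℝ) (L H N : ℕ) [NeZero L] (i : Fin L) :
    MeasurePreserving (fun α : Config L H => α i)
      (canonical q L H N) (stickMarginal q L H N) := by
  refine ⟨measurable_of_finite _, ?_⟩
  have hi : (fun α : Config L H => α i)
      = (fun α : Config L H => α 0) ∘ fun α => α ∘ Equiv.swap 0 i := by
    funext α
    simp
  rw [hi, ← Measure.map_map (measurable_of_finite _) (measurable_of_finite _),
    canonical_map_perm, stickMarginal]

/-- The isometry `φ ↦ φ ∘ π_i` from `L²(ν₀)` to `L²(ν)`. -/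
def lift (q : ℝ) (L H N : ℕ) [NeZero L] (i : Fin L) :
    StickL2 q L H N →ₗᵢ[ℝ] Lp ℝ 2 (canonical q L H N) :=
  Lp.compMeasurePreservingₗᵢ ℝ (fun α => α i) (measurePreserving_proj q L H N i)

/-- The operator `K` on `L²(ν₀)` given by `⟨φ, K ψ⟩ = ν((φ ∘ π₁)(ψ ∘ π₂))`; equivalently `K φ` is
`ν(φ ∘ π₂ | F₁)` seen as a function of the first stick (`inner_stickOperator` and
`stickOperator_eq_condExp`). -/
def stickOperator (q : ℝ) (L H N : ℕ) [L.AtLeastTwo] : StickL2 q L H N →L[ℝ] StickL2 q L H N :=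
  (ContinuousLinearMap.adjoint (lift q L H N 0).toContinuousLinearMap).comp
    (lift q L H N 1).toContinuousLinearMap

/-- The centered particle number `n̄ = n - ρ`, with `ρ = N / L`, as an element of `L²(ν₀)`. -/
def centeredCount (q : ℝ) (L H N : ℕ) [NeZero L] : StickL2 q L H N :=
  MemLp.toLp (fun η : Stick H => (stickCount η : ℝ) - (N : ℝ) / (L : ℝ)) MemLp.of_discrete

theorem lift_coeFn (q : ℝ) (L H N : ℕ) [NeZero L] (i : Fin L) (φ : StickL2 q L H N) :
    (lift q L H N i φ : Config L H → ℝ) =ᵐ[canonical q L H N] fun α => φ (α i) :=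
  Lp.coeFn_compMeasurePreserving φ (measurePreserving_proj q L H N i)

/-- The bilinear form of `K`. -/
theorem inner_stickOperator (q : ℝ) (L H N : ℕ) [L.AtLeastTwo] (φ ψ : StickL2 q L H N) :
    inner ℝ φ (stickOperator q L H N ψ) = ∫ α, φ (α 0) * ψ (α 1) ∂(canonical q L H N) := by
  rw [stickOperator, ContinuousLinearMap.comp_apply, ContinuousLinearMap.adjoint_inner_right,
    L2.inner_def]
  refine integral_congr_ae ?_
  filter_upwards [lift_coeFn q L H N 0 φ, lift_coeFn q L H N 1 ψ] with α h0 h1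
  simp only [LinearIsometry.coe_toContinuousLinearMap, h0, h1]
  simp [mul_comm]

/-- `K φ` is the conditional expectation of `φ ∘ π₂` given the first stick. -/
theorem stickOperator_eq_condExp (q : ℝ) (L H N : ℕ) [L.AtLeastTwo] (φ : StickL2 q L H N) :
    (fun α : Config L H => stickOperator q L H N φ (α 0)) =ᵐ[canonical q L H N]
      (canonical q L H N)[fun α : Config L H => φ (α 1) |
        MeasurableSpace.comap (fun α : Config L H => α 0) inferInstance] := by
  have hm : MeasurableSpace.comap (fun α : Config L H => α 0) inferInstance
      ≤ (inferInstance : MeasurableSpace (Config L H)) :=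
    (measurable_of_finite (fun α : Config L H => α 0)).comap_le
  refine ae_eq_condExp_of_forall_setIntegral_eq hm Integrable.of_finite
    (fun _ _ _ => Integrable.of_finite) ?_ ?_
  · rintro _ ⟨t, ht, rfl⟩ -
    have hs : MeasurableSet ((fun α : Config L H => α 0) ⁻¹' t) := MeasurableSet.of_discrete
    have key := inner_stickOperator q L H N
      (indicatorConstLp 2 ht (measure_ne_top _ _) (1 : ℝ)) φ
    rw [L2.inner_indicatorConstLp_one] at key
    rw [← integral_indicator hs]
    have h3 := (measurePreserving_proj q L H N 0).quasiMeasurePreserving.ae_eq_comp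
      (indicatorConstLp_coeFn (p := 2) (hs := ht)
        (hμs := measure_ne_top (stickMarginal q L H N) t) (c := (1 : ℝ)))
    have h4 : ∫ α in (fun α : Config L H => α 0) ⁻¹' t, φ (α 1) ∂(canonical q L H N)
        = ∫ η in t, stickOperator q L H N φ η ∂(stickMarginal q L H N) := by
      rw [key, ← integral_indicator hs]
      refine integral_congr_ae ?_
      filter_upwards [h3] with α h
      simp only [Function.comp_apply] at h
      rw [h]
      by_cases hα : α 0 ∈ t <;> simp [hα]
    rw [h4, integral_indicator hs]
    exact (setIntegral_map ht AEStronglyMeasurable.of_discrete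
      (measurable_of_finite _).aemeasurable).symm
  · refine (StronglyMeasurable.aestronglyMeasurable ?_)
    exact (StronglyMeasurable.of_discrete (f := (stickOperator q L H N φ : Stick H → ℝ))).comp_measurable
      (comap_measurable _)

end StickModel

end

open Polynomial

/-! Write `L = k + 2`. Given the first stick, the second depends on it only through the number `n`
of particles it holds, so an eigenfunction of `K` with nonzero eigenvalue is a function `F` of `n`
on the admissible numbers. The eigenvalue equation then reads `lam * F n = condMean P k (N - n) F`,
where `P` generates the particle number of one stick. By exchangeability an affine `F` goes to an
affine function, with slope multiplied by `-1 / (k + 1)`. This produces the eigenvalues `1` and `-1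
/ (L - 1)`.

Every other eigenvalue is controlled by second differences. If those of `f` are at most `D`, those
of `M ↦ condMean P k M f` are at most `κ D (k + 1) ^ (-4/3)`, uniformly in height and density
(`exists_condMeanDiff_stickPoly_le`). Evaluating the eigenvalue equation where the second difference
of `F` is largest gives `|lam| ≤ κ (k + 1) ^ (-4/3)` unless `F` is affine
(`abs_le_or_affine_of_eigen`, `eigen_trichotomy`). The form bound follows from diagonalizing `K` on
the invariant subspace orthogonal to `1` and `n̄`, which contains no nonzero affine function of `n`
(`abs_inner_le_of_eigenvalues_le`).

The contraction has two regimes, separated at `τ = (k + 1) ^ (1/3)` particles or holes. When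
particles are few, subtract an affine function so that `f` vanishes at `0` and `1`. What remains is
at most `D / 2 * m (m - 1)`, whose mean is of order `(τ / (k + 1)) ^ 2`
(`abs_condMean_le_of_low_density`). Few holes reduce to this case by `condMean_reflect`. Otherwise
tilt the activities so that the mean total is `M + 1`. The `k + 1` sticks then have total variance
`Λ ≥ c τ`, and a local limit estimate by Fourier integrals gives `D / ((k + 1) Λ)`
(`exists_condMeanDiff_bernoulliPoly_le`). Both bounds are of order `τ ^ (-4)`, which is why the
threshold is the cube root. -/

/-- The linear functional on polynomials sending `X ^ m` to `g m`. -/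
noncomputable def polyMean {E : Type*} [AddCommGroup E] [Module ℝ E] (g : ℕ → E) :
    ℝ[X] →ₗ[ℝ] E :=
  Polynomial.lsum fun m => LinearMap.toSpanSingleton ℝ E (g m)

/-! ### Means against the coefficients of a polynomial. -/

section polyMean

variable {E : Type*} [AddCommGroup E] [Module ℝ E]

theorem polyMean_eq_sum (g : ℕ → E) (P : ℝ[X]) :
    polyMean g P = ∑ m ∈ P.support, P.coeff m • g m := by
  simp [polyMean, Polynomial.lsum_apply, Polynomial.sum]

@[simp] theorem polyMean_monomial (g : ℕ → E) (m : ℕ) (a : ℝ) :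
    polyMean g (monomial m a) = a • g m := by
  simp [polyMean, Polynomial.lsum_apply, Polynomial.sum_monomial_index]

@[simp] theorem polyMean_one (g : ℕ → E) : polyMean g 1 = g 0 := by
  have := polyMean_monomial g 0 1
  simpa using this

theorem polyMean_mul_X (g : ℕ → E) (P : ℝ[X]) :
    polyMean g (P * X) = polyMean (fun m => g (m + 1)) P := by
  induction P using Polynomial.induction_on' with
  | add p q hp hq => simp [add_mul, hp, hq]
  | monomial m a => simp [monomial_mul_X]

/-- A Bernoulli factor in the generating polynomial adds an independent Bernoulli variable: the mean
is averaged with its shift by one. This drives the moment induction. -/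
theorem polyMean_mul_bernoulli (g : ℕ → E) (P : ℝ[X]) (a : ℝ) :
    polyMean g (P * (C (1 - a) + C a * X))
      = (1 - a) • polyMean g P + a • polyMean (fun m => g (m + 1)) P := by
  have : P * (C (1 - a) + C a * X) = (1 - a) • P + a • (P * X) := by
    simp only [smul_eq_C_mul]; ring
  rw [this, map_add, map_smul, map_smul, polyMean_mul_X]

theorem polyMean_add (g h : ℕ → E) (P : ℝ[X]) :
    polyMean (fun m => g m + h m) P = polyMean g P + polyMean h P := by
  simp [polyMean_eq_sum, Finset.sum_add_distrib]

theorem polyMean_sub (g h : ℕ → E) (P : ℝ[X]) :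
    polyMean (fun m => g m - h m) P = polyMean g P - polyMean h P := by
  simp [polyMean_eq_sum, smul_sub]

theorem polyMean_const_mul (c : ℝ) (g : ℕ → ℝ) (P : ℝ[X]) :
    polyMean (fun m => c * g m) P = c * polyMean g P := by
  simp only [polyMean_eq_sum, Finset.mul_sum, smul_eq_mul]
  exact Finset.sum_congr rfl fun _ _ => by ring

theorem polyMean_const_mul_complex (c : ℂ) (g : ℕ → ℂ) (P : ℝ[X]) :
    polyMean (fun m => c * g m) P = c * polyMean g P := by
  simp only [polyMean_eq_sum, Finset.mul_sum, Complex.real_smul]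
  exact Finset.sum_congr rfl fun _ _ => by ring

theorem polyMean_ofReal (g : ℕ → ℝ) (P : ℝ[X]) :
    polyMean (fun m => (g m : ℂ)) P = (polyMean g P : ℂ) := by
  simp [polyMean_eq_sum]

theorem polyMean_mono {P : ℝ[X]} (hP : ∀ m, 0 ≤ P.coeff m) {g h : ℕ → ℝ}
    (hgh : ∀ m, g m ≤ h m) : polyMean g P ≤ polyMean h P := by
  simp only [polyMean_eq_sum, smul_eq_mul]
  exact Finset.sum_le_sum fun m _ => mul_le_mul_of_nonneg_left (hgh m) (hP m)

theorem norm_polyMean_le {P : ℝ[X]} (hP : ∀ m, 0 ≤ P.coeff m) (g : ℕ → ℂ) :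
    ‖polyMean g P‖ ≤ polyMean (fun m => ‖g m‖) P := by
  simp only [polyMean_eq_sum, smul_eq_mul]
  refine (norm_sum_le _ _).trans (le_of_eq (Finset.sum_congr rfl fun m _ => ?_))
  rw [norm_smul, Real.norm_of_nonneg (hP m)]

theorem abs_polyMean_le {P : ℝ[X]} (hP : ∀ m, 0 ≤ P.coeff m) (g : ℕ → ℝ) :
    |polyMean g P| ≤ polyMean (fun m => |g m|) P := by
  simp only [polyMean_eq_sum, smul_eq_mul]
  refine (Finset.abs_sum_le_sum_abs _ _).trans (le_of_eq (Finset.sum_congr rfl fun m _ => ?_))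
  rw [abs_mul, abs_of_nonneg (hP m)]

theorem polyMean_pow (z : ℂ) (P : ℝ[X]) : polyMean (fun m => z ^ m) P = aeval z P := by
  induction P using Polynomial.induction_on' with
  | add p q hp hq => simp [hp, hq]
  | monomial m a => simp [aeval_monomial]

end polyMean

/-! ### Conditional means given the total, and their second differences. -/

/-- The polynomial with coefficients `f m * P.coeff m`. -/
noncomputable def weigh (P : ℝ[X]) (f : ℕ → ℝ) : ℝ[X] :=
  ∑ m ∈ P.support, monomial m (P.coeff m * f m)

@[simp] theorem coeff_weigh (P : ℝ[X]) (f : ℕ → ℝ) (m : ℕ) :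
    (weigh P f).coeff m = P.coeff m * f m := by
  simp only [weigh, finsetSum_coeff, coeff_monomial, Finset.sum_ite_eq', mem_support_iff]
  split_ifs with h
  · rfl
  · simp [not_not.1 h]

theorem polyMean_weigh {E : Type*} [AddCommGroup E] [Module ℝ E] (g : ℕ → E) (P : ℝ[X])
    (f : ℕ → ℝ) : polyMean g (weigh P f) = polyMean (fun m => f m • g m) P := by
  rw [polyMean_eq_sum _ P, weigh, map_sum]
  exact Finset.sum_congr rfl fun m _ => by rw [polyMean_monomial, mul_smul]

theorem weigh_add (P : ℝ[X]) (f g : ℕ → ℝ) :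
    weigh P (fun m => f m + g m) = weigh P f + weigh P g := by
  ext m; simp [mul_add]

theorem weigh_const_mul (P : ℝ[X]) (c : ℝ) (f : ℕ → ℝ) :
    weigh P (fun m => c * f m) = C c * weigh P f := by
  ext m; simp; ring

theorem weigh_const (P : ℝ[X]) (c : ℝ) : weigh P (fun _ => c) = C c * P := by
  ext m; simp; ring

theorem weigh_natCast (P : ℝ[X]) : weigh P (fun m => (m : ℝ)) = X * derivative P := by
  ext m
  cases m with
  | zero => simp
  | succ m => simp [coeff_X_mul, coeff_derivative]

/-- The mean of `f` at the first of `k + 1` independent integers, each with weights the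
coefficients of `P`, conditioned on their sum being `M`. -/
noncomputable def condMean (P : ℝ[X]) (k M : ℕ) (f : ℕ → ℝ) : ℝ :=
  (weigh P f * P ^ k).coeff M / (P ^ (k + 1)).coeff M

theorem condMean_add (P : ℝ[X]) (k M : ℕ) (f g : ℕ → ℝ) :
    condMean P k M (fun m => f m + g m) = condMean P k M f + condMean P k M g := by
  simp [condMean, weigh_add, add_mul, add_div]

theorem condMean_const_mul (P : ℝ[X]) (k M : ℕ) (c : ℝ) (f : ℕ → ℝ) :
    condMean P k M (fun m => c * f m) = c * condMean P k M f := by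
  simp [condMean, weigh_const_mul, mul_assoc, mul_div_assoc]

theorem condMean_const {P : ℝ[X]} {k M : ℕ} (h : (P ^ (k + 1)).coeff M ≠ 0) (c : ℝ) :
    condMean P k M (fun _ => c) = c := by
  rw [condMean, weigh_const, mul_assoc, ← pow_succ', coeff_C_mul, mul_div_assoc, div_self h,
    mul_one]

/-- The `k + 1` variables are exchangeable, so each has mean `M / (k + 1)`. In polynomial form, `X *
derivative` applied to `P ^ (k + 1)` gives `k + 1` equal terms and multiplies the coefficient of `X
^ M` by `M`. -/
theorem condMean_natCast {P : ℝ[X]} {k M : ℕ} (h : (P ^ (k + 1)).coeff M ≠ 0) :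
    condMean P k M (fun m => (m : ℝ)) = M / (k + 1) := by
  have h1 : X * derivative (P ^ (k + 1)) = C ((k : ℝ) + 1) * (weigh P (fun m => (m : ℝ)) * P ^ k) := by
    rw [weigh_natCast, derivative_pow]
    simp; ring
  have h2 : (X * derivative (P ^ (k + 1))).coeff M = M * (P ^ (k + 1)).coeff M := by
    rw [← weigh_natCast, coeff_weigh, mul_comm]
  rw [h1, coeff_C_mul] at h2
  rw [condMean]
  have hk : (k : ℝ) + 1 ≠ 0 := by positivity
  field_simp
  linarith

theorem condMean_affine {P : ℝ[X]} {k M : ℕ} (h : (P ^ (k + 1)).coeff M ≠ 0) (a b : ℝ) :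
    condMean P k M (fun m => a + b * m) = a + b * (M / (k + 1)) := by
  rw [condMean_add, condMean_const h, condMean_const_mul, condMean_natCast h]

/-- Tilting multiplies numerator and denominator by the same factor `c ^ (k + 1) * a ^ M`, so the
conditional law does not see it. This frees the choice of density in the bulk estimate. -/
theorem condMean_scale {P Q : ℝ[X]} {c a : ℝ} (hc : c ≠ 0) (ha : a ≠ 0)
    (hQ : Q = C c * P.comp (C a * X)) (k M : ℕ) (f : ℕ → ℝ) :
    condMean Q k M f = condMean P k M f := by
  have h1 : weigh Q f = C c * (weigh P f).comp (C a * X) := by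
    ext m; simp [hQ, comp_C_mul_X_coeff]; ring
  have h2 (j : ℕ) : Q ^ j = C (c ^ j) * (P ^ j).comp (C a * X) := by
    rw [hQ, mul_pow, ← C_pow, pow_comp]
  have h3 : weigh Q f * Q ^ k = C (c ^ (k + 1)) * (weigh P f * P ^ k).comp (C a * X) := by
    rw [h1, h2, mul_comp, pow_succ, C_mul]; ring
  rw [condMean, condMean, h3, h2, coeff_C_mul, coeff_C_mul, comp_C_mul_X_coeff,
    comp_C_mul_X_coeff]
  rw [mul_div_mul_left _ _ (pow_ne_zero _ hc), mul_div_mul_right _ _ (pow_ne_zero _ ha)]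

/-- The second difference of `M ↦ condMean P k M f` centred at `M + 1`. -/
noncomputable def condMeanDiff (P : ℝ[X]) (k M : ℕ) (f : ℕ → ℝ) : ℝ :=
  condMean P k (M + 2) f - 2 * condMean P k (M + 1) f + condMean P k M f

/-- The conditional mean of an affine function is affine in `M`. Hence `f` may be normalized by any
affine function before estimating. -/
theorem condMeanDiff_add_affine {P : ℝ[X]} {k M : ℕ} (h0 : (P ^ (k + 1)).coeff M ≠ 0)
    (h1 : (P ^ (k + 1)).coeff (M + 1) ≠ 0) (h2 : (P ^ (k + 1)).coeff (M + 2) ≠ 0)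
    (f : ℕ → ℝ) (a b : ℝ) :
    condMeanDiff P k M (fun m => f m + (a + b * m)) = condMeanDiff P k M f := by
  simp only [condMeanDiff, condMean_add P k _ f, condMean_affine h0, condMean_affine h1,
    condMean_affine h2]
  push_cast
  ring

/-! ### Moments of sums of independent Bernoulli variables -/

/-- The generating polynomial of a sum of independent Bernoulli variables. -/
noncomputable def bernoulliPoly {ι : Type*} (s : Finset ι) (p : ι → ℝ) : ℝ[X] :=
  ∏ i ∈ s, (C (1 - p i) + C (p i) * X)

section bernoulli

variable {ι : Type*} (s : Finset ι) (p : ι → ℝ)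

theorem coeff_bernoulliPoly_nonneg (hp : ∀ i, 0 ≤ p i ∧ p i ≤ 1) (m : ℕ) :
    0 ≤ (bernoulliPoly s p).coeff m := by
  classical
  induction s using Finset.induction_on generalizing m with
  | empty => simp only [bernoulliPoly, Finset.prod_empty, coeff_one]; split_ifs <;> norm_num
  | insert a s ha ih =>
    rw [bernoulliPoly, Finset.prod_insert ha, add_mul, mul_assoc, coeff_add, coeff_C_mul,
      coeff_C_mul]
    have h1 := (hp a).1
    have h2 := (hp a).2
    refine add_nonneg (mul_nonneg (by linarith) (ih m)) (mul_nonneg h1 ?_)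
    cases m with
    | zero => simp
    | succ m => rw [coeff_X_mul]; exact ih m

/-- Induction on the number of variables. The excess in the fourth-moment bound at each step is `6
(x (1 - x)) ^ 2`, which is nonnegative. -/
theorem polyMean_bernoulliPoly_moments (hp : ∀ i, 0 ≤ p i ∧ p i ≤ 1) :
    polyMean (fun _ => (1 : ℝ)) (bernoulliPoly s p) = 1 ∧
    polyMean (fun m => (m : ℝ) - ∑ i ∈ s, p i) (bernoulliPoly s p) = 0 ∧
    polyMean (fun m => ((m : ℝ) - ∑ i ∈ s, p i) ^ 2) (bernoulliPoly s p)
      = ∑ i ∈ s, p i * (1 - p i) ∧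
    polyMean (fun m => ((m : ℝ) - ∑ i ∈ s, p i) ^ 4) (bernoulliPoly s p)
      ≤ ∑ i ∈ s, p i * (1 - p i) + 3 * (∑ i ∈ s, p i * (1 - p i)) ^ 2 := by
  classical
  induction s using Finset.induction_on with
  | empty => simp [bernoulliPoly]
  | insert a s ha ih =>
    obtain ⟨i0, i1, i2, i4⟩ := ih
    have hP : bernoulliPoly (insert a s) p
        = bernoulliPoly s p * (C (1 - p a) + C (p a) * X) := by
      rw [bernoulliPoly, Finset.prod_insert ha, mul_comm]; rfl
    rw [hP, Finset.sum_insert ha, Finset.sum_insert ha]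
    simp only [polyMean_mul_bernoulli, smul_eq_mul, Nat.cast_add, Nat.cast_one]
    obtain ⟨h0, h1⟩ := hp a
    set ρ := ∑ i ∈ s, p i
    set v := ∑ i ∈ s, p i * (1 - p i)
    set P := bernoulliPoly s p
    set x := p a
    have e1 : ∀ c : ℝ, polyMean (fun m => (m : ℝ) - ρ + c) P = c := by
      intro c
      rw [polyMean_add (fun m => (m : ℝ) - ρ) (fun _ => c), i1]
      have := polyMean_const_mul c (fun _ => 1) P
      simp only [mul_one, i0] at this
      rw [this, zero_add]
    have e2 : ∀ c : ℝ, polyMean (fun m => ((m : ℝ) - ρ + c) ^ 2) P = v + c ^ 2 := by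
      intro c
      have : (fun m : ℕ => ((m : ℝ) - ρ + c) ^ 2)
          = fun m : ℕ => ((m : ℝ) - ρ) ^ 2 + (2 * c * ((m : ℝ) - ρ) + c ^ 2 * 1) := by
        ext m; ring
      rw [this, polyMean_add, polyMean_add, polyMean_const_mul, polyMean_const_mul, i0, i1, i2]
      ring
    -- The third moment needs no estimate: it is multiplied by the mean of the new centred variable,
    -- which is zero.
    set T := polyMean (fun m => ((m : ℝ) - ρ) ^ 3) P with hT
    have e4 : ∀ c : ℝ, polyMean (fun m => ((m : ℝ) - ρ + c) ^ 4) P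
        = polyMean (fun m => ((m : ℝ) - ρ) ^ 4) P + 4 * c * T + 6 * c ^ 2 * v + c ^ 4 := by
      intro c
      have : (fun m : ℕ => ((m : ℝ) - ρ + c) ^ 4)
          = fun m : ℕ => ((m : ℝ) - ρ) ^ 4 + (4 * c * ((m : ℝ) - ρ) ^ 3
            + (6 * c ^ 2 * ((m : ℝ) - ρ) ^ 2 + (4 * c ^ 3 * ((m : ℝ) - ρ) + c ^ 4 * 1))) := by
        ext m; ring
      rw [this, polyMean_add, polyMean_add, polyMean_add, polyMean_add, polyMean_const_mul,
        polyMean_const_mul, polyMean_const_mul, polyMean_const_mul, i0, i1, i2]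
      ring
    have s1 : (fun m : ℕ => (m : ℝ) - (x + ρ)) = fun m : ℕ => (m : ℝ) - ρ + (-x) := by
      ext m; ring
    have s2 : (fun m : ℕ => (m : ℝ) + 1 - (x + ρ)) = fun m : ℕ => (m : ℝ) - ρ + (1 - x) := by
      ext m; ring
    have s3 (j : ℕ) : (fun m : ℕ => ((m : ℝ) - (x + ρ)) ^ j)
        = fun m : ℕ => ((m : ℝ) - ρ + (-x)) ^ j := by
      ext m; ring_nf
    have s4 (j : ℕ) : (fun m : ℕ => ((m : ℝ) + 1 - (x + ρ)) ^ j)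
        = fun m : ℕ => ((m : ℝ) - ρ + (1 - x)) ^ j := by
      ext m; ring_nf
    refine ⟨by rw [i0]; ring, ?_, ?_, ?_⟩
    · rw [s1, s2, e1, e1]; ring
    · rw [s3, s4, e2, e2]; ring
    · rw [s3, s4, e4, e4]
      have hx : 0 ≤ x * (1 - x) := mul_nonneg h0 (by linarith)
      have : 0 ≤ x * (1 - x) * (x * (1 - x)) := mul_nonneg hx hx
      nlinarith [i4, this]

end bernoulli

/-! ### Fourier representation -/

theorem norm_exp_mul_I_sub_one_sub_le (x : ℝ) :
    ‖Complex.exp (x * Complex.I) - 1 - x * Complex.I‖ ≤ 2 * x ^ 2 := by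
  refine (Complex.norm_le_abs_re_add_abs_im _).trans ?_
  have hre : (Complex.exp (x * Complex.I) - 1 - x * Complex.I).re = Real.cos x - 1 := by
    simp [Complex.exp_ofReal_mul_I_re]
  have him : (Complex.exp (x * Complex.I) - 1 - x * Complex.I).im = Real.sin x - x := by
    simp [Complex.exp_ofReal_mul_I_im]
  rw [hre, him]
  have h1 : |Real.cos x - 1| ≤ x ^ 2 := by
    rw [abs_le]
    constructor <;> nlinarith [Real.one_sub_sq_div_two_le_cos (x := x), Real.cos_le_one x]
  have h2 : |Real.sin x - x| ≤ x ^ 2 := by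
    rw [← sq_abs x]
    rcases le_or_gt |x| 2 with h | h
    · rw [abs_sub_comm]
      refine (Real.abs_sub_sin_le x).trans ?_
      nlinarith [mul_nonneg (sq_nonneg |x|) (sub_nonneg.2 h), abs_nonneg x]
    · have : |Real.sin x - x| ≤ |x| + |x| :=
        (abs_sub _ _).trans (add_le_add Real.abs_sin_le_abs le_rfl)
      nlinarith
  linarith

theorem norm_exp_mul_I_sub_taylor_le (x : ℝ) :
    ‖Complex.exp (x * Complex.I) - 1 - x * Complex.I + (x ^ 2 / 2 : ℝ)‖ ≤ 2 * |x| ^ 3 := by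
  refine (Complex.norm_le_abs_re_add_abs_im _).trans ?_
  have hre : (Complex.exp (x * Complex.I) - 1 - x * Complex.I + (x ^ 2 / 2 : ℝ)).re
      = Real.cos x - 1 + x ^ 2 / 2 := by
    rw [Complex.add_re, Complex.ofReal_re]
    simp [Complex.exp_ofReal_mul_I_re]
  have him : (Complex.exp (x * Complex.I) - 1 - x * Complex.I + (x ^ 2 / 2 : ℝ)).im
      = Real.sin x - x := by
    rw [Complex.add_im, Complex.ofReal_im]
    simp [Complex.exp_ofReal_mul_I_im]
  rw [hre, him]
  have h2 : |Real.sin x - x| ≤ |x| ^ 3 := by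
    rw [abs_sub_comm]
    refine (Real.abs_sub_sin_le x).trans ?_
    have : 0 ≤ |x| ^ 3 := by positivity
    linarith
  have h1 : |Real.cos x - 1 + x ^ 2 / 2| ≤ |x| ^ 3 := by
    have hn : 0 ≤ Real.cos x - 1 + x ^ 2 / 2 := by
      linarith [Real.one_sub_sq_div_two_le_cos (x := x)]
    rw [abs_of_nonneg hn]
    have hx2 : x ^ 2 = |x| ^ 2 := (sq_abs x).symm
    rcases le_or_gt |x| 1 with h | h
    · have hc : Real.cos x = 1 - 2 * Real.sin (x / 2) ^ 2 := by
        have := Real.cos_sq' (x / 2)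
        have h' := Real.cos_two_mul (x / 2)
        rw [show 2 * (x / 2) = x by ring] at h'
        linarith
      have ha := Real.abs_sub_sin_le (x / 2)
      have hb : |x / 2 + Real.sin (x / 2)| ≤ |x / 2| + |x / 2| :=
        (abs_add_le _ _).trans (add_le_add le_rfl Real.abs_sin_le_abs)
      have hd : |x / 2| = |x| / 2 := by rw [abs_div, abs_two]
      rw [hd] at ha hb
      have hprod : Real.cos x - 1 + x ^ 2 / 2
          = 2 * ((x / 2 - Real.sin (x / 2)) * (x / 2 + Real.sin (x / 2))) := by
        rw [hc]; ring
      rw [hprod]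
      calc _ ≤ 2 * (|x / 2 - Real.sin (x / 2)| * |x / 2 + Real.sin (x / 2)|) := by
            rw [← abs_mul]; gcongr; exact le_abs_self _
        _ ≤ 2 * ((|x| / 2) ^ 3 / 6 * (|x| / 2 + |x| / 2)) := by gcongr
        _ = |x| ^ 3 * |x| / 24 := by ring
        _ ≤ |x| ^ 3 := by
            have : 0 ≤ |x| ^ 3 := by positivity
            nlinarith
    · have : |x| ^ 2 ≤ |x| ^ 3 := pow_le_pow_right₀ h.le (by norm_num)
      nlinarith [Real.cos_le_one x, sq_nonneg |x|]
  linarith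

theorem integral_exp_int_mul_I (n : ℤ) :
    ∫ t in (-Real.pi)..Real.pi, Complex.exp ((n * t : ℝ) * Complex.I)
      = if n = 0 then (2 * Real.pi : ℂ) else 0 := by
  split_ifs with h
  · subst h; simp; ring
  · have hc : (n : ℂ) * Complex.I ≠ 0 := by simp [h]
    have := integral_exp_mul_complex (a := -Real.pi) (b := Real.pi) hc
    have e : (fun t : ℝ => Complex.exp ((n * t : ℝ) * Complex.I))
        = fun t : ℝ => Complex.exp ((n : ℂ) * Complex.I * t) := by
      ext t; congr 1; push_cast; ring
    rw [e, this]
    have p : Complex.exp ((n : ℂ) * Complex.I * (Real.pi : ℝ))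
        = Complex.exp ((n : ℂ) * Complex.I * ((-Real.pi : ℝ) : ℂ)) := by
      rw [Complex.exp_eq_exp_iff_exists_int]
      exact ⟨n, by push_cast; ring⟩
    rw [p, sub_self, zero_div]

theorem integral_aeval_exp_mul_I (Q : ℝ[X]) (n : ℕ) :
    ∫ t in (-Real.pi)..Real.pi,
      aeval (Complex.exp ((t : ℝ) * Complex.I)) Q * Complex.exp (-(n * t : ℝ) * Complex.I)
      = 2 * Real.pi * Q.coeff n := by
  have hcont (Q : ℝ[X]) : Continuous fun t : ℝ =>
      aeval (Complex.exp ((t : ℝ) * Complex.I)) Q * Complex.exp (-(n * t : ℝ) * Complex.I) := by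
    refine Continuous.mul ?_ (by fun_prop)
    exact (Polynomial.continuous_aeval Q).comp (by fun_prop)
  induction Q using Polynomial.induction_on' with
  | add p q hp hq =>
    simp only [map_add, add_mul]
    rw [intervalIntegral.integral_add ((hcont p).intervalIntegrable _ _)
      ((hcont q).intervalIntegrable _ _), hp, hq]
    simp; ring
  | monomial m a =>
    have e : (fun t : ℝ => aeval (Complex.exp ((t : ℝ) * Complex.I)) (monomial m a)
        * Complex.exp (-(n * t : ℝ) * Complex.I))
        = fun t : ℝ => (a : ℂ) * Complex.exp ((((m : ℤ) - (n : ℤ) : ℤ) * t : ℝ) * Complex.I) := by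
      ext t
      rw [aeval_monomial, ← Complex.exp_nat_mul, mul_assoc, ← Complex.exp_add]
      congr 2
      push_cast; ring
    rw [e, intervalIntegral.integral_const_mul, integral_exp_int_mul_I, coeff_monomial]
    have : ((m : ℤ) - n = 0) ↔ m = n := by omega
    simp only [this]
    split_ifs
    · ring
    · simp

/-- The Fourier transform of `f` against the weights `P.coeff m`, centred at `ρ`. -/
noncomputable def charSum (P : ℝ[X]) (ρ : ℝ) (f : ℕ → ℝ) (t : ℝ) : ℂ :=
  polyMean (fun m => (f m : ℂ) * Complex.exp ((((m : ℝ) - ρ) * t : ℝ) * Complex.I)) P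

theorem charSum_eq_aeval (P : ℝ[X]) (ρ : ℝ) (f : ℕ → ℝ) (t : ℝ) :
    charSum P ρ f t
      = Complex.exp (-(ρ * t : ℝ) * Complex.I) * aeval (Complex.exp (t * Complex.I)) (weigh P f) := by
  rw [← polyMean_pow, polyMean_weigh, ← polyMean_const_mul_complex, charSum]
  congr 2
  ext m
  rw [Complex.real_smul, ← Complex.exp_nat_mul, mul_left_comm, ← Complex.exp_add]
  congr 2
  push_cast; ring

theorem continuous_charSum (P : ℝ[X]) (ρ : ℝ) (f : ℕ → ℝ) : Continuous (charSum P ρ f) := by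
  have : charSum P ρ f = fun t : ℝ => Complex.exp (-(ρ * t : ℝ) * Complex.I)
      * aeval (Complex.exp (t * Complex.I)) (weigh P f) := funext fun t => charSum_eq_aeval P ρ f t
  rw [this]
  exact Continuous.mul (by fun_prop)
    ((Polynomial.continuous_aeval (weigh P f)).comp (by fun_prop))

theorem weigh_one (P : ℝ[X]) : weigh P (fun _ => 1) = P := by
  ext m; simp

/-- Fourier inversion with each of the `k + 1` factors centred at `ρ`. The remaining character is
trivial exactly when `n = (k + 1) * ρ`. -/
theorem integral_charSum_mul_pow (P : ℝ[X]) (ρ : ℝ) (f : ℕ → ℝ) (k n : ℕ) :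
    ∫ t in (-Real.pi)..Real.pi, charSum P ρ f t * charSum P ρ (fun _ => 1) t ^ k
        * Complex.exp (-((n - (k + 1) * ρ) * t : ℝ) * Complex.I)
      = 2 * Real.pi * (weigh P f * P ^ k).coeff n := by
  rw [← integral_aeval_exp_mul_I]
  congr 1
  ext t
  rw [charSum_eq_aeval, charSum_eq_aeval, map_mul, map_pow, weigh_one, mul_pow,
    ← Complex.exp_nat_mul]
  have : Complex.exp (-(n * t : ℝ) * Complex.I) = Complex.exp (-(ρ * t : ℝ) * Complex.I)
      * Complex.exp (k * (-(ρ * t : ℝ) * Complex.I))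
      * Complex.exp (-((n - (k + 1) * ρ) * t : ℝ) * Complex.I) := by
    rw [← Complex.exp_add, ← Complex.exp_add]
    congr 1
    push_cast; ring
  rw [this]; ring

/-- The squared modulus is `1 - 2 p (1 - p) (1 - cos t)`, and `1 - cos t ≥ 2 t ^ 2 / π ^ 2` on `[-π,
π]`. -/
theorem norm_one_sub_add_mul_exp_le {p : ℝ} (h0 : 0 ≤ p) (h1 : p ≤ 1) {t : ℝ}
    (ht : |t| ≤ Real.pi) :
    ‖(1 - p : ℂ) + p * Complex.exp (t * Complex.I)‖
      ≤ Real.exp (-(2 / Real.pi ^ 2) * (p * (1 - p)) * t ^ 2) := by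
  have hsq : ‖(1 - p : ℂ) + p * Complex.exp (t * Complex.I)‖ ^ 2
      = 1 - 2 * (p * (1 - p)) * (1 - Real.cos t) := by
    rw [Complex.sq_norm, Complex.normSq_apply]
    simp [Complex.exp_ofReal_mul_I_re, Complex.exp_ofReal_mul_I_im]
    linear_combination p ^ 2 * Real.sin_sq_add_cos_sq t
  refine le_of_sq_le_sq ?_ (Real.exp_pos _).le
  rw [hsq, ← Real.exp_nat_mul]
  have hc := Real.cos_le_one_sub_mul_cos_sq ht
  have hp : 0 ≤ p * (1 - p) := mul_nonneg h0 (by linarith)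
  have h2 := Real.add_one_le_exp (-(2 * (p * (1 - p)) * (1 - Real.cos t)))
  refine le_trans (by linarith) (h2.trans (Real.exp_le_exp.2 ?_))
  push_cast
  nlinarith [mul_le_mul_of_nonneg_left hc hp]

theorem norm_charSum_bernoulliPoly_le {ι : Type*} (s : Finset ι) (p : ι → ℝ)
    (hp : ∀ i, 0 ≤ p i ∧ p i ≤ 1) (ρ : ℝ) {t : ℝ} (ht : |t| ≤ Real.pi) :
    ‖charSum (bernoulliPoly s p) ρ (fun _ => 1) t‖
      ≤ Real.exp (-(2 / Real.pi ^ 2) * (∑ i ∈ s, p i * (1 - p i)) * t ^ 2) := by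
  rw [charSum_eq_aeval, weigh_one, norm_mul]
  have h1 : ‖Complex.exp (-(ρ * t : ℝ) * Complex.I)‖ = 1 := by
    rw [← Complex.ofReal_neg, Complex.norm_exp_ofReal_mul_I]
  rw [h1, one_mul, bernoulliPoly, map_prod, norm_prod, Finset.mul_sum, Finset.sum_mul,
    Real.exp_sum]
  refine Finset.prod_le_prod (fun _ _ => norm_nonneg _) fun i _ => ?_
  have := norm_one_sub_add_mul_exp_le (hp i).1 (hp i).2 ht
  simpa using this

/-! ### Gaussian bounds for Fourier integrals -/

theorem exists_pow_mul_exp_neg_sq_le {c : ℝ} (hc : 0 < c) (j : ℕ) :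
    ∃ K : ℝ, 0 < K ∧ ∀ x : ℝ, 0 ≤ x → x ^ j * Real.exp (-c * x ^ 2) ≤ K := by
  refine ⟨j.factorial * Real.exp (1 / (4 * c)), by positivity, fun x hx => ?_⟩
  have h1 := Real.pow_div_factorial_le_exp x hx j
  rw [div_le_iff₀ (by positivity)] at h1
  have h2 : x - c * x ^ 2 ≤ 1 / (4 * c) := by
    rw [le_div_iff₀ (by positivity)]
    nlinarith [sq_nonneg (2 * c * x - 1)]
  calc x ^ j * Real.exp (-c * x ^ 2) ≤ Real.exp x * j.factorial * Real.exp (-c * x ^ 2) := by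
        gcongr
    _ = j.factorial * Real.exp (x - c * x ^ 2) := by
        rw [sub_eq_add_neg, Real.exp_add, neg_mul]; ring
    _ ≤ _ := by gcongr

theorem exists_norm_integral_le_of_gaussian {c : ℝ} (hc : 0 < c) (j : ℕ) :
    ∃ K : ℝ, 0 < K ∧ ∀ (Λ A : ℝ) (G : ℝ → ℂ), 0 < Λ → 0 ≤ A →
      (∀ t, |t| ≤ Real.pi → ‖G t‖ ≤ A * (|t| ^ j * Real.exp (-c * Λ * t ^ 2))) →
      ‖∫ t in (-Real.pi)..Real.pi, G t‖ ≤ A * K * (1 / √Λ) ^ (j + 1) := by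
  -- Half of the Gaussian exponent absorbs the power of `|t|`; the other half is integrated over the
  -- line.
  obtain ⟨K, hK, hKb⟩ := exists_pow_mul_exp_neg_sq_le (half_pos hc) j
  refine ⟨K * √(Real.pi / (c / 2)), by positivity, fun Λ A G hΛ hA hG => ?_⟩
  have hs : 0 < √Λ := Real.sqrt_pos.2 hΛ
  have hss : √Λ ^ 2 = Λ := Real.sq_sqrt hΛ.le
  have hpt : ∀ t : ℝ, |t| ^ j * Real.exp (-c * Λ * t ^ 2)
      ≤ K * (1 / √Λ) ^ j * Real.exp (-(c / 2 * Λ) * t ^ 2) := by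
    intro t
    have h := hKb (√Λ * |t|) (by positivity)
    have e : Real.exp (-c * Λ * t ^ 2) = Real.exp (-(c / 2) * (√Λ * |t|) ^ 2)
        * Real.exp (-(c / 2 * Λ) * t ^ 2) := by
      rw [← Real.exp_add, mul_pow, hss, sq_abs]; congr 1; ring
    have e2 : |t| ^ j = (1 / √Λ) ^ j * (√Λ * |t|) ^ j := by
      rw [← mul_pow]; congr 1; field_simp
    rw [e, e2]
    calc _ = (1 / √Λ) ^ j * ((√Λ * |t|) ^ j * Real.exp (-(c / 2) * (√Λ * |t|) ^ 2))
          * Real.exp (-(c / 2 * Λ) * t ^ 2) := by ring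
      _ ≤ (1 / √Λ) ^ j * K * Real.exp (-(c / 2 * Λ) * t ^ 2) := by gcongr
      _ = _ := by ring
  have hb : 0 < c / 2 * Λ := by positivity
  have hint := integrable_exp_neg_mul_sq hb
  have hle : -Real.pi ≤ Real.pi := by linarith [Real.pi_pos]
  have h1 : ‖∫ t in (-Real.pi)..Real.pi, G t‖
      ≤ ∫ t in (-Real.pi)..Real.pi, A * (K * (1 / √Λ) ^ j) * Real.exp (-(c / 2 * Λ) * t ^ 2) := by
    refine intervalIntegral.norm_integral_le_of_norm_le hle (Filter.Eventually.of_forall ?_)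
      ((hint.const_mul _).intervalIntegrable)
    intro t ht
    refine (hG t (abs_le.2 ⟨ht.1.le, ht.2⟩)).trans ?_
    rw [mul_assoc A]
    exact mul_le_mul_of_nonneg_left (hpt t) hA
  refine h1.trans ?_
  rw [intervalIntegral.integral_const_mul]
  have h2 : ∫ t in (-Real.pi)..Real.pi, Real.exp (-(c / 2 * Λ) * t ^ 2)
      ≤ √(Real.pi / (c / 2)) * (1 / √Λ) := by
    rw [intervalIntegral.integral_of_le hle]
    refine (MeasureTheory.setIntegral_le_integral hint
      (Filter.Eventually.of_forall fun t => (Real.exp_pos _).le)).trans ?_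
    rw [integral_gaussian, ← div_div, Real.sqrt_div' _ hΛ.le]
    exact le_of_eq (by ring)
  calc _ ≤ A * (K * (1 / √Λ) ^ j) * (√(Real.pi / (c / 2)) * (1 / √Λ)) := by gcongr
    _ = _ := by ring

/-- On `[-1/√Λ, 1/√Λ]` the integrand is at least `exp (-1/2) ≥ 3/5`. This is the main term in the
lower bound for the partition functions. -/
theorem integral_exp_neg_half_sq_ge {Λ : ℝ} (hΛ : 1 ≤ Λ) :
    6 / 5 * (1 / √Λ) ≤ ∫ t in (-Real.pi)..Real.pi, Real.exp (-(Λ / 2) * t ^ 2) := by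
  have hs : 1 ≤ √Λ := Real.one_le_sqrt.2 hΛ
  set e := 1 / √Λ with he
  have he0 : 0 < e := by positivity
  have he1 : e ≤ 1 := by rw [he, div_le_one (by positivity)]; exact hs
  have hee : Λ * e ^ 2 = 1 := by
    rw [he, div_pow, Real.sq_sqrt (by linarith)]; field_simp
  have hpi := Real.pi_gt_three
  have hcont : Continuous fun t : ℝ => Real.exp (-(Λ / 2) * t ^ 2) := by fun_prop
  have h1 : ∫ t in (-e)..e, Real.exp (-(Λ / 2) * t ^ 2)
      ≤ ∫ t in (-Real.pi)..Real.pi, Real.exp (-(Λ / 2) * t ^ 2) :=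
    intervalIntegral.integral_mono_interval (by linarith) (by linarith) (by linarith)
      (Filter.Eventually.of_forall fun t => (Real.exp_pos _).le) (hcont.intervalIntegrable _ _)
  have h2 : ∫ t in (-e)..e, (3 / 5 : ℝ) ≤ ∫ t in (-e)..e, Real.exp (-(Λ / 2) * t ^ 2) := by
    refine intervalIntegral.integral_mono_on (by linarith) (by simp)
      (hcont.intervalIntegrable _ _) fun t ht => ?_
    have ht2 : t ^ 2 ≤ e ^ 2 := sq_le_sq' ht.1 ht.2
    have h3 : Λ * t ^ 2 ≤ 1 := by
      rw [← hee]; exact mul_le_mul_of_nonneg_left ht2 (by linarith)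
    have h4 : Real.exp (-(1 / 2)) ≤ Real.exp (-(Λ / 2) * t ^ 2) :=
      Real.exp_le_exp.2 (by linarith)
    refine le_trans ?_ h4
    rw [Real.exp_neg]
    have h5 : Real.exp (1 / 2) ^ 2 = Real.exp 1 := by
      rw [← Real.exp_nat_mul]; norm_num
    have h6 := Real.exp_one_lt_d9
    have h7 : Real.exp (1 / 2) ≤ 5 / 3 := by
      nlinarith [Real.exp_pos (1 / 2 : ℝ)]
    rw [le_inv_comm₀ (by norm_num) (Real.exp_pos _)]
    linarith
  simp only [intervalIntegral.integral_const, smul_eq_mul] at h2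
  linarith

theorem norm_pow_sub_pow_le_mul {a b : ℂ} {r : ℝ} (ha : ‖a‖ ≤ r) (hb : ‖b‖ ≤ r) (n : ℕ) :
    ‖a ^ (n + 1) - b ^ (n + 1)‖ ≤ (n + 1) * ‖a - b‖ * r ^ n := by
  have hr : 0 ≤ r := (norm_nonneg _).trans ha
  induction n with
  | zero => simp
  | succ n ih =>
    have : a ^ (n + 1 + 1) - b ^ (n + 1 + 1)
        = a * (a ^ (n + 1) - b ^ (n + 1)) + (a - b) * b ^ (n + 1) := by ring
    rw [this]
    refine (norm_add_le _ _).trans ?_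
    rw [norm_mul, norm_mul, norm_pow]
    calc _ ≤ r * ((n + 1) * ‖a - b‖ * r ^ n) + ‖a - b‖ * r ^ (n + 1) := by gcongr
      _ = _ := by push_cast; ring

/-- A discrete quotient rule. In the application `ε = 1/√Λ`, and each difference of Fourier
coefficients gains one power of `ε`, so every term of the expansion has size `ε ^ 4`. -/
theorem abs_secondDiff_div_le {a0 a1 a2 b0 b1 b2 ε A B : ℝ} (hε : 0 < ε) (hA : 0 ≤ A) (hB : 0 ≤ B)
    (h1 : |a1| ≤ A * ε ^ 3)
    (h21 : |a2 - a1| ≤ A * ε ^ 4) (h01 : |a0 - a1| ≤ A * ε ^ 4)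
    (h012 : |a2 - 2 * a1 + a0| ≤ A * ε ^ 5)
    (hb0 : ε ≤ b0) (hb1 : ε ≤ b1) (hb2 : ε ≤ b2)
    (d2 : |b2 - b1| ≤ B * ε ^ 2) (d0 : |b0 - b1| ≤ B * ε ^ 2)
    (d012 : |b2 - 2 * b1 + b0| ≤ B * ε ^ 3) :
    |a2 / b2 - 2 * (a1 / b1) + a0 / b0| ≤ A * (1 + 3 * B + 2 * B ^ 2) * ε ^ 4 := by
  have p0 : 0 < b0 := hε.trans_le hb0
  have p1 : 0 < b1 := hε.trans_le hb1
  have p2 : 0 < b2 := hε.trans_le hb2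
  have key : a2 / b2 - 2 * (a1 / b1) + a0 / b0
      = (a2 - 2 * a1 + a0) / b1 - (a2 - a1) * (b2 - b1) / (b1 * b2)
        - (a0 - a1) * (b0 - b1) / (b0 * b1) - a1 * (b2 - 2 * b1 + b0) / (b0 * b2)
        - 2 * (a1 * ((b2 - b1) * (b0 - b1)) / (b0 * b1 * b2)) := by
    field_simp; ring
  have t1 : |(a2 - 2 * a1 + a0) / b1| ≤ A * ε ^ 4 := by
    rw [abs_div, abs_of_pos p1]
    calc _ ≤ A * ε ^ 5 / ε := by gcongr
      _ = _ := by field_simp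
  have t2 : |(a2 - a1) * (b2 - b1) / (b1 * b2)| ≤ A * B * ε ^ 4 := by
    rw [abs_div, abs_mul, abs_of_pos (mul_pos p1 p2)]
    calc _ ≤ A * ε ^ 4 * (B * ε ^ 2) / (ε * ε) := by gcongr
      _ = _ := by field_simp
  have t3 : |(a0 - a1) * (b0 - b1) / (b0 * b1)| ≤ A * B * ε ^ 4 := by
    rw [abs_div, abs_mul, abs_of_pos (mul_pos p0 p1)]
    calc _ ≤ A * ε ^ 4 * (B * ε ^ 2) / (ε * ε) := by gcongr
      _ = _ := by field_simp
  have t4 : |a1 * (b2 - 2 * b1 + b0) / (b0 * b2)| ≤ A * B * ε ^ 4 := by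
    rw [abs_div, abs_mul, abs_of_pos (mul_pos p0 p2)]
    calc _ ≤ A * ε ^ 3 * (B * ε ^ 3) / (ε * ε) := by gcongr
      _ = _ := by field_simp
  have t5 : |a1 * ((b2 - b1) * (b0 - b1)) / (b0 * b1 * b2)| ≤ A * B ^ 2 * ε ^ 4 := by
    rw [abs_div, abs_mul, abs_mul, abs_of_pos (mul_pos (mul_pos p0 p1) p2)]
    calc _ ≤ A * ε ^ 3 * ((B * ε ^ 2) * (B * ε ^ 2)) / (ε * ε * ε) := by gcongr
      _ = _ := by field_simp
  rw [key]
  rw [abs_le] at *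
  constructor <;> linarith [t1.1, t1.2, t2.1, t2.2, t3.1, t3.2, t4.1, t4.2, t5.1, t5.2]

/-! ### Functions with bounded second differences -/

/-- Discrete Taylor formula about the chord through `c` and `c + 1`: slopes change by at most `D`
per step, and summing twice gives a quadratic remainder that vanishes at both nodes. -/
theorem abs_sub_affine_le {f : ℕ → ℝ} {D : ℝ}
    (hf : ∀ m, |f (m + 2) - 2 * f (m + 1) + f m| ≤ D) (c m : ℕ) :
    |f m - f c - (f (c + 1) - f c) * ((m : ℝ) - c)|
      ≤ D / 2 * (((m : ℝ) - c) * ((m : ℝ) - c - 1)) := by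
  rcases le_total c m with h | h
  · obtain ⟨j, rfl⟩ := Nat.exists_eq_add_of_le h
    have h1 : ∀ j : ℕ, |f (c + j + 1) - f (c + j) - (f (c + 1) - f c)| ≤ D * j := by
      intro j
      induction j with
      | zero => simp
      | succ j ih =>
        have := hf (c + j)
        rw [abs_le] at *
        push_cast
        rw [show c + (j + 1) + 1 = c + j + 2 by ring, show c + (j + 1) = c + j + 1 by ring]
        constructor <;> linarith [this.1, this.2, ih.1, ih.2]
    clear h
    induction j with
    | zero => simp
    | succ j ih =>
      have := h1 j
      rw [abs_le] at *
      push_cast at *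
      rw [show c + (j + 1) = c + j + 1 by ring]
      constructor <;> nlinarith [this.1, this.2, ih.1, ih.2]
  · obtain ⟨j, rfl⟩ := Nat.exists_eq_add_of_le h
    have h1 : ∀ i : ℕ, i ≤ j → |f (m + j + 1) - f (m + j)
        - (f (m + (j - i) + 1) - f (m + (j - i)))| ≤ D * i := by
      intro i
      induction i with
      | zero => simp
      | succ i ih =>
        intro hi
        have h2 := ih (by omega)
        have h3 := hf (m + (j - (i + 1)))
        rw [show m + (j - (i + 1)) + 2 = m + (j - i) + 1 by omega,
          show m + (j - (i + 1)) + 1 = m + (j - i) by omega] at h3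
        rw [show m + (j - (i + 1)) + 1 = m + (j - i) by omega]
        rw [abs_le] at *
        push_cast
        constructor <;> linarith [h2.1, h2.2, h3.1, h3.2]
    have h2 : ∀ i : ℕ, i ≤ j → |f (m + (j - i)) - f (m + j) + (f (m + j + 1) - f (m + j)) * i|
        ≤ D / 2 * (i * (i + 1)) := by
      intro i
      induction i with
      | zero => simp
      | succ i ih =>
        intro hi
        have h2 := ih (by omega)
        have h3 := h1 (i + 1) hi
        rw [show m + (j - (i + 1)) + 1 = m + (j - i) by omega] at h3
        rw [abs_le] at *
        push_cast at *
        constructor <;> nlinarith [h2.1, h2.2, h3.1, h3.2]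
    have h3 := h2 j le_rfl
    simp only [Nat.sub_self, add_zero] at h3
    push_cast
    convert h3 using 2 <;> ring

/-! ### Characteristic functions of Bernoulli sums and affine regression. -/

section bernoulli

variable {ι : Type} (s : Finset ι) (p : ι → ℝ)

theorem polyMean_bernoulliPoly_abs_cube_le (hp : ∀ i, 0 ≤ p i ∧ p i ≤ 1) :
    polyMean (fun m => |(m : ℝ) - ∑ i ∈ s, p i| ^ 3) (bernoulliPoly s p)
      ≤ ∑ i ∈ s, p i * (1 - p i) + 3 / 2 * (∑ i ∈ s, p i * (1 - p i)) ^ 2 := by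
  obtain ⟨-, -, h2, h4⟩ := polyMean_bernoulliPoly_moments s p hp
  have h := polyMean_mono (coeff_bernoulliPoly_nonneg s p hp)
    (g := fun m => |(m : ℝ) - ∑ i ∈ s, p i| ^ 3)
    (h := fun m => 1 / 2 * ((m : ℝ) - ∑ i ∈ s, p i) ^ 2 + 1 / 2 * ((m : ℝ) - ∑ i ∈ s, p i) ^ 4)
    (fun m => by
      set u := (m : ℝ) - ∑ i ∈ s, p i
      have e2 : u ^ 2 = |u| ^ 2 := (sq_abs u).symm
      have e4 : u ^ 4 = |u| ^ 4 := by rw [← abs_pow, abs_of_nonneg (by positivity)]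
      rw [e2, e4]
      nlinarith [mul_nonneg (sq_nonneg |u|) (sq_nonneg (|u| - 1))])
  refine h.trans ?_
  rw [polyMean_add, polyMean_const_mul, polyMean_const_mul, h2]
  linarith

/-- Taylor expansion of both terms. The error keeps a factor equal to the variance, which may be
small; over `k + 1` factors it therefore adds up to a multiple of `Λ |t| ^ 3`. -/
theorem norm_charSum_sub_gaussian_le (hp : ∀ i, 0 ≤ p i ∧ p i ≤ 1) {S : ℝ}
    (hS : ∑ i ∈ s, p i * (1 - p i) ≤ S) {t : ℝ} (ht : |t| ≤ Real.pi) :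
    ‖charSum (bernoulliPoly s p) (∑ i ∈ s, p i) (fun _ => 1) t
        - Real.exp (-((∑ i ∈ s, p i * (1 - p i)) * t ^ 2 / 2))‖
      ≤ (2 + 4 * S) * (∑ i ∈ s, p i * (1 - p i)) * |t| ^ 3 := by
  obtain ⟨h0, h1, h2, -⟩ := polyMean_bernoulliPoly_moments s p hp
  have h3 := polyMean_bernoulliPoly_abs_cube_le s p hp
  have hv : 0 ≤ ∑ i ∈ s, p i * (1 - p i) :=
    Finset.sum_nonneg fun i _ => mul_nonneg (hp i).1 (by linarith [(hp i).2])
  have hP := coeff_bernoulliPoly_nonneg s p hp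
  set v := ∑ i ∈ s, p i * (1 - p i)
  set ρ := ∑ i ∈ s, p i
  set P := bernoulliPoly s p
  have e1 : charSum P ρ (fun _ => 1) t - 1 + (v * t ^ 2 / 2 : ℝ)
      = polyMean (fun m : ℕ => Complex.exp (((((m : ℝ) - ρ) * t : ℝ)) * Complex.I) - 1
        - ((((m : ℝ) - ρ) * t : ℝ)) * Complex.I + (((((m : ℝ) - ρ) * t) ^ 2 / 2 : ℝ) : ℂ)) P := by
    rw [polyMean_add, polyMean_sub, polyMean_sub]
    have a1 : polyMean (fun _ : ℕ => (1 : ℂ)) P = 1 := by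
      have := polyMean_ofReal (fun _ => 1) P
      rw [h0] at this; simpa using this
    have a2 : polyMean (fun m : ℕ => ((((m : ℝ) - ρ) * t : ℝ) : ℂ) * Complex.I) P = 0 := by
      have : (fun m : ℕ => ((((m : ℝ) - ρ) * t : ℝ) : ℂ) * Complex.I)
          = fun m : ℕ => (t * Complex.I) * (((m : ℝ) - ρ : ℝ) : ℂ) := by
        ext m; push_cast; ring
      rw [this, polyMean_const_mul_complex, polyMean_ofReal, h1]; simp
    have a3 : polyMean (fun m : ℕ => (((((m : ℝ) - ρ) * t) ^ 2 / 2 : ℝ) : ℂ)) P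
        = ((v * t ^ 2 / 2 : ℝ) : ℂ) := by
      rw [polyMean_ofReal]
      have : (fun m : ℕ => (((m : ℝ) - ρ) * t) ^ 2 / 2)
          = fun m : ℕ => (t ^ 2 / 2) * ((m : ℝ) - ρ) ^ 2 := by
        ext m; ring
      rw [this, polyMean_const_mul, h2]; congr 1; ring
    rw [a1, a2, a3, sub_zero, charSum]
    simp
  have e2 : ‖charSum P ρ (fun _ => 1) t - 1 + (v * t ^ 2 / 2 : ℝ)‖
      ≤ 2 * |t| ^ 3 * (v + 3 / 2 * v ^ 2) := by
    rw [e1]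
    refine (norm_polyMean_le hP _).trans ?_
    have := polyMean_mono hP (fun m => norm_exp_mul_I_sub_taylor_le (((m : ℝ) - ρ) * t))
    refine this.trans ?_
    have e : (fun m : ℕ => 2 * |((m : ℝ) - ρ) * t| ^ 3)
        = fun m : ℕ => (2 * |t| ^ 3) * |(m : ℝ) - ρ| ^ 3 := by
      ext m; rw [abs_mul, mul_pow]; ring
    rw [e, polyMean_const_mul]
    gcongr
  have e3 : |Real.exp (-(v * t ^ 2 / 2)) - 1 + v * t ^ 2 / 2| ≤ (v * t ^ 2 / 2) ^ 2 := by
    set y := v * t ^ 2 / 2 with hy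
    have hy0 : 0 ≤ y := by positivity
    rcases le_or_gt y 1 with h | h
    · have := Real.norm_exp_sub_one_sub_id_le (x := -y) (by rwa [norm_neg, Real.norm_of_nonneg hy0])
      rw [norm_neg, Real.norm_of_nonneg hy0] at this
      simpa [sub_neg_eq_add] using this
    · have h5 := Real.add_one_le_exp (-y)
      have h6 : Real.exp (-y) ≤ 1 := Real.exp_le_one_iff.2 (by linarith)
      rw [abs_of_nonneg (by linarith)]
      nlinarith
  have e4 : charSum P ρ (fun _ => 1) t - Real.exp (-(v * t ^ 2 / 2))
      = (charSum P ρ (fun _ => 1) t - 1 + (v * t ^ 2 / 2 : ℝ))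
        - ((Real.exp (-(v * t ^ 2 / 2)) - 1 + v * t ^ 2 / 2 : ℝ) : ℂ) := by
    push_cast; ring
  rw [e4]
  refine (norm_sub_le _ _).trans ?_
  rw [Complex.norm_real, Real.norm_eq_abs]
  refine (add_le_add e2 e3).trans ?_
  have hpi : Real.pi ≤ 4 := Real.pi_le_four
  have ht4 : t ^ 4 ≤ 4 * |t| ^ 3 := by
    have : t ^ 4 = |t| * |t| ^ 3 := by
      rw [← pow_succ', (by decide : Even (3 + 1)).pow_abs]
    rw [this]
    exact mul_le_mul_of_nonneg_right (ht.trans hpi) (by positivity)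
  have hv2 : v ^ 2 ≤ S * v := by nlinarith
  have ht3 : 0 ≤ |t| ^ 3 := by positivity
  calc 2 * |t| ^ 3 * (v + 3 / 2 * v ^ 2) + (v * t ^ 2 / 2) ^ 2
      = 2 * |t| ^ 3 * (v + 3 / 2 * v ^ 2) + v ^ 2 * t ^ 4 / 4 := by ring
    _ ≤ 2 * |t| ^ 3 * (v + 3 / 2 * v ^ 2) + v ^ 2 * (4 * |t| ^ 3) / 4 := by gcongr
    _ = 2 * v * |t| ^ 3 + 4 * v ^ 2 * |t| ^ 3 := by ring
    _ ≤ 2 * v * |t| ^ 3 + 4 * (S * v) * |t| ^ 3 := by gcongr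
    _ = _ := by ring

/-- Subtracting an affine function, a function with second differences at most `D` can be made
orthogonal to affine functions, with a bound on its first absolute moment. -/
theorem exists_affine_regression (hp : ∀ i, 0 ≤ p i ∧ p i ≤ 1) {S : ℝ}
    (hv : 0 < ∑ i ∈ s, p i * (1 - p i)) (hS : ∑ i ∈ s, p i * (1 - p i) ≤ S)
    {f : ℕ → ℝ} {D : ℝ} (hf : ∀ m, |f (m + 2) - 2 * f (m + 1) + f m| ≤ D) :
    ∃ a b : ℝ,
      polyMean (fun m => f m + (a + b * m)) (bernoulliPoly s p) = 0 ∧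
      polyMean (fun m => (f m + (a + b * m)) * ((m : ℝ) - ∑ i ∈ s, p i)) (bernoulliPoly s p) = 0 ∧
      polyMean (fun m => |f m + (a + b * m)| * ((m : ℝ) - ∑ i ∈ s, p i) ^ 2) (bernoulliPoly s p)
        ≤ D * (∑ i ∈ s, p i * (1 - p i)) * (1 + 3 * S + (1 + S) * (1 + 2 * S)) := by
  obtain ⟨m0, m1, m2, m4⟩ := polyMean_bernoulliPoly_moments s p hp
  have m3 := polyMean_bernoulliPoly_abs_cube_le s p hp
  have hP := coeff_bernoulliPoly_nonneg s p hp
  have hρ : 0 ≤ ∑ i ∈ s, p i := Finset.sum_nonneg fun i _ => (hp i).1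
  set v := ∑ i ∈ s, p i * (1 - p i)
  set ρ := ∑ i ∈ s, p i
  set P := bernoulliPoly s p
  have hD : 0 ≤ D := (abs_nonneg _).trans (hf 0)
  have hS0 : 0 < S := hv.trans_le hS
  -- With the nodes `c` and `c + 1` around `ρ`, the mean of `(m - c) (m - c - 1)` is `v + (ρ - c) (ρ
  -- - c - 1) ≤ v`. A remainder bounded only by a constant would be useless for small `v`.
  set c := ⌊ρ⌋₊
  have hc1 : (c : ℝ) ≤ ρ := Nat.floor_le hρ
  have hc2 : ρ < c + 1 := Nat.lt_floor_add_one ρ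
  have hconst (x : ℝ) : polyMean (fun _ => x) P = x := by
    have := polyMean_const_mul x (fun _ => 1) P
    simpa [m0] using this
  let u : ℕ → ℝ := fun m => (m : ℝ) - ρ
  let h : ℕ → ℝ := fun m => ((m : ℝ) - c) * ((m : ℝ) - c - 1)
  have hmean : polyMean h P ≤ v := by
    have : h = fun m : ℕ => ((m : ℝ) - ρ) ^ 2
        + ((2 * (ρ - c) - 1) * ((m : ℝ) - ρ) + (ρ - c) * (ρ - c - 1)) := by
      ext m; simp only [h]; ring
    rw [this, polyMean_add, polyMean_add, polyMean_const_mul, hconst, m1, m2]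
    nlinarith
  have hle (m : ℕ) : h m ≤ u m ^ 2 + |u m| := by
    have h1 := neg_abs_le (u m)
    have h2 := le_abs_self (u m)
    have : h m = u m ^ 2 + (2 * (ρ - c) - 1) * u m - (ρ - c) * (1 - (ρ - c)) := by
      simp only [h, u]; ring
    rw [this]
    have h3 : (2 * (ρ - c) - 1) * u m ≤ |u m| := by
      refine (le_abs_self _).trans ?_
      rw [abs_mul]
      have : |2 * (ρ - c) - 1| ≤ 1 := by rw [abs_le]; constructor <;> linarith
      exact mul_le_of_le_one_left (abs_nonneg _) this
    nlinarith
  let f0 : ℕ → ℝ := fun m => f m - f c - (f (c + 1) - f c) * ((m : ℝ) - c)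
  have hf0 (m : ℕ) : |f0 m| ≤ D / 2 * h m := abs_sub_affine_le hf c m
  have m4' : polyMean (fun m => u m ^ 4) P ≤ v * (1 + 3 * S) := by
    refine m4.trans ?_
    nlinarith
  have m3' : polyMean (fun m => |u m| ^ 3) P ≤ v * (1 + 2 * S) := by
    refine m3.trans ?_
    nlinarith
  set α := polyMean f0 P with hα
  set γ := polyMean (fun m => f0 m * u m) P with hγ
  have hαb : |α| ≤ D / 2 * v := by
    refine (abs_polyMean_le hP _).trans ((polyMean_mono hP hf0).trans ?_)
    rw [polyMean_const_mul]
    gcongr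
  have hγb : |γ| ≤ D * (1 + S) * v := by
    refine (abs_polyMean_le hP _).trans ?_
    have : ∀ m, |f0 m * u m| ≤ D / 2 * (|u m| ^ 3 + u m ^ 2) := by
      intro m
      rw [abs_mul]
      calc _ ≤ D / 2 * h m * |u m| := by gcongr; exact hf0 m
        _ ≤ D / 2 * (u m ^ 2 + |u m|) * |u m| := by gcongr; exact hle m
        _ = _ := by rw [← sq_abs (u m)]; ring
    refine (polyMean_mono hP this).trans ?_
    rw [polyMean_const_mul, polyMean_add, m2]
    calc _ ≤ D / 2 * (v * (1 + 2 * S) + v) := by gcongr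
      _ = _ := by ring
  -- The regression slope stays bounded as `v → 0` because the covariance `γ` is itself of order
  -- `v`.
  have hβ : |γ / v| ≤ D * (1 + S) := by
    rw [abs_div, abs_of_pos hv, div_le_iff₀ hv]; exact hγb
  have hfun : ∀ m : ℕ, f m + ((-f c + (f (c + 1) - f c) * c - α + γ / v * ρ)
      + (-(f (c + 1) - f c) - γ / v) * m) = f0 m - α - γ / v * u m := by
    intro m; simp only [f0, u]; ring
  refine ⟨-f c + (f (c + 1) - f c) * c - α + γ / v * ρ, -(f (c + 1) - f c) - γ / v, ?_, ?_, ?_⟩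
  · simp only [hfun]
    rw [polyMean_sub, polyMean_sub, hconst, polyMean_const_mul, m1]
    simp [hα]
  · simp only [hfun]
    have : (fun m : ℕ => (f0 m - α - γ / v * u m) * ((m : ℝ) - ρ))
        = fun m : ℕ => f0 m * u m - α * ((m : ℝ) - ρ) - γ / v * ((m : ℝ) - ρ) ^ 2 := by
      ext m; simp only [u]; ring
    rw [this, polyMean_sub, polyMean_sub, polyMean_const_mul, polyMean_const_mul, m1, m2, ← hγ]
    field_simp; ring
  · simp only [hfun]
    have : ∀ m : ℕ, |f0 m - α - γ / v * u m| * ((m : ℝ) - ρ) ^ 2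
        ≤ D / 2 * (u m ^ 4) + ((D / 2 + D * (1 + S)) * |u m| ^ 3
          + D / 2 * v * ((m : ℝ) - ρ) ^ 2) := by
      intro m
      have h1 : |f0 m - α - γ / v * u m| ≤ D / 2 * (u m ^ 2 + |u m|) + D / 2 * v
          + D * (1 + S) * |u m| := by
        refine (abs_sub _ _).trans (add_le_add ((abs_sub _ _).trans (add_le_add ?_ hαb)) ?_)
        · exact (hf0 m).trans (mul_le_mul_of_nonneg_left (hle m) (by positivity))
        · rw [abs_mul]; gcongr
      calc _ ≤ (D / 2 * (u m ^ 2 + |u m|) + D / 2 * v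
          + D * (1 + S) * |u m|) * ((m : ℝ) - ρ) ^ 2 := by gcongr
        _ = (D / 2 * (u m ^ 2 + |u m|) + D / 2 * v
          + D * (1 + S) * |u m|) * (u m) ^ 2 := rfl
        _ = D / 2 * u m ^ 4 + ((D / 2 + D * (1 + S)) * (|u m| * u m ^ 2)
          + D / 2 * v * u m ^ 2) := by ring
        _ = _ := by
          rw [← sq_abs (u m), ← pow_succ']
    refine (polyMean_mono hP this).trans ?_
    rw [polyMean_add, polyMean_add, polyMean_const_mul, polyMean_const_mul, polyMean_const_mul, m2]
    calc _ ≤ D / 2 * (v * (1 + 3 * S)) + ((D / 2 + D * (1 + S)) * (v * (1 + 2 * S))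
          + D / 2 * v * S) := by gcongr
      _ = _ := by ring

/-- Orthogonality to `1` and `m - ρ` removes the Taylor terms of order zero and one of the
exponential, leaving `t ^ 2`. -/
theorem norm_charSum_le_of_orthogonal {P : ℝ[X]} (hP : ∀ m, 0 ≤ P.coeff m) {ρ : ℝ} {g : ℕ → ℝ}
    (h0 : polyMean g P = 0) (h1 : polyMean (fun m => g m * ((m : ℝ) - ρ)) P = 0) (t : ℝ) :
    ‖charSum P ρ g t‖ ≤ 2 * t ^ 2 * polyMean (fun m => |g m| * ((m : ℝ) - ρ) ^ 2) P := by
  have e : charSum P ρ g t = polyMean (fun m : ℕ => (g m : ℂ) *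
      (Complex.exp (((((m : ℝ) - ρ) * t : ℝ)) * Complex.I) - 1
        - ((((m : ℝ) - ρ) * t : ℝ)) * Complex.I)) P := by
    have : (fun m : ℕ => (g m : ℂ) * (Complex.exp (((((m : ℝ) - ρ) * t : ℝ)) * Complex.I) - 1
        - ((((m : ℝ) - ρ) * t : ℝ)) * Complex.I))
        = fun m : ℕ => (g m : ℂ) * Complex.exp (((((m : ℝ) - ρ) * t : ℝ)) * Complex.I) - (g m : ℂ)
          - (t * Complex.I) * ((g m * ((m : ℝ) - ρ) : ℝ) : ℂ) := by
      ext m; push_cast; ring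
    rw [this, polyMean_sub, polyMean_sub, polyMean_const_mul_complex, polyMean_ofReal,
      polyMean_ofReal, h0, h1, charSum]
    simp
  rw [e]
  refine (norm_polyMean_le hP _).trans ?_
  rw [← polyMean_const_mul]
  refine polyMean_mono hP fun m => ?_
  rw [norm_mul, Complex.norm_real, Real.norm_eq_abs]
  calc _ ≤ |g m| * (2 * (((m : ℝ) - ρ) * t) ^ 2) := by
        gcongr; exact norm_exp_mul_I_sub_one_sub_le _
    _ = _ := by ring

end bernoulli

/-! ### Local limit estimate for the second difference of conditional means. -/

theorem norm_exp_neg_mul_I_sub_one_le (t : ℝ) :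
    ‖Complex.exp (-(t : ℂ) * Complex.I) - 1‖ ≤ |t| := by
  have := Real.norm_exp_I_mul_ofReal_sub_one_le (x := -t)
  rw [norm_neg, Real.norm_eq_abs] at this
  refine le_trans (le_of_eq ?_) this
  congr 3
  push_cast; ring

theorem norm_exp_second_diff_le (t : ℝ) :
    ‖Complex.exp (-(t : ℂ) * Complex.I) - 2 + Complex.exp ((t : ℂ) * Complex.I)‖ ≤ |t| ^ 2 := by
  have h1 := norm_exp_neg_mul_I_sub_one_le t
  have h2 := norm_exp_neg_mul_I_sub_one_le (-t)
  rw [abs_neg] at h2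
  have e : Complex.exp (-(t : ℂ) * Complex.I) - 2 + Complex.exp ((t : ℂ) * Complex.I)
      = -((Complex.exp (-(t : ℂ) * Complex.I) - 1)
        * (Complex.exp (-((-t : ℝ) : ℂ) * Complex.I) - 1)) := by
    have : Complex.exp (-(t : ℂ) * Complex.I) * Complex.exp (-((-t : ℝ) : ℂ) * Complex.I) = 1 := by
      rw [← Complex.exp_add, ← Complex.exp_zero]; congr 1; push_cast; ring
    have e2 : Complex.exp ((t : ℂ) * Complex.I) = Complex.exp (-((-t : ℝ) : ℂ) * Complex.I) := by
      congr 1; push_cast; ring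
    rw [e2]
    linear_combination this
  rw [e, norm_neg, norm_mul, sq]
  exact mul_le_mul h1 h2 (norm_nonneg _) (abs_nonneg _)

/-- Bounds for the integrals of a function with Gaussian decay against three successive
characters. -/
theorem exists_fourier_diff_bounds {c : ℝ} (hc : 0 < c) (j : ℕ) :
    ∃ K : ℝ, 0 < K ∧ ∀ (Λ A : ℝ) (G : ℝ → ℂ) (x0 x1 x2 : ℝ), 0 < Λ → 0 ≤ A → Continuous G →
      (∀ t, |t| ≤ Real.pi → ‖G t‖ ≤ A * (|t| ^ j * Real.exp (-c * Λ * t ^ 2))) →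
      (∫ t in (-Real.pi)..Real.pi, G t * Complex.exp ((t : ℂ) * Complex.I)) = (x0 : ℂ) →
      (∫ t in (-Real.pi)..Real.pi, G t) = (x1 : ℂ) →
      (∫ t in (-Real.pi)..Real.pi, G t * Complex.exp (-(t : ℂ) * Complex.I)) = (x2 : ℂ) →
      |x1| ≤ A * K * (1 / √Λ) ^ (j + 1) ∧ |x2 - x1| ≤ A * K * (1 / √Λ) ^ (j + 2) ∧
      |x0 - x1| ≤ A * K * (1 / √Λ) ^ (j + 2) ∧
      |x2 - 2 * x1 + x0| ≤ A * K * (1 / √Λ) ^ (j + 3) := by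
  obtain ⟨K0, hK0, H0⟩ := exists_norm_integral_le_of_gaussian hc j
  obtain ⟨K1, hK1, H1⟩ := exists_norm_integral_le_of_gaussian hc (j + 1)
  obtain ⟨K2, hK2, H2⟩ := exists_norm_integral_le_of_gaussian hc (j + 2)
  refine ⟨K0 + K1 + K2, by positivity, fun Λ A G x0 x1 x2 hΛ hA hcont hG h0 h1 h2 => ?_⟩
  have hs : 0 < √Λ := Real.sqrt_pos.2 hΛ
  have i0 : IntervalIntegrable (fun t : ℝ => G t * Complex.exp ((t : ℂ) * Complex.I))
    MeasureTheory.volume (-Real.pi) Real.pi := (hcont.mul (by fun_prop)).intervalIntegrable _ _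
  have i1 : IntervalIntegrable G MeasureTheory.volume (-Real.pi) Real.pi :=
    hcont.intervalIntegrable _ _
  have i2 : IntervalIntegrable (fun t : ℝ => G t * Complex.exp (-(t : ℂ) * Complex.I))
    MeasureTheory.volume (-Real.pi) Real.pi := (hcont.mul (by fun_prop)).intervalIntegrable _ _
  have weaken {x y z w : ℝ} (hx : x ≤ A * y * w) (hyz : y ≤ z) (hw : 0 ≤ w) : x ≤ A * z * w :=
    hx.trans (by gcongr)
  have hmul (i : ℕ) (E : ℝ → ℂ) (hE : ∀ t, ‖E t‖ ≤ |t| ^ i) (t : ℝ) (ht : |t| ≤ Real.pi) :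
      ‖G t * E t‖ ≤ A * (|t| ^ (j + i) * Real.exp (-c * Λ * t ^ 2)) := by
    rw [norm_mul]
    calc _ ≤ A * (|t| ^ j * Real.exp (-c * Λ * t ^ 2)) * |t| ^ i :=
          mul_le_mul (hG t ht) (hE t) (norm_nonneg _) (by positivity)
      _ = _ := by rw [pow_add]; ring
  refine ⟨?_, ?_, ?_, ?_⟩
  · have := H0 Λ A G hΛ hA hG
    rw [h1, Complex.norm_real, Real.norm_eq_abs] at this
    exact weaken this (by linarith) (by positivity)
  · have e : ((x2 - x1 : ℝ) : ℂ) = ∫ t in (-Real.pi)..Real.pi,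
        G t * (Complex.exp (-(t : ℂ) * Complex.I) - 1) := by
      push_cast
      rw [← h2, ← h1, ← intervalIntegral.integral_sub i2 i1]
      congr 1; ext t; ring
    have := H1 Λ A _ hΛ hA (hmul 1 _ fun t => by
      rw [pow_one]; exact norm_exp_neg_mul_I_sub_one_le t)
    rw [← e, Complex.norm_real, Real.norm_eq_abs] at this
    exact weaken this (by linarith) (by positivity)
  · have e : ((x0 - x1 : ℝ) : ℂ) = ∫ t in (-Real.pi)..Real.pi,
        G t * (Complex.exp ((t : ℂ) * Complex.I) - 1) := by
      push_cast
      rw [← h0, ← h1, ← intervalIntegral.integral_sub i0 i1]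
      congr 1; ext t; ring
    have := H1 Λ A _ hΛ hA (hmul 1 _ fun t => by
      have := norm_exp_neg_mul_I_sub_one_le (-t)
      rw [abs_neg] at this
      rw [pow_one]
      simpa using this)
    rw [← e, Complex.norm_real, Real.norm_eq_abs] at this
    exact weaken this (by linarith) (by positivity)
  · have e : ((x2 - 2 * x1 + x0 : ℝ) : ℂ) = ∫ t in (-Real.pi)..Real.pi,
        G t * (Complex.exp (-(t : ℂ) * Complex.I) - 2 + Complex.exp ((t : ℂ) * Complex.I)) := by
      push_cast
      rw [← h0, ← h1, ← h2, ← intervalIntegral.integral_const_mul,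
        ← intervalIntegral.integral_sub i2 (i1.const_mul 2),
        ← intervalIntegral.integral_add (i2.sub (i1.const_mul 2)) i0]
      congr 1; ext t; ring
    have := H2 Λ A _ hΛ hA (hmul 2 _ norm_exp_second_diff_le)
    rw [← e, Complex.norm_real, Real.norm_eq_abs] at this
    exact weaken this (by linarith) (by positivity)

set_option maxHeartbeats 1000000 in
/-- For sums of independent Bernoulli variables conditioned at their mean, the conditional mean
has small second differences as a function of the conditioning. -/
theorem exists_condMeanDiff_bernoulliPoly_le {S : ℝ} (hS : 0 < S) :
    ∃ C Λ₀ : ℝ, 0 < C ∧ 0 < Λ₀ ∧ ∀ (ι : Type) (s : Finset ι) (p : ι → ℝ),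
      (∀ i, 0 ≤ p i ∧ p i ≤ 1) → 0 < ∑ i ∈ s, p i * (1 - p i) →
      ∑ i ∈ s, p i * (1 - p i) ≤ S → ∀ k M : ℕ, 1 ≤ k →
      ((k : ℝ) + 1) * ∑ i ∈ s, p i = M + 1 →
      Λ₀ ≤ ((k : ℝ) + 1) * ∑ i ∈ s, p i * (1 - p i) →
      ∀ (f : ℕ → ℝ) (D : ℝ), (∀ m, |f (m + 2) - 2 * f (m + 1) + f m| ≤ D) →
      |condMeanDiff (bernoulliPoly s p) k M f|
        ≤ C * D / (((k : ℝ) + 1) * (((k : ℝ) + 1) * ∑ i ∈ s, p i * (1 - p i))) := by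
  have hpi := Real.pi_pos
  -- Half of the decay rate `2 / π ^ 2`: the numerator has only `k` decaying factors, and `2 k ≥ k +
  -- 1`.
  set c : ℝ := 1 / Real.pi ^ 2 with hc
  have hc0 : 0 < c := by positivity
  obtain ⟨Ka, hKa, Ha⟩ := exists_fourier_diff_bounds hc0 2
  obtain ⟨Kb, hKb, Hb⟩ := exists_fourier_diff_bounds hc0 0
  obtain ⟨K3, hK3, H3⟩ := exists_norm_integral_le_of_gaussian hc0 3
  set CS : ℝ := 1 + 3 * S + (1 + S) * (1 + 2 * S) with hCS
  have hCS0 : 0 < CS := by positivity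
  set T : ℝ := (2 + 4 * S) * K3 + Kb with hT
  have hT0 : 0 < T := by positivity
  -- The first constant is assembled from `abs_secondDiff_div_le`. The threshold for `Λ` ensures `Λ
  -- ≥ 1` and `T * ε ≤ 1/5`, where `T` collects the error constants for the denominators.
  refine ⟨2 * CS * Ka * (1 + 3 * Kb + 2 * Kb ^ 2), 1 + (5 * T) ^ 2, by positivity, by positivity,
    fun ι s p hp hv hvS k M hk hρ hΛ f D hf => ?_⟩
  have hP := coeff_bernoulliPoly_nonneg s p hp
  obtain ⟨a, b, hg0, hg1, hg2⟩ := exists_affine_regression s p hp hv hvS hf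
  have hφ := fun t (ht : |t| ≤ Real.pi) =>
    norm_charSum_bernoulliPoly_le s p hp (∑ i ∈ s, p i) ht
  have hφg := fun t (ht : |t| ≤ Real.pi) => norm_charSum_sub_gaussian_le s p hp hvS ht
  set v := ∑ i ∈ s, p i * (1 - p i) with hvdef
  set ρ := ∑ i ∈ s, p i with hρdef
  set P := bernoulliPoly s p with hPdef
  set Λ : ℝ := ((k : ℝ) + 1) * v with hΛdef
  set φ := charSum P ρ (fun _ => 1) with hφdef
  have hφc : Continuous φ := continuous_charSum _ _ _
  have hΛ1 : 1 ≤ Λ := by nlinarith [sq_nonneg (5 * T)]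
  have hΛ0 : 0 < Λ := by linarith
  have hD : 0 ≤ D := (abs_nonneg _).trans (hf 0)
  set ε := 1 / √Λ with hε
  have hsq : 0 < √Λ := Real.sqrt_pos.2 hΛ0
  have hε0 : 0 < ε := by positivity
  have hε2 : Λ * ε ^ 2 = 1 := by rw [hε, div_pow, Real.sq_sqrt hΛ0.le]; field_simp
  have hTε : T * ε ≤ 1 / 5 := by
    have : 5 * T ≤ √Λ := Real.le_sqrt_of_sq_le (by linarith)
    rw [hε, mul_one_div, div_le_iff₀ hsq]; linarith
  have hk1 : (1 : ℝ) ≤ k := by exact_mod_cast hk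
  have hr (t : ℝ) : Real.exp (-(2 / Real.pi ^ 2) * v * t ^ 2) ^ k ≤ Real.exp (-c * Λ * t ^ 2) := by
    rw [← Real.exp_nat_mul]
    refine Real.exp_le_exp.2 ?_
    have h1 : 0 ≤ c * v * t ^ 2 := by positivity
    have h2 : (k : ℝ) * (-(2 / Real.pi ^ 2) * v * t ^ 2) = -(2 * k * (c * v * t ^ 2)) := by
      rw [hc]; ring
    rw [h2, hΛdef]
    nlinarith
  have hr1 (t : ℝ) : Real.exp (-(2 / Real.pi ^ 2) * v * t ^ 2) ≤ 1 := by
    refine Real.exp_le_one_iff.2 ?_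
    have : 0 ≤ 2 / Real.pi ^ 2 * v * t ^ 2 := by positivity
    linarith
  have hφk (t : ℝ) (ht : |t| ≤ Real.pi) : ‖φ t ^ k‖ ≤ Real.exp (-c * Λ * t ^ 2) := by
    rw [norm_pow]
    exact (pow_le_pow_left₀ (norm_nonneg _) (hφ t ht) k).trans (hr t)
  have hφk1 (t : ℝ) (ht : |t| ≤ Real.pi) : ‖φ t ^ (k + 1)‖ ≤ Real.exp (-c * Λ * t ^ 2) := by
    rw [pow_succ, norm_mul]
    exact (mul_le_of_le_one_right (norm_nonneg _) ((hφ t ht).trans (hr1 t))).trans (hφk t ht)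
  set g : ℕ → ℝ := fun m => f m + (a + b * m) with hgdef
  set Q : ℝ := D * v * CS with hQ
  have hG (t : ℝ) (ht : |t| ≤ Real.pi) :
      ‖charSum P ρ g t * φ t ^ k‖ ≤ 2 * Q * (|t| ^ 2 * Real.exp (-c * Λ * t ^ 2)) := by
    rw [norm_mul]
    have h1 := norm_charSum_le_of_orthogonal hP hg0 hg1 t
    calc _ ≤ 2 * t ^ 2 * Q * Real.exp (-c * Λ * t ^ 2) := by
          refine mul_le_mul (h1.trans (by gcongr)) (hφk t ht) (norm_nonneg _) (by positivity)
      _ = _ := by rw [sq_abs]; ring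
  -- Since `(k + 1) * ρ = M + 1`, the totals `M`, `M + 1`, `M + 2` correspond to the characters `exp
  -- (it)`, `1`, `exp (-it)`.
  have hcoef (h : ℕ → ℝ) (n : ℕ) : (∫ t in (-Real.pi)..Real.pi, charSum P ρ h t * φ t ^ k
        * Complex.exp (-((n - (M + 1)) * t : ℝ) * Complex.I))
      = ((2 * Real.pi * (weigh P h * P ^ k).coeff n : ℝ) : ℂ) := by
    have := integral_charSum_mul_pow P ρ h k n
    rw [hρ] at this
    rw [hφdef, this]; push_cast; ring
  have hcoef0 (h : ℕ → ℝ) : (∫ t in (-Real.pi)..Real.pi, charSum P ρ h t * φ t ^ k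
        * Complex.exp ((t : ℂ) * Complex.I))
      = ((2 * Real.pi * (weigh P h * P ^ k).coeff M : ℝ) : ℂ) := by
    rw [← hcoef]; congr 1; ext t; congr 2; push_cast; ring
  have hcoef1 (h : ℕ → ℝ) : (∫ t in (-Real.pi)..Real.pi, charSum P ρ h t * φ t ^ k)
      = ((2 * Real.pi * (weigh P h * P ^ k).coeff (M + 1) : ℝ) : ℂ) := by
    rw [← hcoef]; congr 1; ext t; simp
  have hcoef2 (h : ℕ → ℝ) : (∫ t in (-Real.pi)..Real.pi, charSum P ρ h t * φ t ^ k
        * Complex.exp (-(t : ℂ) * Complex.I))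
      = ((2 * Real.pi * (weigh P h * P ^ k).coeff (M + 2) : ℝ) : ℂ) := by
    rw [← hcoef]; congr 1; ext t; congr 2; push_cast; ring
  obtain ⟨A1, A21, A01, A012⟩ := Ha Λ (2 * Q) _ _ _ _ hΛ0 (by positivity)
    ((continuous_charSum P ρ g).mul (hφc.pow k)) hG (hcoef0 g) (hcoef1 g) (hcoef2 g)
  have hB0 := hcoef0 (fun _ => 1)
  have hB1 := hcoef1 (fun _ => 1)
  have hB2 := hcoef2 (fun _ => 1)
  simp only [weigh_one, ← pow_succ'] at hB0 hB1 hB2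
  rw [← hφdef] at hB0 hB1 hB2
  simp only [← pow_succ'] at hB0 hB1 hB2
  obtain ⟨-, B21, B01, B012⟩ := Hb Λ 1 _ _ _ _ hΛ0 (by positivity) (hφc.pow (k + 1))
    (fun t ht => by simpa using hφk1 t ht) hB0 hB1 hB2
  set b0 := 2 * Real.pi * (P ^ (k + 1)).coeff M
  set b1 := 2 * Real.pi * (P ^ (k + 1)).coeff (M + 1)
  set b2 := 2 * Real.pi * (P ^ (k + 1)).coeff (M + 2)
  simp only [one_mul, zero_add] at B21 B01 B012
  rw [← hε] at A1 A21 A01 A012 B21 B01 B012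
  have hgauss : |b1 - ∫ t in (-Real.pi)..Real.pi, Real.exp (-(Λ / 2) * t ^ 2)|
      ≤ (2 + 4 * S) * K3 * ε ^ 2 := by
    have e : ((b1 - ∫ t in (-Real.pi)..Real.pi, Real.exp (-(Λ / 2) * t ^ 2) : ℝ) : ℂ)
        = ∫ t in (-Real.pi)..Real.pi,
          (φ t ^ (k + 1) - ((Real.exp (-(Λ / 2) * t ^ 2) : ℝ) : ℂ)) := by
      have i1 : IntervalIntegrable (fun t => φ t ^ (k + 1)) MeasureTheory.volume (-Real.pi)
        Real.pi := (hφc.pow (k + 1)).intervalIntegrable _ _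
      have i2 : IntervalIntegrable (fun t : ℝ => ((Real.exp (-(Λ / 2) * t ^ 2) : ℝ) : ℂ))
          MeasureTheory.volume (-Real.pi) Real.pi :=
        Continuous.intervalIntegrable (by fun_prop) _ _
      rw [intervalIntegral.integral_sub i1 i2, intervalIntegral.integral_ofReal, hB1]
      push_cast; rfl
    have := H3 Λ ((2 + 4 * S) * Λ) (G := fun t =>
      (φ t ^ (k + 1) - ((Real.exp (-(Λ / 2) * t ^ 2) : ℝ) : ℂ))) hΛ0 (by positivity) (fun t ht => ?_)
    · rw [← e, Complex.norm_real, Real.norm_eq_abs, ← hε] at this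
      refine this.trans (le_of_eq ?_)
      calc _ = (2 + 4 * S) * K3 * (Λ * ε ^ 2) * ε ^ 2 := by ring
        _ = _ := by rw [hε2, mul_one]
    · have e2 : Real.exp (-(Λ / 2) * t ^ 2) = Real.exp (-(v * t ^ 2 / 2)) ^ (k + 1) := by
        rw [← Real.exp_nat_mul]; congr 1; rw [hΛdef]; push_cast; ring
      rw [e2, Complex.ofReal_pow]
      have hgr : ‖((Real.exp (-(v * t ^ 2 / 2)) : ℝ) : ℂ)‖
          ≤ Real.exp (-(2 / Real.pi ^ 2) * v * t ^ 2) := by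
        rw [Complex.norm_real, Real.norm_of_nonneg (Real.exp_pos _).le]
        refine Real.exp_le_exp.2 ?_
        have h1 : 2 / Real.pi ^ 2 ≤ 1 / 2 := by
          rw [div_le_div_iff₀ (by positivity) (by norm_num)]
          have : (3 : ℝ) ^ 2 ≤ Real.pi ^ 2 := by gcongr; exact Real.pi_gt_three.le
          linarith
        have h2 : 0 ≤ v * t ^ 2 := by positivity
        have h3 := mul_le_mul_of_nonneg_right h1 h2
        calc -(v * t ^ 2 / 2) = -(1 / 2 * (v * t ^ 2)) := by ring
          _ ≤ -(2 / Real.pi ^ 2 * (v * t ^ 2)) := neg_le_neg h3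
          _ = _ := by ring
      refine (norm_pow_sub_pow_le_mul (hφ t ht) hgr k).trans ?_
      calc _ ≤ ((k : ℝ) + 1) * ((2 + 4 * S) * v * |t| ^ 3) * Real.exp (-c * Λ * t ^ 2) := by
            gcongr
            · exact hφg t ht
            · exact hr t
        _ = _ := by rw [hΛdef]; ring
  -- The Gaussian contributes at least `6/5 * ε`, and the errors total at most `T * ε ^ 2 ≤ ε / 5`.
  -- This leaves `ε` as a lower bound for all three denominators.
  have hmain := integral_exp_neg_half_sq_ge hΛ1
  rw [← hε] at hmain
  have hTε2 : T * ε ^ 2 ≤ 1 / 5 * ε := by rw [sq, ← mul_assoc]; gcongr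
  have hTe : T * ε ^ 2 = (2 + 4 * S) * K3 * ε ^ 2 + Kb * ε ^ 2 := by rw [hT]; ring
  have hKb2 : 0 ≤ Kb * ε ^ 2 := by positivity
  have hb1 : ε ≤ b1 := by linarith [(abs_le.1 hgauss).1]
  have hb0 : ε ≤ b0 := by linarith [(abs_le.1 hgauss).1, (abs_le.1 B01).1]
  have hb2 : ε ≤ b2 := by linarith [(abs_le.1 hgauss).1, (abs_le.1 B21).1]
  have hne {x : ℝ} (hx : ε ≤ 2 * Real.pi * x) : x ≠ 0 := by
    rintro rfl; linarith
  have hfin := abs_secondDiff_div_le hε0 (by positivity) hKb.le A1 A21 A01 A012 hb0 hb1 hb2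
    B21 B01 B012
  rw [mul_div_mul_left _ _ (by positivity), mul_div_mul_left _ _ (by positivity),
    mul_div_mul_left _ _ (by positivity)] at hfin
  rw [← condMeanDiff_add_affine (hne hb0) (hne hb1) (hne hb2) f a b]
  refine hfin.trans (le_of_eq ?_)
  -- The factor `v` saved by the regression turns `ε ^ 4 = Λ ^ (-2)` into `1 / ((k + 1) * Λ)`.
  have hε4 : v * ε ^ 4 = 1 / (((k : ℝ) + 1) * Λ) := by
    have h1 : ε ^ 2 = 1 / Λ := by rw [eq_div_iff hΛ0.ne']; linarith
    rw [show ε ^ 4 = (ε ^ 2) ^ 2 by ring, h1, hΛdef]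
    have : (k : ℝ) + 1 ≠ 0 := by positivity
    field_simp
  calc _ = 2 * CS * Ka * (1 + 3 * Kb + 2 * Kb ^ 2) * D * (v * ε ^ 4) := by rw [hQ]; ring
    _ = _ := by rw [hε4]; ring

/-! ### Elementary symmetric coefficients and the low-density regime. -/

/-- The generating polynomial of the particle number of a stick whose sites have activities
`x i`. -/
noncomputable def sitePoly {ι : Type} (s : Finset ι) (x : ι → ℝ) : ℝ[X] :=
  ∏ i ∈ s, (1 + C (x i) * X)

theorem coeff_mul_nonneg {P Q : ℝ[X]} (hP : ∀ m, 0 ≤ P.coeff m) (hQ : ∀ m, 0 ≤ Q.coeff m)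
    (m : ℕ) : 0 ≤ (P * Q).coeff m := by
  rw [coeff_mul]
  exact Finset.sum_nonneg fun i _ => mul_nonneg (hP _) (hQ _)

theorem coeff_mul_le_coeff_mul {P P' Q : ℝ[X]} (h : ∀ m, P.coeff m ≤ P'.coeff m)
    (hQ : ∀ m, 0 ≤ Q.coeff m) (m : ℕ) : (P * Q).coeff m ≤ (P' * Q).coeff m := by
  rw [coeff_mul, coeff_mul]
  exact Finset.sum_le_sum fun i _ => mul_le_mul_of_nonneg_right (h _) (hQ _)

theorem coeff_pow_nonneg {P : ℝ[X]} (hP : ∀ m, 0 ≤ P.coeff m) (k m : ℕ) :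
    0 ≤ (P ^ k).coeff m := by
  induction k generalizing m with
  | zero => rw [pow_zero, coeff_one]; split_ifs <;> norm_num
  | succ k ih => rw [pow_succ]; exact coeff_mul_nonneg ih hP m

theorem coeff_mul_pos {P Q : ℝ[X]} (hP : ∀ m, 0 ≤ P.coeff m) (hQ : ∀ m, 0 ≤ Q.coeff m)
    {d e : ℕ} (hPd : ∀ m ≤ d, 0 < P.coeff m) (hQe : ∀ m ≤ e, 0 < Q.coeff m) :
    ∀ m ≤ d + e, 0 < (P * Q).coeff m := by
  intro m hm
  rw [coeff_mul]
  refine Finset.sum_pos' (fun i _ => mul_nonneg (hP _) (hQ _))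
    ⟨(min m d, m - min m d), ?_, mul_pos (hPd _ (by omega)) (hQe _ (by omega))⟩
  rw [Finset.HasAntidiagonal.mem_antidiagonal]
  exact Nat.add_sub_cancel' (min_le_left _ _)

theorem coeff_pow_pos {P : ℝ[X]} (hP : ∀ m, 0 ≤ P.coeff m) {d : ℕ}
    (hPd : ∀ m ≤ d, 0 < P.coeff m) (k : ℕ) : ∀ m ≤ k * d, 0 < (P ^ k).coeff m := by
  induction k with
  | zero => intro m hm; rw [show m = 0 by omega]; simp
  | succ k ih =>
    intro m hm
    rw [pow_succ]
    exact coeff_mul_pos (coeff_pow_nonneg hP k) hP ih hPd m (by rwa [Nat.succ_mul] at hm)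

section sitePoly

variable {ι : Type} (s : Finset ι) (x : ι → ℝ)

theorem coeff_one_add_mul_X (a : ℝ) (m : ℕ) :
    (1 + C a * X : ℝ[X]).coeff m = if m = 0 then 1 else if m = 1 then a else 0 := by
  rcases m with _ | _ | m
  · simp
  · simp [coeff_one]
  · simp [coeff_one]

theorem natDegree_one_add_mul_X_le (a : ℝ) : (1 + C a * X : ℝ[X]).natDegree ≤ 1 := by
  rw [natDegree_le_iff_coeff_eq_zero]
  intro m hm
  rw [coeff_one_add_mul_X, if_neg (by omega), if_neg (by omega)]

theorem coeff_one_add_mul_X_nonneg {a : ℝ} (ha : 0 ≤ a) (m : ℕ) :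
    0 ≤ (1 + C a * X : ℝ[X]).coeff m := by
  rw [coeff_one_add_mul_X]; split_ifs <;> first | exact zero_le_one | exact ha | exact le_rfl

theorem coeff_sitePoly_nonneg (hx : ∀ i, 0 ≤ x i) (m : ℕ) : 0 ≤ (sitePoly s x).coeff m := by
  classical
  induction s using Finset.induction_on generalizing m with
  | empty => simp only [sitePoly, Finset.prod_empty, coeff_one]; split_ifs <;> norm_num
  | insert a s ha ih =>
    rw [sitePoly, Finset.prod_insert ha]
    exact coeff_mul_nonneg (coeff_one_add_mul_X_nonneg (hx a)) ih m

theorem coeff_sitePoly_pos (hx : ∀ i, 0 < x i) : ∀ m ≤ s.card, 0 < (sitePoly s x).coeff m := by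
  classical
  induction s using Finset.induction_on with
  | empty => intro m hm; rw [show m = 0 by simpa using hm]; simp [sitePoly]
  | insert a s ha ih =>
    rw [sitePoly, Finset.prod_insert ha, Finset.card_insert_of_notMem ha, add_comm]
    refine coeff_mul_pos (coeff_one_add_mul_X_nonneg (hx a).le)
      (coeff_sitePoly_nonneg s x fun i => (hx i).le) (fun m hm => ?_) ih
    rw [coeff_one_add_mul_X]
    split_ifs
    · exact one_pos
    · exact hx a
    · omega

theorem natDegree_sitePoly_le : (sitePoly s x).natDegree ≤ s.card := by
  refine (natDegree_prod_le _ _).trans ?_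
  rw [Finset.card_eq_sum_ones]
  exact Finset.sum_le_sum fun i _ => natDegree_one_add_mul_X_le (x i)

/-- The coefficients are elementary symmetric functions: `e₁ * e_m` contains each squarefree
monomial of degree `m + 1` exactly `m + 1` times, plus nonnegative terms. -/
theorem succ_mul_coeff_sitePoly_succ_le (hx : ∀ i, 0 ≤ x i) (m : ℕ) :
    ((m : ℝ) + 1) * (sitePoly s x).coeff (m + 1) ≤ (∑ i ∈ s, x i) * (sitePoly s x).coeff m := by
  classical
  induction s using Finset.induction_on generalizing m with
  | empty => simp [sitePoly, coeff_one]
  | insert a s ha ih =>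
    have hP : sitePoly (insert a s) x = sitePoly s x + C (x a) * (sitePoly s x * X) := by
      rw [sitePoly, Finset.prod_insert ha, sitePoly]; ring
    rw [hP, Finset.sum_insert ha]
    have hn := coeff_sitePoly_nonneg s x hx
    have hS : 0 ≤ ∑ i ∈ s, x i := Finset.sum_nonneg fun i _ => hx i
    have hxa := hx a
    cases m with
    | zero =>
      have := ih 0
      simp only [coeff_add, coeff_C_mul, coeff_mul_X, Nat.cast_zero, mul_coeff_zero,
        coeff_X_zero, mul_zero, add_zero, zero_add] at *
      nlinarith [hn 0]
    | succ m =>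
      have h1 := ih m
      have h2 := ih (m + 1)
      simp only [coeff_add, coeff_C_mul, coeff_mul_X]
      push_cast at *
      nlinarith [hn m, hn (m + 1), mul_le_mul_of_nonneg_left h1 hxa,
        mul_nonneg (mul_nonneg hxa hxa) (hn m)]

/-- Two applications of the preceding inequality. The factorial moment is thus dominated by removing
two particles. -/
theorem coeff_weigh_choose_le (hx : ∀ i, 0 ≤ x i) (m : ℕ) :
    (weigh (sitePoly s x) (fun m => (m : ℝ) * (m - 1))).coeff m
      ≤ (C ((∑ i ∈ s, x i) ^ 2) * (X ^ 2 * sitePoly s x)).coeff m := by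
  have hS : 0 ≤ ∑ i ∈ s, x i := Finset.sum_nonneg fun i _ => hx i
  rcases m with _ | _ | m
  · simp
  · rw [coeff_C_mul, coeff_X_pow_mul']; simp
  · have h1 := succ_mul_coeff_sitePoly_succ_le s x hx m
    have h2 := succ_mul_coeff_sitePoly_succ_le s x hx (m + 1)
    rw [coeff_weigh, coeff_C_mul, coeff_X_pow_mul]
    push_cast at *
    calc _ = ((m : ℝ) + 1) * (((m : ℝ) + 1 + 1) * (sitePoly s x).coeff (m + 1 + 1)) := by ring
      _ ≤ ((m : ℝ) + 1) * ((∑ i ∈ s, x i) * (sitePoly s x).coeff (m + 1)) := by gcongr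
      _ = (∑ i ∈ s, x i) * (((m : ℝ) + 1) * (sitePoly s x).coeff (m + 1)) := by ring
      _ ≤ (∑ i ∈ s, x i) * ((∑ i ∈ s, x i) * (sitePoly s x).coeff m) := by gcongr
      _ = _ := by ring

theorem succ_mul_coeff_one_add_pow (a : ℝ) (l j : ℕ) :
    ((j : ℝ) + 1) * ((1 + C a * X : ℝ[X]) ^ l).coeff (j + 1)
      = a * ((l : ℝ) - j) * ((1 + C a * X : ℝ[X]) ^ l).coeff j := by
  have h : (1 + C a * X) * derivative ((1 + C a * X : ℝ[X]) ^ l)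
      = C (l * a) * (1 + C a * X : ℝ[X]) ^ l := by
    rcases l with _ | l
    · simp
    · rw [derivative_pow]; simp; ring
  have h1 := congrArg (fun P => P.coeff j) h
  simp only [add_mul, one_mul, coeff_add, mul_assoc, coeff_C_mul, coeff_derivative] at h1
  cases j with
  | zero =>
    simp only [mul_coeff_zero, coeff_X_zero, zero_mul, mul_zero, add_zero] at h1
    push_cast at *
    linarith
  | succ j =>
    rw [coeff_X_mul, coeff_derivative] at h1
    push_cast at *
    linarith

/-- Among `l` copies of the site `i₀`, at least `l - M` are empty when there are `M` particles.
Adding a particle at one of them accounts for the left side; additions at other sites only help. -/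
theorem mul_coeff_pow_le (hx : ∀ i, 0 ≤ x i) {i₀ : ι} (hi : i₀ ∈ s) (l M : ℕ) :
    x i₀ * ((l : ℝ) - M) * (sitePoly s x ^ l).coeff M
      ≤ ((M : ℝ) + 1) * (sitePoly s x ^ l).coeff (M + 1) := by
  classical
  set B : ℝ[X] := (1 + C (x i₀) * X) ^ l with hB
  set Y : ℝ[X] := sitePoly (s.erase i₀) x ^ l with hY
  have hV : sitePoly s x ^ l = B * Y := by
    rw [hB, hY, ← mul_pow, sitePoly, ← Finset.mul_prod_erase s _ hi]; rfl
  have hB0 := coeff_pow_nonneg (coeff_one_add_mul_X_nonneg (hx i₀)) l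
  have hY0 := coeff_pow_nonneg (coeff_sitePoly_nonneg (s.erase i₀) x hx) l
  have h1 : (derivative B * Y).coeff M ≤ ((M : ℝ) + 1) * (sitePoly s x ^ l).coeff (M + 1) := by
    have : derivative (sitePoly s x ^ l) = derivative B * Y + B * derivative Y := by
      rw [hV, derivative_mul]
    have h2 := coeff_derivative (sitePoly s x ^ l) M
    rw [this, coeff_add] at h2
    have h3 : 0 ≤ (B * derivative Y).coeff M := by
      refine coeff_mul_nonneg hB0 (fun m => ?_) M
      rw [coeff_derivative]
      exact mul_nonneg (hY0 _) (by positivity)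
    linarith
  refine le_trans ?_ h1
  rw [hV, coeff_mul, coeff_mul, Finset.mul_sum]
  refine Finset.sum_le_sum fun ji hji => ?_
  have hj : (ji.1 : ℝ) ≤ M := by
    rw [Finset.HasAntidiagonal.mem_antidiagonal] at hji
    exact_mod_cast (by omega : ji.1 ≤ M)
  have h2 := succ_mul_coeff_one_add_pow (x i₀) l ji.1
  rw [← hB] at h2
  rw [coeff_derivative, mul_comm (B.coeff (ji.1 + 1)), h2, ← mul_assoc]
  refine mul_le_mul_of_nonneg_right ?_ (hY0 _)
  refine mul_le_mul_of_nonneg_right ?_ (hB0 _)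
  exact mul_le_mul_of_nonneg_left (by linarith) (hx i₀)

/-- The factorial moment costs two particles, hence a ratio of partition functions at `n - 2` and
`n`. Since `2 * n ≤ k + 1`, at least half of the copies of `i₀` are empty, and each removed particle
gives a factor of order `n / (x i₀ * (k + 1))`. -/
theorem abs_condMean_le_of_low_density (hx : ∀ i, 0 < x i) {i₀ : ι} (hi : i₀ ∈ s) {k n : ℕ}
    (hn : 2 * n ≤ k + 1) (hns : n ≤ (k + 1) * s.card) {g : ℕ → ℝ} {D : ℝ} (hD : 0 ≤ D)
    (hg : ∀ m ≤ s.card, |g m| ≤ D / 2 * ((m : ℝ) * (m - 1))) :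
    |condMean (sitePoly s x) k n g|
      ≤ 2 * D * ((∑ i ∈ s, x i) / x i₀) ^ 2 * ((n : ℝ) / (k + 1)) ^ 2 := by
  have hx0 : ∀ i, 0 ≤ x i := fun i => (hx i).le
  set P := sitePoly s x with hPdef
  have hP := coeff_sitePoly_nonneg s x hx0
  have hPk := coeff_pow_nonneg hP k
  have hZ := coeff_pow_pos hP (coeff_sitePoly_pos s x hx) (k + 1)
  have hZn := hZ n hns
  rw [← hPdef] at hP hPk hZ hZn
  set Z := (P ^ (k + 1)).coeff
  set σ := ∑ i ∈ s, x i
  have ha := hx i₀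
  rw [condMean, abs_div, abs_of_pos hZn, div_le_iff₀ hZn]
  have h1 : |(weigh P g * P ^ k).coeff n|
      ≤ D / 2 * (weigh P (fun m => (m : ℝ) * (m - 1)) * P ^ k).coeff n := by
    rw [coeff_mul, coeff_mul, Finset.mul_sum]
    refine (Finset.abs_sum_le_sum_abs _ _).trans (Finset.sum_le_sum fun ij _ => ?_)
    rw [abs_mul, abs_of_nonneg (hPk _), ← mul_assoc]
    refine mul_le_mul_of_nonneg_right ?_ (hPk _)
    rw [coeff_weigh, coeff_weigh, abs_mul, abs_of_nonneg (hP _)]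
    rcases le_or_gt ij.1 s.card with h | h
    · rw [mul_left_comm]
      exact mul_le_mul_of_nonneg_left (hg _ h) (hP _)
    · have : P.coeff ij.1 = 0 :=
        coeff_eq_zero_of_natDegree_lt ((natDegree_sitePoly_le s x).trans_lt h)
      simp [this]
  have h2 : (weigh P (fun m => (m : ℝ) * (m - 1)) * P ^ k).coeff n
      ≤ σ ^ 2 * (X ^ 2 * P ^ (k + 1)).coeff n := by
    have := coeff_mul_le_coeff_mul (coeff_weigh_choose_le s x hx0) hPk n
    rwa [mul_assoc, coeff_C_mul, mul_assoc, ← pow_succ'] at this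
  have h3 : (X ^ 2 * P ^ (k + 1)).coeff n ≤ (2 * n / (x i₀ * (k + 1))) ^ 2 * Z n := by
    rcases n with _ | _ | n
    · simp
    · rw [coeff_X_pow_mul', if_neg (by norm_num)]
      exact mul_nonneg (sq_nonneg _) hZn.le
    · rw [coeff_X_pow_mul]
      have e1 := mul_coeff_pow_le s x hx0 hi (k + 1) n
      have e2 := mul_coeff_pow_le s x hx0 hi (k + 1) (n + 1)
      have hn' : 2 * ((n : ℝ) + 2) ≤ k + 1 := by exact_mod_cast hn
      have z0 : 0 ≤ Z n := coeff_pow_nonneg hP _ _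
      have z1 : 0 ≤ Z (n + 1) := coeff_pow_nonneg hP _ _
      change x i₀ * (((k + 1 : ℕ) : ℝ) - n) * Z n ≤ ((n : ℝ) + 1) * Z (n + 1) at e1
      change x i₀ * (((k + 1 : ℕ) : ℝ) - ((n + 1 : ℕ) : ℝ)) * Z (n + 1)
        ≤ (((n + 1 : ℕ) : ℝ) + 1) * Z (n + 1 + 1) at e2
      push_cast at *
      set b := x i₀ * ((k : ℝ) + 1) with hb
      have hb0 : 0 < b := by positivity
      have step {u w c : ℝ} (hu : 0 ≤ u) (hc : c ≤ ((k : ℝ) + 1) / 2) {d : ℝ}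
          (h : x i₀ * ((k : ℝ) + 1 - c) * u ≤ d * w) : u ≤ 2 * d / b * w := by
        have : b / 2 * u ≤ d * w := by
          refine le_trans (mul_le_mul_of_nonneg_right ?_ hu) h
          rw [hb]
          nlinarith
        rw [div_mul_eq_mul_div, le_div_iff₀ hb0]
        linarith
      have s1 := step z0 (by linarith) e1
      have s2 := step z1 (by linarith) e2
      have zz : 0 ≤ Z (n + 1 + 1) := hZn.le
      calc Z n ≤ 2 * ((n : ℝ) + 1) / b * (2 * ((n : ℝ) + 1 + 1) / b * Z (n + 1 + 1)) :=
            s1.trans (by gcongr)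
        _ ≤ 2 * ((n : ℝ) + 1 + 1) / b * (2 * ((n : ℝ) + 1 + 1) / b * Z (n + 1 + 1)) := by
            gcongr; linarith
        _ = _ := by ring
  calc _ ≤ D / 2 * (σ ^ 2 * ((2 * n / (x i₀ * (k + 1))) ^ 2 * Z n)) :=
        h1.trans (mul_le_mul_of_nonneg_left
          (h2.trans (mul_le_mul_of_nonneg_left h3 (sq_nonneg _))) (by positivity))
    _ = _ := by field_simp

/-! ### Exchanging particles and holes -/

theorem reflect_sitePoly (hx : ∀ i, 0 < x i) :
    reflect s.card (sitePoly s x) = C (∏ i ∈ s, x i) * sitePoly s (fun i => (x i)⁻¹) := by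
  classical
  induction s using Finset.induction_on with
  | empty => simp [sitePoly]
  | insert a s ha ih =>
    have h1 : reflect 1 (1 + C (x a) * X : ℝ[X]) = C (x a) * (1 + C (x a)⁻¹ * X) := by
      have hxa := (hx a).ne'
      ext m
      rw [coeff_reflect, coeff_C_mul, coeff_one_add_mul_X, coeff_one_add_mul_X]
      rcases m with _ | _ | m
      · simp [revAt_le]
      · simp [revAt_le, hxa]
      · rw [revAt_eq_self_of_lt (by omega)]; simp
    have hd := natDegree_one_add_mul_X_le (x a)
    rw [Finset.card_insert_of_notMem ha, add_comm s.card, sitePoly, Finset.prod_insert ha,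
      Finset.prod_insert ha, sitePoly, Finset.prod_insert ha]
    change reflect (1 + s.card) (_ * sitePoly s x) = _ * (_ * sitePoly s (fun i => (x i)⁻¹))
    rw [reflect_mul _ _ hd (natDegree_sitePoly_le s x), ih, h1, C_mul]
    ring

/-- Reversing coefficients replaces every activity by its inverse, up to a constant common to
numerator and denominator. High density in particles becomes low density in holes. -/
theorem condMean_reflect (hx : ∀ i, 0 < x i) {k M : ℕ} (hM : M ≤ (k + 1) * s.card) (g : ℕ → ℝ) :
    condMean (sitePoly s x) k M g
      = condMean (sitePoly s (fun i => (x i)⁻¹)) k ((k + 1) * s.card - M)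
        (fun m => g (s.card - m)) := by
  set d := s.card with hd
  set P := sitePoly s x with hP
  set Q := sitePoly s (fun i => (x i)⁻¹) with hQ
  set c := ∏ i ∈ s, x i with hc
  have hc0 : c ≠ 0 := (Finset.prod_pos fun i _ => hx i).ne'
  have hPd : P.natDegree ≤ d := natDegree_sitePoly_le s x
  have hQd : Q.natDegree ≤ d := natDegree_sitePoly_le s _
  have hr : reflect d P = C c * Q := reflect_sitePoly s x hx
  have hpow (j : ℕ) : reflect (j * d) (P ^ j) = C (c ^ j) * Q ^ j := by
    induction j with
    | zero => simp
    | succ j ih =>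
      rw [pow_succ, Nat.succ_mul, reflect_mul _ _ (natDegree_pow_le_of_le j hPd) hPd, ih, hr,
        pow_succ, pow_succ, C_mul]
      ring
  have hw : (weigh P g).natDegree ≤ d := by
    rw [natDegree_le_iff_coeff_eq_zero]
    intro m hm
    rw [coeff_weigh, coeff_eq_zero_of_natDegree_lt (hPd.trans_lt hm), zero_mul]
  have hrw : reflect d (weigh P g) = C c * weigh Q (fun m => g (d - m)) := by
    ext m
    rw [coeff_reflect, coeff_weigh, coeff_C_mul, coeff_weigh, ← mul_assoc, ← coeff_C_mul, ← hr,
      coeff_reflect]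
    rcases le_or_gt m d with h | h
    · rw [revAt_le h]
    · rw [revAt_eq_self_of_lt h, coeff_eq_zero_of_natDegree_lt (hPd.trans_lt h), zero_mul,
        zero_mul]
  have hnum : reflect ((k + 1) * d) (weigh P g * P ^ k)
      = C (c ^ (k + 1)) * (weigh Q (fun m => g (d - m)) * Q ^ k) := by
    rw [Nat.succ_mul, add_comm, reflect_mul _ _ hw (natDegree_pow_le_of_le k hPd), hrw, hpow,
      pow_succ, C_mul]
    ring
  have hcoef {A B : ℝ[X]} (h : reflect ((k + 1) * d) A = C (c ^ (k + 1)) * B) :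
      A.coeff M = c ^ (k + 1) * B.coeff ((k + 1) * d - M) := by
    rw [← coeff_C_mul, ← h, coeff_reflect, revAt_le (Nat.sub_le _ _), Nat.sub_sub_self hM]
  rw [condMean, condMean, hcoef hnum, hcoef (hpow (k + 1)),
    mul_div_mul_left _ _ (pow_ne_zero _ hc0)]

end sitePoly

/-! ### Tilting the activities to a prescribed density. -/

section tilt

variable {ι : Type} (s : Finset ι) (x : ι → ℝ)

/-- After normalization, activities `y * x i` give independent Bernoulli variables, so
`condMean_scale` identifies the two conditional laws. -/
theorem bernoulliPoly_tilt (hx : ∀ i, 0 < x i) {y : ℝ} (hy : 0 < y) :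
    bernoulliPoly s (fun i => y * x i / (1 + y * x i))
      = C (∏ i ∈ s, (1 + y * x i)⁻¹) * (sitePoly s x).comp (C y * X) := by
  rw [sitePoly, prod_comp, map_prod, ← Finset.prod_mul_distrib, bernoulliPoly]
  refine Finset.prod_congr rfl fun i _ => ?_
  have h : 1 + y * x i ≠ 0 := by have := mul_pos hy (hx i); positivity
  have h1 : 1 - y * x i / (1 + y * x i) = (1 + y * x i)⁻¹ := by field_simp; ring
  have h2 : y * x i / (1 + y * x i) = (1 + y * x i)⁻¹ * (x i * y) := by field_simp
  rw [h1, h2]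
  simp only [add_comp, one_comp, mul_comp, C_comp, X_comp, C_mul]
  ring

theorem condMeanDiff_tilt (hx : ∀ i, 0 < x i) {y : ℝ} (hy : 0 < y) (k M : ℕ) (f : ℕ → ℝ) :
    condMeanDiff (bernoulliPoly s (fun i => y * x i / (1 + y * x i))) k M f
      = condMeanDiff (sitePoly s x) k M f := by
  have hc : ∏ i ∈ s, (1 + y * x i)⁻¹ ≠ 0 :=
    (Finset.prod_pos fun i _ => by have := mul_pos hy (hx i); positivity).ne'
  have h := fun M => condMean_scale hc hy.ne' (bernoulliPoly_tilt s x hx hy) k M f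
  simp only [condMeanDiff, h]

theorem exists_tilt (hx : ∀ i, 0 < x i) {ρ : ℝ} (h0 : 0 < ρ) (h1 : ρ < s.card) :
    ∃ y : ℝ, 0 < y ∧ ∑ i ∈ s, y * x i / (1 + y * x i) = ρ := by
  set F : ℝ → ℝ := fun y => ∑ i ∈ s, y * x i / (1 + y * x i) with hF
  have hlim : Filter.Tendsto F Filter.atTop (nhds s.card) := by
    have : (s.card : ℝ) = ∑ i ∈ s, (1 - 0 : ℝ) := by simp
    rw [this]
    refine tendsto_finsetSum _ fun i _ => ?_
    have h2 : Filter.Tendsto (fun y : ℝ => 1 + y * x i) Filter.atTop Filter.atTop :=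
      Filter.tendsto_atTop_add_const_left _ _ (Filter.tendsto_id.atTop_mul_const (hx i))
    refine (h2.inv_tendsto_atTop.const_sub 1).congr' ?_
    filter_upwards [Filter.eventually_gt_atTop 0] with y hy
    have : 1 + y * x i ≠ 0 := by have := mul_pos hy (hx i); positivity
    rw [Pi.inv_apply]
    field_simp; ring
  obtain ⟨Y, hY, hY0⟩ := ((hlim.eventually (lt_mem_nhds h1)).and
    (Filter.eventually_gt_atTop 0)).exists
  have hcont : ContinuousOn F (Set.Icc 0 Y) := by
    refine continuousOn_finsetSum _ fun i _ => ContinuousOn.div (by fun_prop) (by fun_prop) ?_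
    intro y hy
    have := mul_nonneg hy.1 (hx i).le
    positivity
  obtain ⟨y, hy, hyρ⟩ := intermediate_value_Icc hY0.le hcont
    (⟨by simp [hF, h0.le], hY.le⟩ : ρ ∈ Set.Icc (F 0) (F Y))
  refine ⟨y, lt_of_le_of_ne hy.1 ?_, hyρ⟩
  rintro rfl
  simp [hF] at hyρ
  linarith

end tilt

/-! ### Variance of the particle number of a stick. -/

/-- Occupation probabilities at adjacent heights differ by an amount comparable to `p (1 - p)`. Sums
of variances are thus compared with telescoping sums, uniformly in the height. -/
theorem fermi_sub_le {r y : ℝ} (hr0 : 0 < r) (hr1 : r < 1) (hy : 0 < y) :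
    (1 - r) * (y / (1 + y) * (1 - y / (1 + y))) ≤ y / (1 + y) - r * y / (1 + r * y) ∧
    y / (1 + y) - r * y / (1 + r * y) ≤ (1 - r) / r * (y / (1 + y) * (1 - y / (1 + y))) := by
  have h1 : 0 < 1 + y := by positivity
  have h2 : 0 < 1 + r * y := by positivity
  have e1 : y / (1 + y) - r * y / (1 + r * y) = (1 - r) * y / ((1 + y) * (1 + r * y)) := by
    field_simp; ring
  have e2 : y / (1 + y) * (1 - y / (1 + y)) = y / ((1 + y) * (1 + y)) := by
    field_simp; ring
  have hry : r * y ≤ y := by nlinarith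
  have h1r : 0 ≤ 1 - r := by linarith
  rw [e1, e2]
  constructor
  · rw [mul_div_assoc]
    gcongr
  · rw [div_mul_div_comm, div_le_div_iff₀ (by positivity) (by positivity)]
    have : r * (1 + y) ≤ 1 + r * y := by nlinarith
    have hz : 0 ≤ (1 - r) * y * (1 + y) := by positivity
    nlinarith [mul_le_mul_of_nonneg_left this hz]

/-- Upper and lower bounds for the variance of the particle number of a stick, uniform in its
height and in its density. -/
theorem variance_fermi_bounds {r y : ℝ} (hr0 : 0 < r) (hr1 : r < 1) (hy : 0 < y) (H : ℕ)
    (p : Fin H → ℝ) (hp : ∀ h, p h = y * r ^ ((h : ℕ) + 1) / (1 + y * r ^ ((h : ℕ) + 1))) :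
    ∑ h, p h * (1 - p h) ≤ 1 / (1 - r) ∧
    (min (1 / 4) (r / (2 * (1 - r))) * min 1 (min (∑ h, p h) (H - ∑ h, p h))
      ≤ ∑ h, p h * (1 - p h)) := by
  have h1r : 0 < 1 - r := by linarith
  set P : ℕ → ℝ := fun h => y * r ^ (h + 1) / (1 + y * r ^ (h + 1)) with hP
  have hpP : ∀ h : Fin H, p h = P h := hp
  have hpos (h : ℕ) : 0 < y * r ^ (h + 1) := by positivity
  have hP0 (h : ℕ) : 0 < P h := div_pos (hpos h) (by have := hpos h; linarith)
  have hP1 (h : ℕ) : P h < 1 := by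
    have := hpos h
    rw [hP]; simp only
    rw [div_lt_one (by linarith)]; linarith
  have hstep (h : ℕ) := fermi_sub_le hr0 hr1 (hpos h)
  have hsucc (h : ℕ) : r * (y * r ^ (h + 1)) / (1 + r * (y * r ^ (h + 1))) = P (h + 1) := by
    simp only [hP]; rw [show r * (y * r ^ (h + 1)) = y * r ^ (h + 1 + 1) by ring]
  simp only [hsucc] at hstep
  change ∀ h, (1 - r) * (P h * (1 - P h)) ≤ P h - P (h + 1) ∧
    P h - P (h + 1) ≤ (1 - r) / r * (P h * (1 - P h)) at hstep
  have hanti : Antitone P := antitone_nat_of_succ_le fun h => by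
    have h1 := (hstep h).1
    have := mul_nonneg h1r.le (mul_nonneg (hP0 h).le (by linarith [hP1 h] : 0 ≤ 1 - P h))
    linarith
  have hsum : ∑ h, p h * (1 - p h) = ∑ h ∈ Finset.range H, P h * (1 - P h) := by
    rw [← Fin.sum_univ_eq_sum_range (fun h => P h * (1 - P h))]
    exact Finset.sum_congr rfl fun h _ => by rw [hpP]
  have hsum1 : ∑ h, p h = ∑ h ∈ Finset.range H, P h := by
    rw [← Fin.sum_univ_eq_sum_range (fun h => P h)]
    exact Finset.sum_congr rfl fun h _ => by rw [hpP]
  rw [hsum, hsum1]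
  set v := ∑ h ∈ Finset.range H, P h * (1 - P h) with hv
  have htel := Finset.sum_range_sub' P H
  constructor
  · rw [le_div_iff₀ h1r, hv, Finset.sum_mul]
    have : ∑ h ∈ Finset.range H, P h * (1 - P h) * (1 - r)
        ≤ ∑ h ∈ Finset.range H, (P h - P (h + 1)) :=
      Finset.sum_le_sum fun h _ => by rw [mul_comm]; exact (hstep h).1
    linarith [hP1 0, hP0 H]
  · have hlow : r / (1 - r) * (P 0 - P H) ≤ v := by
      rw [← htel, hv, Finset.mul_sum]
      refine Finset.sum_le_sum fun h _ => ?_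
      have := mul_le_mul_of_nonneg_left (hstep h).2 (div_nonneg hr0.le h1r.le)
      refine this.trans (le_of_eq ?_)
      field_simp
    set c := min (1 / 4) (r / (2 * (1 - r)))
    have hc4 : c ≤ 1 / 4 := min_le_left _ _
    have hcr : c ≤ r / (2 * (1 - r)) := min_le_right _ _
    have hc0 : 0 ≤ c := le_min (by norm_num) (by positivity)
    have hρ0 : 0 ≤ ∑ h ∈ Finset.range H, P h := Finset.sum_nonneg fun h _ => (hP0 h).le
    have hHρ : (H : ℝ) - ∑ h ∈ Finset.range H, P h = ∑ h ∈ Finset.range H, (1 - P h) := by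
      simp
    have hH0 : 0 ≤ (H : ℝ) - ∑ h ∈ Finset.range H, P h := by
      rw [hHρ]; exact Finset.sum_nonneg fun h _ => by linarith [hP1 h]
    -- Three profiles: if all sites have `p ≤ 3/4` the variance dominates the particle number; if
    -- the profile falls from above `3/4` to at most `1/4` the telescoping drop exceeds `1/2`;
    -- otherwise all sites have `p > 1/4` and the variance dominates the hole number.
    rcases le_or_gt (P 0) (3 / 4) with h | h
    · calc _ ≤ 1 / 4 * ∑ h ∈ Finset.range H, P h := by
            gcongr; exact (min_le_right _ _).trans (min_le_left _ _)
        _ ≤ v := by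
            rw [hv, Finset.mul_sum]
            refine Finset.sum_le_sum fun j _ => ?_
            nlinarith [hP0 j, hanti (Nat.zero_le j)]
    · rcases le_or_gt (P H) (1 / 4) with h' | h'
      · calc _ ≤ r / (2 * (1 - r)) * 1 := by
              gcongr; exact min_le_left _ _
          _ = r / (1 - r) * (1 / 2) := by field_simp
          _ ≤ r / (1 - r) * (P 0 - P H) := by gcongr; linarith
          _ ≤ v := hlow
      · calc _ ≤ 1 / 4 * ((H : ℝ) - ∑ h ∈ Finset.range H, P h) := by
              gcongr; exact (min_le_right _ _).trans (min_le_right _ _)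
          _ ≤ v := by
              rw [hHρ, hv, Finset.mul_sum]
              refine Finset.sum_le_sum fun j hj => ?_
              have := hanti (Finset.mem_range.1 hj).le
              nlinarith [hP1 j]

/-! ### Contraction of second differences for sticks. -/

/-- The generating polynomial of the particle number of a stick of height `H`. -/
noncomputable def stickPoly (q : ℝ) (H : ℕ) : ℝ[X] :=
  sitePoly Finset.univ fun h : Fin H => (q ^ 2) ^ ((h : ℕ) + 1)

theorem coeff_stickPoly_pow_pos {q : ℝ} (hq : 0 < q) (H k m : ℕ) (hm : m ≤ k * H) :
    0 < (stickPoly q H ^ k).coeff m := by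
  refine coeff_pow_pos (coeff_sitePoly_nonneg _ _ fun h => by positivity)
    (coeff_sitePoly_pos _ _ fun h => by positivity) k m ?_
  simpa using hm

/-- The total activity is comparable to that of the most favourable site: the lowest one for
particles, the highest one for holes. The low-density constants are therefore independent of the
height. -/
theorem sum_geom_div_le {r : ℝ} (hr0 : 0 < r) (hr1 : r < 1) (H : ℕ) :
    ∑ h : Fin (H + 1), r ^ ((h : ℕ) + 1) / r ≤ 1 / (1 - r) ∧
    ∑ h : Fin (H + 1), (r ^ ((h : ℕ) + 1))⁻¹ / (r ^ (H + 1))⁻¹ ≤ 1 / (1 - r) := by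
  have hg : ∑ h ∈ Finset.range (H + 1), r ^ h ≤ 1 / (1 - r) := by
    rw [one_div, ← tsum_geometric_of_lt_one hr0.le hr1]
    exact (summable_geometric_of_lt_one hr0.le hr1).sum_le_tsum _ fun i _ => by positivity
  constructor
  · refine le_trans (le_of_eq ?_) hg
    rw [← Fin.sum_univ_eq_sum_range]
    exact Finset.sum_congr rfl fun h _ => by rw [pow_succ]; field_simp
  · refine le_trans (le_of_eq ?_) hg
    rw [← Fin.sum_univ_eq_sum_range, ← Equiv.sum_comp Fin.revPerm]
    refine Finset.sum_congr rfl fun h _ => ?_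
    have h1 : ((Fin.revPerm h : Fin (H + 1)) : ℕ) = H - h := by simp [Fin.val_rev]
    have h2 : H + 1 = (H - h + 1) + h := by omega
    have h3 : r ^ (H + 1) = r ^ (H - (h : ℕ) + 1) * r ^ (h : ℕ) := by rw [← pow_add, ← h2]
    rw [h1, div_eq_iff (by positivity), h3]
    field_simp

/-- Second differences of the conditional mean of one stick given the total number of particles
in `k + 1` sticks are at most of order `(k + 1) ^ (-4 / 3)`, uniformly in the height and the
density. -/
theorem exists_condMeanDiff_stickPoly_le {q : ℝ} (hq0 : 0 < q) (hq1 : q < 1) :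
    ∃ κ τ₀ : ℝ, 0 < κ ∧ 0 < τ₀ ∧ ∀ (H k M : ℕ) (τ : ℝ), τ₀ ≤ τ → τ ^ 3 = (k : ℝ) + 1 →
      M + 2 ≤ (k + 1) * H → ∀ (f : ℕ → ℝ) (D : ℝ),
      (∀ m, |f (m + 2) - 2 * f (m + 1) + f m| ≤ D) →
      |condMeanDiff (stickPoly q H) k M f| ≤ κ * D / τ ^ 4 := by
  set r := q ^ 2 with hr
  have hr0 : 0 < r := by positivity
  have hr1 : r < 1 := by rw [hr]; nlinarith
  have h1r : 0 < 1 - r := by linarith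
  obtain ⟨C₀, Λ₀, hC, hΛ, hbulk⟩ := exists_condMeanDiff_bernoulliPoly_le (S := 1 / (1 - r))
    (by positivity)
  set c := min (1 / 4) (r / (2 * (1 - r))) with hc
  have hc0 : 0 < c := lt_min (by norm_num) (by positivity)
  -- The `32` is `8` from the low-density bound with `n ≤ 2 τ`, times the weight `1 + 2 + 1` of a
  -- second difference. The threshold gives `τ ≥ 2` and `c * τ ≥ Λ₀`.
  refine ⟨32 * (1 / (1 - r)) ^ 2 + C₀ / c, 2 + Λ₀ / c, by positivity, by positivity,
    fun H k M τ hτ hτ3 hM f D hf => ?_⟩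
  have hΛc : 0 < Λ₀ / c := by positivity
  have hτ2 : 2 ≤ τ := by linarith
  have hτΛ : Λ₀ ≤ c * τ := by
    have : Λ₀ / c ≤ τ := by linarith
    rw [div_le_iff₀ hc0] at this; linarith
  have hτ0 : 0 < τ := by linarith
  have hD : 0 ≤ D := (abs_nonneg _).trans (hf 0)
  have hcube : 4 * τ ≤ (k : ℝ) + 1 := by
    rw [← hτ3]; nlinarith [mul_nonneg hτ0.le (sub_nonneg.2 hτ2)]
  obtain ⟨H, rfl⟩ : ∃ H', H = H' + 1 := by
    cases H with
    | zero => omega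
    | succ H => exact ⟨H, rfl⟩
  set x : Fin (H + 1) → ℝ := fun h => r ^ ((h : ℕ) + 1) with hx
  have hx0 : ∀ h, 0 < x h := fun h => by positivity
  have hst : stickPoly q (H + 1) = sitePoly Finset.univ x := rfl
  have hcard : (Finset.univ : Finset (Fin (H + 1))).card = H + 1 := by simp
  obtain ⟨hg1, hg2⟩ := sum_geom_div_le hr0 hr1 H
  have hsum1 : (∑ h, x h) / x 0 ≤ 1 / (1 - r) := by
    rw [Finset.sum_div]; simpa [hx] using hg1
  have hsum2 : (∑ h, (x h)⁻¹) / (x (Fin.last H))⁻¹ ≤ 1 / (1 - r) := by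
    rw [Finset.sum_div]; simpa [hx] using hg2
  have hn1 : 0 ≤ (∑ h, x h) / x 0 :=
    div_nonneg (Finset.sum_nonneg fun h _ => (hx0 h).le) (hx0 _).le
  have hn2 : 0 ≤ (∑ h, (x h)⁻¹) / (x (Fin.last H))⁻¹ :=
    div_nonneg (Finset.sum_nonneg fun h _ => (inv_pos.2 (hx0 h)).le) (inv_pos.2 (hx0 _)).le
  have hZ (n : ℕ) (hn : n ≤ (k + 1) * (H + 1)) : (stickPoly q (H + 1) ^ (k + 1)).coeff n ≠ 0 :=
    (coeff_stickPoly_pow_pos hq0 _ _ _ hn).ne'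
  have hnum {n : ℕ} (hn : (n : ℝ) ≤ 2 * τ) : 2 * n ≤ k + 1 := by
    have : (2 * n : ℝ) ≤ k + 1 := by linarith
    exact_mod_cast this
  have hbd {n : ℕ} (hn : (n : ℝ) ≤ 2 * τ) {z : ℝ} (hz0 : 0 ≤ z) (hz : z ≤ 1 / (1 - r)) :
      2 * D * z ^ 2 * ((n : ℝ) / (k + 1)) ^ 2 ≤ 8 * (1 / (1 - r)) ^ 2 * D / τ ^ 4 := by
    rw [← hτ3]
    calc _ ≤ 2 * D * (1 / (1 - r)) ^ 2 * ((2 * τ) / τ ^ 3) ^ 2 := by gcongr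
      _ = _ := by field_simp; ring
  have hcomb (g : ℕ → ℝ)
      (hg : ∀ n, M ≤ n → n ≤ M + 2 → |condMean (stickPoly q (H + 1)) k n g|
        ≤ 8 * (1 / (1 - r)) ^ 2 * D / τ ^ 4) :
      |condMeanDiff (stickPoly q (H + 1)) k M g| ≤ 32 * (1 / (1 - r)) ^ 2 * D / τ ^ 4 := by
    have g0 := abs_le.1 (hg M le_rfl (by omega))
    have g1 := abs_le.1 (hg (M + 1) (by omega) (by omega))
    have g2 := abs_le.1 (hg (M + 2) (by omega) le_rfl)
    have e : 32 * (1 / (1 - r)) ^ 2 * D / τ ^ 4 = 4 * (8 * (1 / (1 - r)) ^ 2 * D / τ ^ 4) := by ring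
    rw [condMeanDiff, e, abs_le]
    constructor <;> linarith [g0.1, g0.2, g1.1, g1.2, g2.1, g2.2]
  have hκ : 32 * (1 / (1 - r)) ^ 2 * D / τ ^ 4
      ≤ (32 * (1 / (1 - r)) ^ 2 + C₀ / c) * D / τ ^ 4 := by
    gcongr; exact le_add_of_nonneg_right (by positivity)
  -- Few particles: subtract the chord of `f` through `0` and `1`.
  by_cases hlow : (M : ℝ) + 1 ≤ τ
  · refine le_trans ?_ hκ
    set g : ℕ → ℝ := fun m => f m + (-f 0 + -(f 1 - f 0) * m)
    rw [← condMeanDiff_add_affine (hZ M (by omega)) (hZ (M + 1) (by omega)) (hZ (M + 2) hM) f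
      (-f 0) (-(f 1 - f 0))]
    refine hcomb g fun n hn1' hn2' => ?_
    have hnτ : (n : ℝ) ≤ 2 * τ := by
      have : (n : ℝ) ≤ M + 2 := by exact_mod_cast hn2'
      linarith
    refine (abs_condMean_le_of_low_density Finset.univ x hx0 (Finset.mem_univ 0) (hnum hnτ)
      (by rw [hcard]; omega) hD fun m _ => ?_).trans (hbd hnτ hn1 hsum1)
    have := abs_sub_affine_le hf 0 m
    simp only [Nat.cast_zero, sub_zero, zero_add] at this
    refine le_trans (le_of_eq ?_) this
    simp only [g]; congr 1; ring
  -- Few holes: the stick has `H + 1` sites, so zero and one hole mean `H + 1` and `H` particles,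
  -- and the chord through these is subtracted.
  · by_cases hhigh : ((k + 1) * (H + 1) : ℝ) - M - 1 ≤ τ
    · refine le_trans ?_ hκ
      set g : ℕ → ℝ := fun m => f m + ((-f H + (f (H + 1) - f H) * H) + -(f (H + 1) - f H) * m)
        with hgdef
      rw [← condMeanDiff_add_affine (hZ M (by omega)) (hZ (M + 1) (by omega)) (hZ (M + 2) hM) f
        (-f H + (f (H + 1) - f H) * H) (-(f (H + 1) - f H))]
      refine hcomb g fun n hn1' hn2' => ?_
      have hnle : n ≤ (k + 1) * (H + 1) := hn2'.trans hM
      rw [hst, condMean_reflect Finset.univ x hx0 (by rw [hcard]; exact hnle), hcard]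
      have hnτ : (((k + 1) * (H + 1) - n : ℕ) : ℝ) ≤ 2 * τ := by
        rw [Nat.cast_sub hnle]
        have : (M : ℝ) ≤ n := by exact_mod_cast hn1'
        push_cast
        linarith
      refine (abs_condMean_le_of_low_density Finset.univ (fun h => (x h)⁻¹)
        (fun h => inv_pos.2 (hx0 h)) (Finset.mem_univ (Fin.last H)) (hnum hnτ)
        (by rw [hcard]; omega) hD fun m hm => ?_).trans (hbd hnτ hn2 hsum2)
      rw [hcard] at hm
      have := abs_sub_affine_le hf H (H + 1 - m)
      rw [Nat.cast_sub hm] at this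
      push_cast at this
      have e : D / 2 * (((H : ℝ) + 1 - m - H) * ((H : ℝ) + 1 - m - H - 1))
          = D / 2 * ((m : ℝ) * (m - 1)) := by ring
      rw [e] at this
      refine le_trans (le_of_eq ?_) this
      simp only [hgdef]
      rw [Nat.cast_sub hm]
      congr 1; push_cast; ring
    · push Not at hlow hhigh
      -- Bulk: more than `τ` particles and more than `τ` holes force a total variance of at least `c
      -- * τ` after tilting to density `(M + 1) / (k + 1)`.
      have hk0 : (0 : ℝ) < (k : ℝ) + 1 := by positivity
      obtain ⟨y, hy, hyρ⟩ := exists_tilt (Finset.univ : Finset (Fin (H + 1))) x hx0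
        (ρ := ((M : ℝ) + 1) / (k + 1)) (by positivity) (by
          rw [hcard, div_lt_iff₀ hk0]; push_cast; nlinarith)
      obtain ⟨hv1, hv2⟩ := variance_fermi_bounds hr0 hr1 hy (H + 1)
        (fun h => y * x h / (1 + y * x h)) (fun h => rfl)
      rw [hst, ← condMeanDiff_tilt Finset.univ x hx0 hy]
      have hb := hbulk (Fin (H + 1)) Finset.univ (fun h => y * x h / (1 + y * x h))
      set p : Fin (H + 1) → ℝ := fun h => y * x h / (1 + y * x h) with hp
      have hp01 : ∀ h, 0 ≤ p h ∧ p h ≤ 1 := fun h => by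
        have := mul_pos hy (hx0 h)
        exact ⟨by positivity, (div_le_one (by positivity)).2 (by linarith)⟩
      rw [hyρ] at hv2
      have hkv : c * τ ≤ ((k : ℝ) + 1) * ∑ h, p h * (1 - p h) := by
        refine le_trans ?_ (mul_le_mul_of_nonneg_left hv2 hk0.le)
        rw [mul_left_comm]
        refine mul_le_mul_of_nonneg_left ?_ hc0.le
        rw [mul_min_of_nonneg _ _ hk0.le, mul_min_of_nonneg _ _ hk0.le, mul_sub,
          mul_div_cancel₀ _ hk0.ne']
        refine le_min (by linarith) (le_min hlow.le ?_)
        push_cast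
        linarith
      have hv0 : 0 < ∑ h, p h * (1 - p h) :=
        pos_of_mul_pos_right ((mul_pos hc0 hτ0).trans_le hkv) hk0.le
      have hk1 : 1 ≤ k := by
        have : (0 : ℝ) < k := by linarith
        exact_mod_cast this
      refine (hb hp01 hv0 hv1 k M hk1 (by rw [hyρ, mul_div_cancel₀ _ hk0.ne'])
        (hτΛ.trans hkv) f D hf).trans ?_
      calc _ ≤ C₀ * D / (τ ^ 3 * (c * τ)) := by rw [hτ3]; gcongr
        _ = C₀ / c * D / τ ^ 4 := by field_simp
        _ ≤ _ := by gcongr; exact le_add_of_nonneg_left (by positivity)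

/-! ### Eigenfunctions on the admissible particle numbers. -/

theorem coeff_weigh_mul_congr {P Q : ℝ[X]} {M : ℕ} {F G : ℕ → ℝ}
    (h : ∀ m j, m + j = M → P.coeff m = 0 ∨ Q.coeff j = 0 ∨ F m = G m) :
    (weigh P F * Q).coeff M = (weigh P G * Q).coeff M := by
  rw [coeff_mul, coeff_mul]
  refine Finset.sum_congr rfl fun ij hij => ?_
  rw [Finset.HasAntidiagonal.mem_antidiagonal] at hij
  rw [coeff_weigh, coeff_weigh]
  rcases h ij.1 ij.2 hij with h | h | h <;> rw [h] <;> simp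

/-- If one stick holds `n ≤ H` of `N` particles, any number `m` occurring with positive weight in
another is again admissible: the remaining `k + 1` sticks, including the first, hold at most `(k +
1) * H`. -/
theorem condMean_congr_of_admissible {P : ℝ[X]} {H k N n : ℕ} (hP : P.natDegree ≤ H)
    (hn1 : n ≤ min N H) {F G : ℕ → ℝ}
    (hFG : ∀ m, N - (k + 1) * H ≤ m → m ≤ min N H → F m = G m) :
    condMean P k (N - n) F = condMean P k (N - n) G := by
  rw [condMean, condMean]
  congr 1
  refine coeff_weigh_mul_congr fun m j hmj => ?_
  have hnN : n ≤ N := hn1.trans (min_le_left _ _)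
  have hnH : n ≤ H := hn1.trans (min_le_right _ _)
  by_cases hm : m ≤ H
  · by_cases hj : j ≤ k * H
    · refine Or.inr (Or.inr (hFG m ?_ (le_min (by omega) hm)))
      rw [Nat.succ_mul]; omega
    · exact Or.inr (Or.inl (coeff_eq_zero_of_natDegree_lt
        ((natDegree_pow_le_of_le k hP).trans_lt (not_le.1 hj))))
  · exact Or.inl (coeff_eq_zero_of_natDegree_lt (hP.trans_lt (not_le.1 hm)))

/-- A function on an interval of integers extends to all integers without increasing its second
differences. -/
theorem exists_extension_secondDiff_le (F : ℕ → ℝ) {a b : ℕ} (hab : a + 1 ≤ b) {D : ℝ}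
    (hD : 0 ≤ D) (hF : ∀ m, a ≤ m → m + 2 ≤ b → |F (m + 2) - 2 * F (m + 1) + F m| ≤ D) :
    ∃ G : ℕ → ℝ, (∀ m, a ≤ m → m ≤ b → G m = F m) ∧
      ∀ m, |G (m + 2) - 2 * G (m + 1) + G m| ≤ D := by
  set G : ℕ → ℝ := fun m => if m < a then F a + ((m : ℝ) - a) * (F (a + 1) - F a)
    else if m ≤ b then F m else F b + ((m : ℝ) - b) * (F b - F (b - 1)) with hG
  have hmid : ∀ m, a ≤ m → m ≤ b → G m = F m := fun m h1 h2 => by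
    simp only [hG]; rw [if_neg (by omega), if_pos h2]
  -- The left chord formula is also valid at `a` and `a + 1`, so no second difference straddles a
  -- kink; likewise on the right at `b - 1` and `b`.
  have hleft : ∀ m, m ≤ a + 1 → G m = F a + ((m : ℝ) - a) * (F (a + 1) - F a) := fun m h => by
    rcases lt_or_ge m a with h1 | h1
    · simp only [hG]; rw [if_pos h1]
    · rw [hmid m h1 (by omega)]
      obtain rfl | rfl : m = a ∨ m = a + 1 := by omega
      · ring
      · push_cast; ring
  have hright : ∀ m, b - 1 ≤ m → G m = F b + ((m : ℝ) - b) * (F b - F (b - 1)) := fun m h => by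
    rcases lt_or_ge b m with h1 | h1
    · simp only [hG]; rw [if_neg (by omega), if_neg (by omega)]
    · rw [hmid m (by omega) h1]
      obtain rfl | rfl : m = b ∨ m = b - 1 := by omega
      · ring
      · rw [Nat.cast_sub (by omega)]; push_cast; ring
  refine ⟨G, hmid, fun m => ?_⟩
  by_cases h1 : m + 2 ≤ a + 1
  · rw [hleft _ h1, hleft (m + 1) (by omega), hleft m (by omega)]
    refine le_trans (le_of_eq ?_) hD
    rw [abs_eq_zero]; push_cast; ring
  · by_cases h2 : b - 1 ≤ m
    · rw [hright _ h2, hright (m + 1) (by omega), hright (m + 2) (by omega)]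
      refine le_trans (le_of_eq ?_) hD
      rw [abs_eq_zero]; push_cast; ring
    · rw [hmid m (by omega) (by omega), hmid (m + 1) (by omega) (by omega),
        hmid (m + 2) (by omega) (by omega)]
      exact hF m (by omega) (by omega)

/-- An eigenfunction of the conditional mean operator on the admissible particle numbers is
affine, unless its eigenvalue is bounded by the contraction rate `ε` of second differences. -/
theorem abs_le_or_affine_of_eigen {P : ℝ[X]} {H k N : ℕ} (hP : P.natDegree ≤ H)
    (hN : N ≤ (k + 2) * H) {ε : ℝ}
    (hε : ∀ M, M + 2 ≤ (k + 1) * H → ∀ (f : ℕ → ℝ) (D : ℝ),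
      (∀ m, |f (m + 2) - 2 * f (m + 1) + f m| ≤ D) → |condMeanDiff P k M f| ≤ ε * D)
    {F : ℕ → ℝ} {lam : ℝ}
    (hF : ∀ n, N - (k + 1) * H ≤ n → n ≤ min N H → lam * F n = condMean P k (N - n) F) :
    |lam| ≤ ε ∨ ∃ A B : ℝ, ∀ n, N - (k + 1) * H ≤ n → n ≤ min N H → F n = A + B * n := by
  set a := N - (k + 1) * H with ha
  set b := min N H with hb
  have hbN : b ≤ N := min_le_left _ _
  have hbH : b ≤ H := min_le_right _ _
  have hab : a ≤ b := le_min (Nat.sub_le _ _) (by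
    rw [Nat.succ_mul] at hN
    rw [ha, tsub_le_iff_left]; exact hN)
  rcases Nat.lt_or_ge b (a + 2) with hlt | hge
  · right
    -- At most two points are admissible, so any function is affine on them.
    refine ⟨F a - (F (a + 1) - F a) * a, F (a + 1) - F a, fun n h1 h2 => ?_⟩
    obtain rfl | rfl : n = a ∨ n = a + 1 := by omega
    · ring
    · push_cast; ring
  · obtain ⟨m₀, hm₀, hmax⟩ := Finset.exists_max_image (Finset.Icc a (b - 2))
      (fun m => |F (m + 2) - 2 * F (m + 1) + F m|) ⟨a, Finset.mem_Icc.2 ⟨le_rfl, by omega⟩⟩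
    rw [Finset.mem_Icc] at hm₀
    set D := |F (m₀ + 2) - 2 * F (m₀ + 1) + F m₀| with hD
    obtain ⟨G, hGF, hG⟩ := exists_extension_secondDiff_le F (a := a) (b := b) (by omega)
      (abs_nonneg _ : 0 ≤ D) fun m h1 h2 => hmax m (Finset.mem_Icc.2 ⟨h1, by omega⟩)
    have hev (n : ℕ) (h1 : a ≤ n) (h2 : n ≤ b) : lam * F n = condMean P k (N - n) G := by
      rw [hF n h1 h2]
      exact condMean_congr_of_admissible hP h2 fun m h3 h4 => (hGF m h3 h4).symm
    rcases (abs_nonneg (F (m₀ + 2) - 2 * F (m₀ + 1) + F m₀)).eq_or_lt' with h0 | hpos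
    · right
      refine ⟨G a - (G (a + 1) - G a) * a, G (a + 1) - G a, fun n h1 h2 => ?_⟩
      have := abs_sub_affine_le hG a n
      rw [h0, zero_div, zero_mul] at this
      have h3 := abs_eq_zero.1 (le_antisymm this (abs_nonneg _))
      rw [← hGF n h1 h2]
      linarith
    · left
      have h1 := hev m₀ hm₀.1 (by omega)
      have h2 := hev (m₀ + 1) (by omega) (by omega)
      have h3 := hev (m₀ + 2) (by omega) (by omega)
      have e1 : N - m₀ = N - (m₀ + 2) + 2 := by omega
      have e2 : N - (m₀ + 1) = N - (m₀ + 2) + 1 := by omega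
      rw [e1] at h1
      rw [e2] at h2
      -- The reversal `n ↦ N - n` preserves second differences. At the maximizer `m₀` the
      -- contraction gives `|lam| * D ≤ ε * D` with `D > 0`.
      have hd : condMeanDiff P k (N - (m₀ + 2)) G
          = lam * (F (m₀ + 2) - 2 * F (m₀ + 1) + F m₀) := by
        rw [condMeanDiff, ← h1, ← h2, ← h3]; ring
      have hle := hε (N - (m₀ + 2)) (by omega) G D hG
      rw [hd, abs_mul] at hle
      exact le_of_mul_le_mul_right hle hpos

/-! ### The canonical measure through polynomial coefficients. -/

namespace StickModel

/-- The weight of a single stick in the grand canonical measure. -/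
noncomputable def stickWeight (q : ℝ) {H : ℕ} (η : Stick H) : ℝ :=
  ∏ h : Fin H, q ^ (2 * ((h : ℕ) + 1) * (η h).toNat) / (1 + q ^ (2 * ((h : ℕ) + 1)))

theorem weight_eq_prod_stickWeight (q : ℝ) {L H : ℕ} (α : Config L H) :
    weight q α = ∏ i, stickWeight q (α i) := rfl

/-- The generating polynomial of the particle number, weighted by a function of the stick. -/
noncomputable def countPoly (q : ℝ) {H : ℕ} (g : Stick H → ℝ) : ℝ[X] :=
  ∑ η, monomial (stickCount η) (g η * stickWeight q η)

theorem stickWeight_pos {q : ℝ} (hq : 0 < q) {H : ℕ} (η : Stick H) : 0 < stickWeight q η :=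
  Finset.prod_pos fun _ _ => by positivity

theorem stickCount_le {H : ℕ} (η : Stick H) : stickCount η ≤ H := by
  have h : stickCount η ≤ ∑ _h : Fin H, 1 := Finset.sum_le_sum fun h _ => Bool.toNat_le (η h)
  simpa using h

theorem coeff_countPoly (q : ℝ) {H : ℕ} (g : Stick H → ℝ) (m : ℕ) :
    (countPoly q g).coeff m = ∑ η, if stickCount η = m then g η * stickWeight q η else 0 := by
  simp only [countPoly, finsetSum_coeff, coeff_monomial]

theorem coeff_countPoly_comp (q : ℝ) {H : ℕ} (f : ℕ → ℝ) (g : Stick H → ℝ) (m : ℕ) :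
    (countPoly q (fun η => f (stickCount η) * g η)).coeff m = f m * (countPoly q g).coeff m := by
  rw [coeff_countPoly, coeff_countPoly, Finset.mul_sum]
  refine Finset.sum_congr rfl fun η _ => ?_
  split_ifs with h
  · rw [h]; ring
  · simp

theorem countPoly_one (q : ℝ) (H : ℕ) :
    countPoly q (fun _ : Stick H => 1)
      = C (∏ h : Fin H, (1 + q ^ (2 * ((h : ℕ) + 1)))⁻¹) * stickPoly q H := by
  have h1 : ∀ h : Fin H, (1 + C ((q ^ 2) ^ ((h : ℕ) + 1)) * X : ℝ[X])
      = ∑ b : Bool, monomial b.toNat (q ^ (2 * ((h : ℕ) + 1) * b.toNat)) := by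
    intro h
    rw [Fintype.sum_bool, ← pow_mul]
    rw [C_mul_X_eq_monomial]; simp [add_comm]
  rw [stickPoly, sitePoly, Finset.prod_congr rfl fun h _ => h1 h,
    Finset.prod_univ_sum, Fintype.piFinset_univ, countPoly, Finset.mul_sum]
  refine Finset.sum_congr rfl fun η _ => ?_
  have h2 : ∏ h : Fin H, monomial (η h).toNat (q ^ (2 * ((h : ℕ) + 1) * (η h).toNat))
      = (monomial (stickCount η) (∏ h : Fin H, q ^ (2 * ((h : ℕ) + 1) * (η h).toNat)) : ℝ[X]) := by
    rw [stickCount, ← C_mul_X_pow_eq_monomial, map_prod, ← Finset.prod_pow_eq_pow_sum,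
      ← Finset.prod_mul_distrib]
    exact Finset.prod_congr rfl fun h _ => (C_mul_X_pow_eq_monomial).symm
  rw [h2, C_mul_monomial, one_mul, stickWeight, ← Finset.prod_mul_distrib]
  congr 1
  exact Finset.prod_congr rfl fun h _ => by rw [div_eq_inv_mul]

theorem prod_countPoly (q : ℝ) {L H : ℕ} (g : Fin L → Stick H → ℝ) :
    ∏ i, countPoly q (g i)
      = ∑ α : Config L H, monomial (totalCount α) ((∏ i, g i (α i)) * weight q α) := by
  simp only [countPoly]
  rw [Finset.prod_univ_sum, Fintype.piFinset_univ]
  refine Finset.sum_congr rfl fun α _ => ?_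
  simp only [totalCount, weight_eq_prod_stickWeight, ← C_mul_X_pow_eq_monomial,
    Finset.prod_mul_distrib, Finset.prod_pow_eq_pow_sum, map_prod, C_mul]

theorem integral_grandCanonical {q : ℝ} (hq : 0 < q) {L H : ℕ} (G : Config L H → ℝ) :
    ∫ α, G α ∂(grandCanonical q L H) = ∑ α, weight q α * G α := by
  rw [grandCanonical, integral_finsetSum_measure fun α _ =>
    (integrable_dirac (by simp)).smul_measure ENNReal.ofReal_ne_top]
  refine Finset.sum_congr rfl fun α _ => ?_
  have hw : 0 ≤ weight q α := Finset.prod_nonneg fun i _ => (stickWeight_pos hq (α i)).le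
  rw [integral_smul_measure, integral_dirac, ENNReal.toReal_ofReal hw, smul_eq_mul]

/-- Expectations of product functions factor into stick polynomials, with the total number `N`
selecting one coefficient. The case of all factors `1` supplies the normalization. -/
theorem integral_canonical {q : ℝ} (hq : 0 < q) {L H : ℕ} (N : ℕ) (g : Fin L → Stick H → ℝ) :
    ∫ α, ∏ i, g i (α i) ∂(canonical q L H N)
      = (∏ i, countPoly q (g i)).coeff N / (countPoly q (fun _ : Stick H => 1) ^ L).coeff N := by
  have hs : MeasurableSet {α : Config L H | totalCount α = N} := MeasurableSet.of_discrete
  have key (G : Fin L → Stick H → ℝ) : ∫ α in {α : Config L H | totalCount α = N}, ∏ i, G i (α i)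
      ∂(grandCanonical q L H) = (∏ i, countPoly q (G i)).coeff N := by
    rw [← integral_indicator hs, integral_grandCanonical hq, prod_countPoly, finsetSum_coeff]
    refine Finset.sum_congr rfl fun α _ => ?_
    rw [coeff_monomial]
    by_cases hα : totalCount α = N
    · rw [if_pos hα, Set.indicator_of_mem (show α ∈ {α : Config L H | totalCount α = N} from hα)]; ring
    · rw [if_neg hα, Set.indicator_of_notMem (show α ∉ {α : Config L H | totalCount α = N} from hα),
        mul_zero]
  have hone := key fun _ _ => 1
  simp only [Finset.prod_const_one, setIntegral_const, smul_eq_mul, mul_one, Finset.prod_const,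
    Finset.card_univ, Fintype.card_fin] at hone
  rw [canonical, ProbabilityTheory.cond, integral_smul_measure, key, ← hone, smul_eq_mul,
    ENNReal.toReal_inv, div_eq_inv_mul]
  rfl

variable {q : ℝ} {k H : ℕ}

theorem integral_canonical_pair (hq : 0 < q) (N : ℕ) (ψ φ : Stick H → ℝ) :
    ∫ α, ψ (α 0) * φ (α 1) ∂(canonical q (k + 2) H N)
      = (countPoly q ψ * countPoly q φ * countPoly q (fun _ : Stick H => 1) ^ k).coeff N
        / (countPoly q (fun _ : Stick H => 1) ^ (k + 2)).coeff N := by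
  have h := integral_canonical hq N
    (Fin.cons ψ (Fin.cons φ fun _ _ => 1) : Fin (k + 2) → Stick H → ℝ)
  simp only [Fin.prod_univ_succ, Fin.cons_zero, Fin.cons_succ, Finset.prod_const_one, mul_one,
    Finset.prod_const, Finset.card_univ, Fintype.card_fin] at h
  rw [mul_assoc, ← h]
  rfl

theorem integral_canonical_single (hq : 0 < q) (N : ℕ) (ψ : Stick H → ℝ) :
    ∫ α, ψ (α 0) ∂(canonical q (k + 2) H N)
      = (countPoly q ψ * countPoly q (fun _ : Stick H => 1) ^ (k + 1)).coeff N
        / (countPoly q (fun _ : Stick H => 1) ^ (k + 2)).coeff N := by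
  have h := integral_canonical_pair (k := k) hq N ψ fun _ => 1
  simp only [mul_one] at h
  rw [h, pow_succ' _ k, mul_assoc]

theorem countPoly_one_pow_coeff_pos (hq : 0 < q) {j N : ℕ} (hN : N ≤ j * H) :
    0 < (countPoly q (fun _ : Stick H => 1) ^ j).coeff N := by
  rw [countPoly_one, mul_pow, ← C_pow, coeff_C_mul]
  exact mul_pos (pow_pos (Finset.prod_pos fun h _ => by positivity) _)
    (coeff_stickPoly_pow_pos hq H j N hN)

theorem natDegree_countPoly_le (g : Stick H → ℝ) : (countPoly q g).natDegree ≤ H := by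
  rw [natDegree_le_iff_coeff_eq_zero]
  intro m hm
  rw [coeff_countPoly]
  refine Finset.sum_eq_zero fun η _ => if_neg ?_
  have := stickCount_le η
  omega

theorem condMean_countPoly_one (hq : 0 < q) (M : ℕ) (f : ℕ → ℝ) :
    condMean (countPoly q (fun _ : Stick H => 1)) k M f = condMean (stickPoly q H) k M f := by
  refine condMean_scale (c := ∏ h : Fin H, (1 + q ^ (2 * ((h : ℕ) + 1)))⁻¹) (a := 1)
    (Finset.prod_pos fun h _ => by positivity).ne' one_ne_zero ?_ k M f
  rw [countPoly_one, C_1, one_mul, comp_X]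

/-- The exact symmetry of the pair integral. -/
theorem integral_canonical_swap (hq : 0 < q) (N : ℕ) (ψ φ : Stick H → ℝ) :
    ∫ α, ψ (α 0) * φ (α 1) ∂(canonical q (k + 2) H N)
      = ∫ α, φ (α 0) * ψ (α 1) ∂(canonical q (k + 2) H N) := by
  rw [integral_canonical_pair hq, integral_canonical_pair hq, mul_comm (countPoly q ψ)]

/-- The second stick conditionally on the first holds `(N - n) / (k + 1)` particles on average. -/
theorem integral_canonical_count (hq : 0 < q) {N : ℕ} (φ : Stick H → ℝ) :
    ((k : ℝ) + 1) * ∫ α, φ (α 0) * (stickCount (α 1) : ℝ) ∂(canonical q (k + 2) H N)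
      = ∫ α, ((N : ℝ) - stickCount (α 0)) * φ (α 0) ∂(canonical q (k + 2) H N) := by
  set P := countPoly q (fun _ : Stick H => 1) with hP
  have hcount : countPoly q (fun η : Stick H => (stickCount η : ℝ)) = X * derivative P := by
    rw [← weigh_natCast]
    ext m
    have := coeff_countPoly_comp q (fun n => (n : ℝ)) (fun _ : Stick H => 1) m
    simp only [mul_one] at this
    rw [this, coeff_weigh, mul_comm]
  have hφ : countPoly q (fun η : Stick H => ((N : ℝ) - stickCount η) * φ η)
      = C (N : ℝ) * countPoly q φ - X * derivative (countPoly q φ) := by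
    rw [← weigh_natCast]
    ext m
    rw [coeff_countPoly_comp q (fun n => (N : ℝ) - n), coeff_sub, coeff_C_mul, coeff_weigh]
    ring
  rw [integral_canonical_pair hq N φ fun η => (stickCount η : ℝ),
    integral_canonical_single hq N fun η => ((N : ℝ) - stickCount η) * φ η, hcount, hφ,
    ← mul_div_assoc]
  congr 1
  -- `X * derivative` counts all particles; the Leibniz rule splits them between the first stick and
  -- `k + 1` equivalent others.
  have h1 : X * derivative (countPoly q φ * P ^ (k + 1))
      = X * derivative (countPoly q φ) * P ^ (k + 1)
        + C ((k : ℝ) + 1) * (countPoly q φ * (X * derivative P) * P ^ k) := by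
    rw [derivative_mul, derivative_pow]; simp; ring
  have h2 : (X * derivative (countPoly q φ * P ^ (k + 1))).coeff N
      = N * (countPoly q φ * P ^ (k + 1)).coeff N := by
    rw [← weigh_natCast, coeff_weigh, mul_comm]
  rw [h1, coeff_add, coeff_C_mul] at h2
  rw [sub_mul, coeff_sub, mul_assoc (C (N : ℝ)), coeff_C_mul]
  linarith

/-! ### Reduction of eigenfunctions to the particle number. -/

/-- The particle numbers of one stick compatible with `N` particles in `k + 2` sticks. -/
def Admissible (k H N n : ℕ) : Prop := N - (k + 1) * H ≤ n ∧ n ≤ min N H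

theorem ae_admissible (q : ℝ) (k H N : ℕ) :
    ∀ᵐ η ∂(stickMarginal q (k + 2) H N), Admissible k H N (stickCount η) := by
  rw [stickMarginal, ae_map_iff (measurable_of_finite _).aemeasurable MeasurableSet.of_discrete]
  have hs : MeasurableSet {α : Config (k + 2) H | totalCount α = N} := MeasurableSet.of_discrete
  filter_upwards [ae_cond_mem (μ := grandCanonical q (k + 2) H) hs] with α hα
  have hα' : totalCount α = N := hα
  rw [totalCount, Fin.sum_univ_succ] at hα'
  have h1 : ∑ i : Fin (k + 1), stickCount (α i.succ) ≤ ∑ _i : Fin (k + 1), H :=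
    Finset.sum_le_sum fun i _ => stickCount_le _
  rw [Finset.sum_const, Finset.card_univ, Fintype.card_fin, smul_eq_mul] at h1
  have h2 := stickCount_le (α 0)
  exact ⟨by omega, by omega⟩

/-- The eigenvalue equation evaluated at an admissible stick. -/
theorem eigen_pointwise (hq : 0 < q) {N : ℕ} (hN : N ≤ (k + 2) * H) {φ : Stick H → ℝ} {lam : ℝ}
    (hφ : ∀ g : Stick H → ℝ, ∫ α, g (α 0) * φ (α 1) ∂(canonical q (k + 2) H N)
      = lam * ∫ α, g (α 0) * φ (α 0) ∂(canonical q (k + 2) H N))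
    {η : Stick H} (hη : Admissible k H N (stickCount η)) :
    lam * φ η = (countPoly q φ * countPoly q (fun _ : Stick H => 1) ^ k).coeff (N - stickCount η)
      / (countPoly q (fun _ : Stick H => 1) ^ (k + 1)).coeff (N - stickCount η) := by
  classical
  set P := countPoly q (fun _ : Stick H => 1)
  have hZ : (P ^ (k + 2)).coeff N ≠ 0 := (countPoly_one_pow_coeff_pos hq hN).ne'
  obtain ⟨h1, h2⟩ := hη
  have hnN : stickCount η ≤ N := h2.trans (min_le_left _ _)
  have hZ1 : (P ^ (k + 1)).coeff (N - stickCount η) ≠ 0 :=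
    (countPoly_one_pow_coeff_pos hq (by omega)).ne'
  have hw := (stickWeight_pos hq η).ne'
  have hmono (c : ℝ) : countPoly q (fun ξ => if ξ = η then c else 0)
      = monomial (stickCount η) (c * stickWeight q η) := by
    rw [countPoly, Finset.sum_eq_single η]
    · simp
    · intro ξ _ hξ; simp [hξ]
    · simp
  have hco (c : ℝ) (Q : ℝ[X]) : (monomial (stickCount η) c * Q).coeff N
      = c * Q.coeff (N - stickCount η) := by
    conv_lhs => rw [← Nat.sub_add_cancel hnN, coeff_monomial_mul]
  -- Testing against the indicator of a single stick configuration makes the weak eigenvalue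
  -- equation pointwise.
  have h := hφ fun ξ => if ξ = η then 1 else 0
  have h3 : (fun α : Config (k + 2) H => (if α 0 = η then (1 : ℝ) else 0) * φ (α 0))
      = fun α => (fun ξ : Stick H => if ξ = η then φ η else 0) (α 0) := by
    ext α
    by_cases hα : α 0 = η <;> simp [hα]
  rw [h3, integral_canonical_pair hq N (fun ξ => if ξ = η then 1 else 0) φ,
    integral_canonical_single hq N (fun ξ => if ξ = η then φ η else 0), hmono, hmono,
    mul_assoc, hco, hco] at h
  rw [eq_div_iff hZ1]
  change _ / (P ^ (k + 2)).coeff N = lam * (_ / (P ^ (k + 2)).coeff N) at h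
  rw [← mul_div_assoc, div_left_inj' hZ] at h
  refine mul_left_cancel₀ hw ?_
  linear_combination -h

/-- Eigenfunctions of the transition kernel are affine in the particle number unless their
eigenvalue is small. -/
theorem eigen_trichotomy (hq : 0 < q) {N : ℕ} (hN : N ≤ (k + 2) * H) {ε : ℝ} (hε0 : 0 ≤ ε)
    (hε : ∀ M, M + 2 ≤ (k + 1) * H → ∀ (f : ℕ → ℝ) (D : ℝ),
      (∀ m, |f (m + 2) - 2 * f (m + 1) + f m| ≤ D) →
        |condMeanDiff (stickPoly q H) k M f| ≤ ε * D)
    {φ : Stick H → ℝ} {lam : ℝ}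
    (hφ : ∀ g : Stick H → ℝ, ∫ α, g (α 0) * φ (α 1) ∂(canonical q (k + 2) H N)
      = lam * ∫ α, g (α 0) * φ (α 0) ∂(canonical q (k + 2) H N)) :
    |lam| ≤ ε ∨ ∃ A B : ℝ, (∀ η : Stick H, Admissible k H N (stickCount η) →
      φ η = A + B * stickCount η) ∧
      (lam = 1 ∨ lam = -1 / ((k : ℝ) + 1) ∨
        ∀ η : Stick H, Admissible k H N (stickCount η) → φ η = 0) := by
  rcases eq_or_ne lam 0 with rfl | hlam
  · left; simpa using hε0
  set P := countPoly q (fun _ : Stick H => 1) with hP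
  have hPd : P.natDegree ≤ H := natDegree_countPoly_le _
  -- The right side of the pointwise equation involves `η` only through its count. Dividing by `lam`
  -- exhibits `φ` as a function of that count.
  set F : ℕ → ℝ := fun n => lam⁻¹ * ((countPoly q φ * P ^ k).coeff (N - n)
    / (P ^ (k + 1)).coeff (N - n)) with hF
  have hφF : ∀ η : Stick H, Admissible k H N (stickCount η) → φ η = F (stickCount η) := by
    intro η hη
    simp only [hF]
    rw [← eigen_pointwise hq hN hφ hη, inv_mul_cancel_left₀ hlam]
  have hev : ∀ n, N - (k + 1) * H ≤ n → n ≤ min N H → lam * F n = condMean P k (N - n) F := by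
    intro n h1 h2
    simp only [hF]
    rw [mul_inv_cancel_left₀ hlam, condMean]
    congr 1
    rw [coeff_mul, coeff_mul]
    refine Finset.sum_congr rfl fun ij hij => ?_
    rw [Finset.HasAntidiagonal.mem_antidiagonal] at hij
    by_cases hj : ij.2 ≤ k * H
    · congr 1
      rw [coeff_weigh, hP, coeff_countPoly, coeff_countPoly, Finset.sum_mul]
      refine Finset.sum_congr rfl fun η _ => ?_
      split_ifs with hη
      · have hadm : Admissible k H N (stickCount η) := by
          have := stickCount_le η
          refine ⟨?_, le_min (by omega) this⟩
          rw [Nat.succ_mul]; omega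
        rw [hφF η hadm, hη]; ring
      · simp
    · rw [coeff_eq_zero_of_natDegree_lt ((natDegree_pow_le_of_le k hPd).trans_lt (not_le.1 hj))]
      simp
  have hε' : ∀ M, M + 2 ≤ (k + 1) * H → ∀ (f : ℕ → ℝ) (D : ℝ),
      (∀ m, |f (m + 2) - 2 * f (m + 1) + f m| ≤ D) → |condMeanDiff P k M f| ≤ ε * D := by
    intro M hM f D hf
    have := hε M hM f D hf
    simpa only [condMeanDiff, hP, condMean_countPoly_one hq] using this
  rcases abs_le_or_affine_of_eigen hPd hN hε' hev with h | ⟨A, B, hAB⟩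
  · exact Or.inl h
  right
  refine ⟨A, B, fun η hη => by rw [hφF η hη, hAB _ hη.1 hη.2], ?_⟩
  have hlin : ∀ n, N - (k + 1) * H ≤ n → n ≤ min N H →
      lam * (A + B * n) = A + B * (((N : ℝ) - n) / (k + 1)) := by
    intro n h1 h2
    have h3 := hev n h1 h2
    rw [condMean_congr_of_admissible hPd h2 (F := F) (G := fun m => A + B * m) hAB,
      condMean_affine (countPoly_one_pow_coeff_pos hq (by omega)).ne', hAB n h1 h2,
      Nat.cast_sub (h2.trans (min_le_left _ _))] at h3
    exact h3
  have hk : (k : ℝ) + 1 ≠ 0 := by positivity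
  -- With a nonzero slope and two consecutive admissible numbers, comparing slopes fixes `lam`.
  -- Otherwise `F` is constant there, so `lam = 1` or `F` vanishes.
  by_cases hex : B ≠ 0 ∧ N - (k + 1) * H + 1 ≤ min N H
  · right; left
    have e1 := hlin _ le_rfl (by omega)
    have e2 := hlin _ (Nat.le_succ _) hex.2
    push_cast at e2
    have e3 : lam * B = -B / (k + 1) := by
      have : lam * B = B * (((N : ℝ) - ((N - (k + 1) * H : ℕ) + 1)) / (k + 1))
          - B * (((N : ℝ) - (N - (k + 1) * H : ℕ)) / (k + 1)) := by linear_combination e2 - e1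
      rw [this]; field_simp; ring
    have : lam = (-B / (k + 1)) / B := by rw [← e3, mul_div_assoc, div_self hex.1, mul_one]
    rw [this, div_div, mul_comm ((k : ℝ) + 1), ← div_div, neg_div, div_self hex.1]
  · have hconst : ∀ n, N - (k + 1) * H ≤ n → n ≤ min N H →
        F n = A + B * (N - (k + 1) * H : ℕ) := by
      intro n h1 h2
      rw [hAB n h1 h2]
      rcases not_and_or.1 hex with h | h
      · rw [not_not] at h; rw [h]; ring
      · rw [show n = N - (k + 1) * H by omega]
    have ha : N - (k + 1) * H ≤ min N H := by
      rw [Nat.succ_mul] at hN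
      exact le_min (Nat.sub_le _ _) (tsub_le_iff_left.2 hN)
    have h1 := hev _ le_rfl ha
    rw [condMean_congr_of_admissible hPd ha hconst,
      condMean_const (countPoly_one_pow_coeff_pos hq (by omega)).ne', hconst _ le_rfl ha] at h1
    rcases eq_or_ne (A + B * (N - (k + 1) * H : ℕ)) 0 with h0 | h0
    · exact Or.inr (Or.inr fun η hη => by rw [hφF η hη, hconst _ hη.1 hη.2, h0])
    · exact Or.inl (mul_right_cancel₀ h0 (by rw [h1, one_mul]))

end StickModel

/-! ### The operator on the Hilbert space. -/

namespace StickModel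

instance finiteDimensional_stickL2 (q : ℝ) (L H N : ℕ) [NeZero L] :
    FiniteDimensional ℝ (StickL2 q L H N) := by
  let T : (Stick H → ℝ) →ₗ[ℝ] StickL2 q L H N :=
    { toFun := fun f => MemLp.toLp f MemLp.of_discrete
      map_add' := fun f g => MemLp.toLp_add _ _
      map_smul' := fun c f => MemLp.toLp_const_smul c _ }
  refine Module.Finite.of_surjective T fun φ => ⟨φ, ?_⟩
  exact Lp.toLp_coeFn φ (Lp.memLp φ)

section

variable {q : ℝ} {k H N : ℕ}

theorem comp_proj_ae_eq {L : ℕ} [NeZero L] {f g : Stick H → ℝ} (i : Fin L)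
    (h : f =ᵐ[stickMarginal q L H N] g) :
    (fun α : Config L H => f (α i)) =ᵐ[canonical q L H N] fun α => g (α i) :=
  (measurePreserving_proj q L H N i).quasiMeasurePreserving.ae_eq_comp h

theorem integral_stickMarginal {L : ℕ} [NeZero L] (f : Stick H → ℝ) :
    ∫ η, f η ∂(stickMarginal q L H N) = ∫ α, f (α 0) ∂(canonical q L H N) :=
  integral_map (measurable_of_finite _).aemeasurable AEStronglyMeasurable.of_discrete

theorem inner_eq_integral {L : ℕ} [NeZero L] (φ ψ : StickL2 q L H N) :
    inner ℝ φ ψ = ∫ α, φ (α 0) * ψ (α 0) ∂(canonical q L H N) := by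
  rw [L2.inner_def, ← integral_stickMarginal fun η => φ η * ψ η]
  congr 1
  ext η
  simp [mul_comm]

theorem inner_toLp_stickOperator (g : Stick H → ℝ) (φ : StickL2 q (k + 2) H N) :
    inner ℝ (MemLp.toLp g MemLp.of_discrete : StickL2 q (k + 2) H N)
        (stickOperator q (k + 2) H N φ)
      = ∫ α, g (α 0) * φ (α 1) ∂(canonical q (k + 2) H N) := by
  rw [inner_stickOperator]
  refine integral_congr_ae ?_
  filter_upwards [comp_proj_ae_eq (N := N) (0 : Fin (k + 2))
    (MemLp.coeFn_toLp (f := g) (μ := stickMarginal q (k + 2) H N) (p := 2) MemLp.of_discrete)]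
    with α hα
  rw [hα]

theorem inner_toLp (g : Stick H → ℝ) (φ : StickL2 q (k + 2) H N) :
    inner ℝ (MemLp.toLp g MemLp.of_discrete : StickL2 q (k + 2) H N) φ
      = ∫ α, g (α 0) * φ (α 0) ∂(canonical q (k + 2) H N) := by
  rw [inner_eq_integral]
  refine integral_congr_ae ?_
  filter_upwards [comp_proj_ae_eq (N := N) (0 : Fin (k + 2))
    (MemLp.coeFn_toLp (f := g) (μ := stickMarginal q (k + 2) H N) (p := 2) MemLp.of_discrete)]
    with α hα
  rw [hα]

theorem stickOperator_isSymmetric (hq : 0 < q) :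
    (stickOperator q (k + 2) H N : StickL2 q (k + 2) H N →ₗ[ℝ] StickL2 q (k + 2) H N).IsSymmetric := by
  intro φ ψ
  rw [real_inner_comm]
  change inner ℝ ψ (stickOperator q (k + 2) H N φ) = inner ℝ φ (stickOperator q (k + 2) H N ψ)
  rw [inner_stickOperator, inner_stickOperator]
  exact integral_canonical_swap hq N ψ φ

/-- The functions orthogonal to the constants and to the particle number. -/
noncomputable def centered (q : ℝ) (k H N : ℕ) : Submodule ℝ (StickL2 q (k + 2) H N) :=
  (Submodule.span ℝ {(MemLp.toLp (fun _ => 1) MemLp.of_discrete : StickL2 q (k + 2) H N),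
    centeredCount q (k + 2) H N})ᗮ

theorem mem_centered (φ : StickL2 q (k + 2) H N) :
    φ ∈ centered q k H N ↔ ∫ η, φ η ∂(stickMarginal q (k + 2) H N) = 0 ∧
      inner ℝ φ (centeredCount q (k + 2) H N) = 0 := by
  have h1 : inner ℝ (MemLp.toLp (fun _ => 1) MemLp.of_discrete : StickL2 q (k + 2) H N) φ
      = ∫ η, φ η ∂(stickMarginal q (k + 2) H N) := by
    rw [inner_toLp, integral_stickMarginal]
    simp
  rw [centered, Submodule.mem_orthogonal]
  constructor
  · intro h
    refine ⟨?_, ?_⟩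
    · rw [← h1]; exact h _ (Submodule.subset_span (by simp))
    · rw [real_inner_comm]; exact h _ (Submodule.subset_span (by simp))
  · rintro ⟨h2, h3⟩ u hu
    induction hu using Submodule.span_induction with
    | mem x hx =>
      rcases hx with rfl | rfl
      · rw [h1, h2]
      · rw [real_inner_comm, h3]
    | zero => simp
    | add x y _ _ hx hy => rw [inner_add_left, hx, hy, add_zero]
    | smul a x _ hx => rw [inner_smul_left, hx, mul_zero]

/-- By symmetry it suffices to pair `φ` on the first stick with `1` or `n` on the second.
Conditionally on the first stick the latter averages to `(N - n) / (k + 1)`, again in the span to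
which `φ` is orthogonal. -/
theorem stickOperator_mem_centered (hq : 0 < q) (φ : StickL2 q (k + 2) H N)
    (hφ : φ ∈ centered q k H N) : stickOperator q (k + 2) H N φ ∈ centered q k H N := by
  rw [mem_centered] at hφ
  obtain ⟨h1, h2⟩ := hφ
  rw [integral_stickMarginal] at h1
  have h3 : ∫ α, φ (α 1) ∂(canonical q (k + 2) H N) = 0 := by
    have := integral_canonical_swap (k := k) hq N (fun _ => 1) φ
    simpa [h1] using this
  rw [mem_centered]
  constructor
  · have h := inner_toLp_stickOperator (fun _ => 1) φ
    rw [inner_toLp] at h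
    rw [integral_stickMarginal]
    simpa [h3] using h
  · rw [real_inner_comm, centeredCount, inner_toLp_stickOperator]
    have h4 : ∀ i : Fin (k + 2), (fun α : Config (k + 2) H => ((stickCount (α 0) : ℝ)
        - (N : ℝ) / ((k + 2 : ℕ) : ℝ)) * φ (α i))
        = fun α => (stickCount (α 0) : ℝ) * φ (α i) - (N : ℝ) / ((k + 2 : ℕ) : ℝ) * φ (α i) := by
      intro i; ext α; ring
    have h5 : ∫ α, (stickCount (α 0) : ℝ) * φ (α 0) ∂(canonical q (k + 2) H N) = 0 := by
      rw [real_inner_comm, centeredCount, inner_toLp, h4,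
        integral_sub Integrable.of_finite Integrable.of_finite, integral_const_mul, h1] at h2
      linarith
    rw [h4, integral_sub Integrable.of_finite Integrable.of_finite, integral_const_mul, h3,
      mul_zero, sub_zero]
    have h6 := integral_canonical_swap (k := k) hq N (fun η => (stickCount η : ℝ)) φ
    have h7 := integral_canonical_count (k := k) hq (N := N) φ
    have h8 : (fun α : Config (k + 2) H => ((N : ℝ) - stickCount (α 0)) * φ (α 0))
        = fun α => (N : ℝ) * φ (α 0) - (stickCount (α 0) : ℝ) * φ (α 0) := by
      ext α; ring
    rw [h8, integral_sub Integrable.of_finite Integrable.of_finite, integral_const_mul, h1, h5,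
      mul_zero, sub_zero] at h7
    rw [h6]
    exact (mul_eq_zero.1 h7).resolve_left (by positivity)

/-- An eigenvector of the stick operator with a large eigenvalue is affine in the particle number,
and its eigenvalue is one of the two explicit ones. -/
theorem eigenvector_trichotomy (hq : 0 < q) (hN : N ≤ (k + 2) * H) {ε : ℝ} (hε0 : 0 ≤ ε)
    (hε : ∀ M, M + 2 ≤ (k + 1) * H → ∀ (f : ℕ → ℝ) (D : ℝ),
      (∀ m, |f (m + 2) - 2 * f (m + 1) + f m| ≤ D) →
        |condMeanDiff (stickPoly q H) k M f| ≤ ε * D)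
    {φ : StickL2 q (k + 2) H N} (hφ0 : φ ≠ 0) {lam : ℝ}
    (hφ : stickOperator q (k + 2) H N φ = lam • φ) :
    |lam| ≤ ε ∨ (lam = 1 ∨ lam = -1 / ((k : ℝ) + 1)) ∧ φ ∉ centered q k H N := by
  have hae := ae_admissible q k H N
  have hev : ∀ g : Stick H → ℝ, ∫ α, g (α 0) * φ (α 1) ∂(canonical q (k + 2) H N)
      = lam * ∫ α, g (α 0) * φ (α 0) ∂(canonical q (k + 2) H N) := by
    intro g
    rw [← inner_toLp_stickOperator, hφ, inner_smul_right, inner_toLp]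
  rcases eigen_trichotomy hq hN hε0 hε hev with h | ⟨A, B, hAB, h⟩
  · exact Or.inl h
  right
  constructor
  · rcases h with h | h | h
    · exact Or.inl h
    · exact Or.inr h
    · refine absurd ?_ hφ0
      rw [Lp.eq_zero_iff_ae_eq_zero]
      filter_upwards [hae] with η hη using h η hη
  · intro hmem
    rw [mem_centered] at hmem
    obtain ⟨h1, h2⟩ := hmem
    refine hφ0 (inner_self_eq_zero (𝕜 := ℝ).1 ?_)
    rw [integral_stickMarginal] at h1
    rw [real_inner_comm, centeredCount, inner_toLp] at h2
    rw [inner_eq_integral]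
    -- An affine `φ` is a combination of `1` and `n̄`, so its squared norm is a combination of two
    -- vanishing pairings.
    have h3 : (fun α : Config (k + 2) H => φ (α 0) * φ (α 0)) =ᵐ[canonical q (k + 2) H N]
        fun α => (A + B * ((N : ℝ) / ((k + 2 : ℕ) : ℝ))) * φ (α 0)
          + B * (((stickCount (α 0) : ℝ) - (N : ℝ) / ((k + 2 : ℕ) : ℝ)) * φ (α 0)) := by
      have h4 : (φ : Stick H → ℝ) =ᵐ[stickMarginal q (k + 2) H N]
          fun η => A + B * stickCount η := by
        filter_upwards [hae] with η hη using hAB η hη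
      filter_upwards [comp_proj_ae_eq (0 : Fin (k + 2)) h4] with α hα
      rw [hα]; ring
    rw [integral_congr_ae h3, integral_add Integrable.of_finite Integrable.of_finite,
      integral_const_mul, integral_const_mul, h1, h2]
    ring

end

end StickModel

/-! ### Finite-dimensional spectral theory and conclusion. -/

theorem abs_inner_le_of_eigenvalues_le {E : Type*} [NormedAddCommGroup E] [InnerProductSpace ℝ E]
    [FiniteDimensional ℝ E] {T : E →ₗ[ℝ] E} (hT : T.IsSymmetric) {ε : ℝ}
    (hε : ∀ (lam : ℝ) (v : E), v ≠ 0 → T v = lam • v → |lam| ≤ ε) (v : E) :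
    |inner ℝ v (T v)| ≤ ε * inner ℝ v v := by
  set b := hT.eigenvectorBasis rfl
  have hb : ∀ i, T (b i) = hT.eigenvalues rfl i • b i := fun i => hT.apply_eigenvectorBasis rfl i
  rw [← b.sum_inner_mul_inner v (T v), ← b.sum_inner_mul_inner v v, Finset.mul_sum]
  refine (Finset.abs_sum_le_sum_abs _ _).trans (Finset.sum_le_sum fun i _ => ?_)
  have h1 : inner ℝ (b i) (T v) = hT.eigenvalues rfl i * inner ℝ (b i) v := by
    rw [← hT, hb, real_inner_smul_left]
  rw [h1, real_inner_comm (b i) v, mul_left_comm, abs_mul, abs_mul_self]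
  refine mul_le_mul_of_nonneg_right (hε _ (b i) ?_ (hb i)) (mul_self_nonneg _)
  exact b.orthonormal.ne_zero i

theorem exists_eigenvector_of_mem_spectrum {E : Type*} [NormedAddCommGroup E] [NormedSpace ℝ E]
    [FiniteDimensional ℝ E] {T : E →L[ℝ] E} {lam : ℝ} (h : lam ∈ spectrum ℝ T) :
    ∃ v : E, v ≠ 0 ∧ T v = lam • v := by
  have := FiniteDimensional.complete ℝ E
  rw [spectrum.mem_iff, ContinuousLinearMap.isUnit_iff_bijective] at h
  set S := algebraMap ℝ (E →L[ℝ] E) lam - T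
  have hinj : ¬ Function.Injective (S : E →ₗ[ℝ] E) := fun hi =>
    h ⟨hi, LinearMap.injective_iff_surjective.1 hi⟩
  rw [← LinearMap.ker_eq_bot, ← ne_eq, Submodule.ne_bot_iff] at hinj
  obtain ⟨v, hv, hv0⟩ := hinj
  refine ⟨v, hv0, ?_⟩
  have h1 : S v = 0 := hv
  simp only [S, sub_apply, ContinuousLinearMap.algebraMap_apply] at h1
  exact (sub_eq_zero.1 h1).symm

/-- For every `q ∈ (0,1)` there are constants `δ > 0`, `k`, `L₀`, not depending on the number of
particles `N` and on the height `H`, with the stated bound on the quadratic form of `K` and the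
resulting localization of its spectrum, for all `L ≥ L₀`. -/
theorem theorem2p1 (q : ℝ) (hq0 : 0 < q) (hq1 : q < 1) :
    ∃ (δ k : ℝ) (L₀ : ℕ), 0 < δ ∧
      ∀ (L H N : ℕ) [L.AtLeastTwo], L₀ ≤ L → N ≤ L * H →
        (∀ φ : StickModel.StickL2 q L H N,
          ∫ η, φ η ∂(StickModel.stickMarginal q L H N) = 0 →
          inner ℝ φ (StickModel.centeredCount q L H N) = 0 →
          |inner ℝ φ (StickModel.stickOperator q L H N φ)| ≤
            k * (L : ℝ) ^ (-1 - δ) * inner ℝ φ φ) ∧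
        (∀ x ∈ spectrum ℝ (StickModel.stickOperator q L H N),
          x = 1 ∨ x = -1 / ((L : ℝ) - 1) ∨ |x| ≤ k * (L : ℝ) ^ (-1 - δ)) := by
  obtain ⟨κ, τ₀, hκ, hτ₀, hmain⟩ := exists_condMeanDiff_stickPoly_le hq0 hq1
  -- The rate is `κ (k + 1) ^ (-4/3)`; since `L = k + 2 ≤ 2 (k + 1)`, passing to `L` costs `2 ^
  -- (4/3)`. The threshold `L₀` makes `k + 1 ≥ τ₀ ^ 3`.
  refine ⟨1 / 3, κ * 2 ^ (4 / 3 : ℝ), ⌈τ₀ ^ 3⌉₊ + 1, by norm_num, ?_⟩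
  intro L H N hL2 hL hN
  obtain ⟨k, rfl⟩ : ∃ k, L = k + 2 := ⟨L - 2, by have := hL2.prop; omega⟩
  set τ : ℝ := ((k : ℝ) + 1) ^ (1 / 3 : ℝ) with hτ
  have hk1 : (0 : ℝ) < (k : ℝ) + 1 := by positivity
  have hτ3 : τ ^ 3 = (k : ℝ) + 1 := by
    rw [hτ, ← Real.rpow_natCast, ← Real.rpow_mul hk1.le]; norm_num
  have hτ0 : 0 < τ := Real.rpow_pos_of_pos hk1 _
  have hττ : τ₀ ≤ τ := by
    refine le_of_pow_le_pow_left₀ (n := 3) (by norm_num) hτ0.le ?_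
    rw [hτ3]
    have h1 : (⌈τ₀ ^ 3⌉₊ : ℝ) ≤ (k : ℝ) + 1 := by exact_mod_cast (by omega : ⌈τ₀ ^ 3⌉₊ ≤ k + 1)
    exact (Nat.le_ceil _).trans h1
  set ε : ℝ := κ / τ ^ 4 with hε
  have hε0 : 0 ≤ ε := by positivity
  have hεL : ε ≤ κ * 2 ^ (4 / 3 : ℝ) * ((k + 2 : ℕ) : ℝ) ^ (-1 - 1 / 3 : ℝ) := by
    have hτ4 : τ ^ 4 = ((k : ℝ) + 1) ^ (4 / 3 : ℝ) := by
      rw [hτ, ← Real.rpow_natCast, ← Real.rpow_mul hk1.le]; norm_num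
    have hle : ((k + 2 : ℕ) : ℝ) ^ (4 / 3 : ℝ) ≤ 2 ^ (4 / 3 : ℝ) * τ ^ 4 := by
      rw [hτ4, ← Real.mul_rpow (by norm_num) hk1.le]
      refine Real.rpow_le_rpow (by positivity) ?_ (by norm_num)
      push_cast; linarith
    have hp : (0 : ℝ) < ((k + 2 : ℕ) : ℝ) ^ (4 / 3 : ℝ) := by positivity
    rw [show (-1 - 1 / 3 : ℝ) = -(4 / 3) by norm_num, Real.rpow_neg (by positivity),
      ← div_eq_mul_inv, hε, div_le_div_iff₀ (by positivity) hp, mul_assoc]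
    exact mul_le_mul_of_nonneg_left hle hκ.le
  have hdiff : ∀ M, M + 2 ≤ (k + 1) * H → ∀ (f : ℕ → ℝ) (D : ℝ),
      (∀ m, |f (m + 2) - 2 * f (m + 1) + f m| ≤ D) →
        |condMeanDiff (stickPoly q H) k M f| ≤ ε * D := by
    intro M hM f D hf
    rw [hε, div_mul_eq_mul_div]
    exact hmain H k M τ hττ hτ3 hM f D hf
  constructor
  · intro φ h1 h2
    have hmem : φ ∈ StickModel.centered q k H N := (StickModel.mem_centered φ).2 ⟨h1, h2⟩
    have hsym := (StickModel.stickOperator_isSymmetric (k := k) (H := H) (N := N)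
      hq0).restrict_invariant (StickModel.stickOperator_mem_centered hq0)
    -- On the centered subspace the two explicit eigenvalues are excluded unless they already
    -- satisfy the bound, because the trichotomy places their eigenvectors outside it.
    have := abs_inner_le_of_eigenvalues_le hsym (ε := ε) (fun lam v hv0 hv => ?_) ⟨φ, hmem⟩
    · refine this.trans (mul_le_mul_of_nonneg_right hεL ?_)
      exact real_inner_self_nonneg
    · have hv' : StickModel.stickOperator q (k + 2) H N (v : StickModel.StickL2 q (k + 2) H N)
          = lam • (v : StickModel.StickL2 q (k + 2) H N) := congrArg Subtype.val hv
      exact (StickModel.eigenvector_trichotomy hq0 hN hε0 hdiff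
        (fun h => hv0 (Subtype.ext h)) hv').resolve_right fun h => h.2 v.2
  · intro x hx
    obtain ⟨v, hv0, hv⟩ := exists_eigenvector_of_mem_spectrum hx
    rcases StickModel.eigenvector_trichotomy hq0 hN hε0 hdiff hv0 hv with h | ⟨h | h, -⟩
    · exact Or.inr (Or.inr (h.trans hεL))
    · exact Or.inl h
    · right; left
      rw [h]; push_cast; congr 1; ring
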